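/- **Setting.** Let $p>1$, $g(u)=-|u|^{p-1}u$, and let $\rho,r\ge 0$ satisfy $r+\frac{\rho}{2}\ge 1$ and $(\rho,r)\ne(0,1)$. Put $s_0=\frac r2+\frac\rho2$ (so $s_0>\frac12$) and assume $g\in C^{[s_0]+1}(\mathbb R)$, where $[\cdot]$ is the integer part. Let $L$ and $B$ be the Fourier multipliers, acting on real-valued functions of $x\in\mathbb R$, with smooth real even symbols $l(\xi)$, $b(\xi)$ such that for some positive constants $c_1,\dots,c_4$ and all $\xi\in\mathbb R$ $$c_1^2(1+\xi^2)^{\rho/2}\le l(\xi)\le c_2^2(1+\xi^2)^{\rho/2},\qquad c_3^2(1+\xi^2)^{-r/2}\le b(\xi)\le c_4^2(1+\xi^2)^{-r/2}.$$ The equation $u_{tt}-Lu_{xx}=B(g(u))_{xx}$ is written as the Cauchy problem $$u_t=w_x,\qquad w_t=Lu_x+B(g(u))_x\quad(t>0),\qquad u(0)=u_0,\quad w(0)=w_0,$$ for real-valued $u,w$. For $T\in(0,\infty]$, a solution on $[0,T)$ is a pair $(u,w)\in C([0,T),H^{s_0}(\mathbb R))\times C([0,T),H^{s_0-\rho/2}(\mathbb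 R))$ with these initial values which satisfies both equations for $0<t<T$ in the sense of tempered distributions in $x$. $T_{\max}$ is the supremum of all $T$ for which a solution on $[0,T)$ exists. For $(u,w)\in H^{s_0}(\mathbb R)\times H^{s_0-\rho/2}(\mathbb R)$ put $$\mathcal I(u)=\tfrac12\int_{\mathbb R}(B^{-1/2}L^{1/2}u)^2dx,\qquad \mathcal Q(u)=\int_{\mathbb R}|u|^{p+1}dx,$$ $$\mathcal E(u,w)=\tfrac12\|B^{-1/2}w\|_{L^2}^2+\mathcal I(u)-\tfrac1{p+1}\mathcal Q(u),$$ $$d=\inf\{\mathcal E(u,w):(u,w)\in H^{s_0}\times H^{s_0-\rho/2},\ u\ne0,\ 2\mathcal I(u)-\mathcal Q(u)=0\},$$ $$\Sigma_+=\{(u,w)\in H^{s_0}\times H^{s_0-\rho/2}:\ \mathcal E(u,w)<d,\ 2\mathcal I(u)-\mathcal Q(u)\ge0\}.$$ **Theorem 3.3.** Let $(u_0,w_0)\in\Sigma_+$. Then the solution of the Cauchy problem with initial data $(u_0,w_0)$ is global: $T_{\max}=\infty$, there is a solution $(u,w)$ on $[0,\infty)$, and every solution on an interval $[0,T)$, $T\in(0,\infty]$,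 with the same initial data coincides with it on $[0,T)$. -/

import Mathlib

open MeasureTheory
open scoped FourierTransform SchwartzMap ContDiff

namespace NonlocalWave

noncomputable section

/-- The space of real-valued square-integrable functions on the line. -/
abbrev RealL2 : Type := Lp ℝ 2 (volume : Measure ℝ)

/-- The space of complex-valued square-integrable functions on the line. -/
abbrev ComplexL2 : Type := Lp ℂ 2 (volume : Measure ℝ)

/-- A real-valued `L²` function, seen as a complex-valued one. -/
def complexify (u : RealL2) : ComplexL2 := Complex.ofRealCLM.compLp u

/-- The Fourier transform `û(ξ) = ∫ u(x) exp(-i ξ x) dx` of a real `L²` function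
(extended to `L²` by continuity). Mathlib's `𝓕` has the kernel `exp(-2π i x η)`, hence the
rescaling `ξ = 2π η`. -/
def hat (u : RealL2) (ξ : ℝ) : ℂ := (𝓕 (complexify u) : ComplexL2) (ξ / (2 * Real.pi))

/-- `u ∈ H^s(ℝ)` for a real-valued `u ∈ L²(ℝ)` (used for `s ≥ 0` only):
`∫ (1 + ξ²)^s |û(ξ)|² dξ < ∞`. -/
def MemSobolev (s : ℝ) (u : RealL2) : Prop :=
  MemLp (fun ξ : ℝ => (((1 + ξ ^ 2) ^ (s / 2) : ℝ) : ℂ) * hat u ξ) 2 volume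

/-- The norm of `H^s(ℝ)`: `‖u‖² = ∫ (1 + ξ²)^s |û(ξ)|² dξ`. -/
def sobolevNorm (s : ℝ) (u : RealL2) : ℝ :=
  Real.sqrt (∫ ξ : ℝ, (1 + ξ ^ 2) ^ s * ‖hat u ξ‖ ^ 2)

/-- `m` is the symbol of an elliptic coercive operator of order `k`: it is smooth and
comparable to `(1 + ξ²)^(k/2)`. The symbol is even because the operator acts
on real-valued functions. -/
structure IsEllipticSymbol (m : ℝ → ℝ) (k : ℝ) : Prop where
  smooth : ContDiff ℝ ∞ m
  even : ∀ ξ, m (-ξ) = m ξ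
  coercive : ∃ c C : ℝ, 0 < c ∧ 0 < C ∧ ∀ ξ : ℝ,
    c ^ 2 * (1 + ξ ^ 2) ^ (k / 2) ≤ m ξ ∧ m ξ ≤ C ^ 2 * (1 + ξ ^ 2) ^ (k / 2)

open Classical in
/-- The Fourier multiplier with symbol `m(ξ)`, `ξ = 2π η`, where it maps `u` into `L²`
(the value is `0` by convention where it does not). -/
def multiplier (m : ℝ → ℝ) (u : RealL2) : ComplexL2 :=
  if h : MemLp (fun η : ℝ => (m (2 * Real.pi * η) : ℂ) * (𝓕 (complexify u) : ComplexL2) η)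
      2 volume
  then 𝓕⁻ (h.toLp _) else 0

/-- The pairing `∫ (M u)(x) φ(x) dx` of the tempered distribution `M u`, where `M` is the Fourier
multiplier with symbol `m(ξ)`, `ξ = 2π η`, with a Schwartz function `φ`; here `m` is
polynomially bounded and `M u` need not be a function. -/
def multiplierPairing (m : ℝ → ℝ) (u : RealL2) (φ : 𝓢(ℝ, ℂ)) : ℂ :=
  ∫ η : ℝ, (m (2 * Real.pi * η) : ℂ) * (𝓕 (complexify u) : ComplexL2) η * (𝓕⁻ φ : 𝓢(ℝ, ℂ)) η

/-- The pairing `∫ u(x) φ(x) dx`. -/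
def pairing (u : RealL2) (φ : 𝓢(ℝ, ℂ)) : ℂ := ∫ x : ℝ, (u x : ℂ) * φ x

/-- The power nonlinearity `g(v) = -|v|^(p-1) v`. -/
def g (p : ℝ) (v : ℝ) : ℝ := -|v| ^ (p - 1) * v

open Classical in
/-- The function `g(u)` as an element of `L²`. It does lie in `L²` when `p > 1` and
`u ∈ H^s` with `s > 1/2`, since then `u` is bounded; the value is `0` by convention otherwise. -/
def gL2 (p : ℝ) (u : RealL2) : RealL2 :=
  if h : MemLp (fun x : ℝ => g p (u x)) 2 volume then h.toLp _ else 0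

/-- `I(u) = 1/2 ∫ (B^(-1/2) L^(1/2) u)² dx`. -/
def I (l b : ℝ → ℝ) (u : RealL2) : ℝ :=
  1 / 2 * ‖multiplier (fun ξ => b ξ ^ (-(1 / 2) : ℝ) * l ξ ^ (1 / 2 : ℝ)) u‖ ^ 2

/-- `Q(u) = ∫ |u|^(p+1) dx`. -/
def Q (p : ℝ) (u : RealL2) : ℝ := ∫ x : ℝ, |u x| ^ (p + 1)

/-- The energy
`E(u, w) = 1/2 ‖B^(-1/2) w‖² + 1/2 ‖B^(-1/2) L^(1/2) u‖² - 1/(p+1) ∫ |u|^(p+1) dx`. -/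
def energy (l b : ℝ → ℝ) (p : ℝ) (u w : RealL2) : ℝ :=
  1 / 2 * ‖multiplier (fun ξ => b ξ ^ (-(1 / 2) : ℝ)) w‖ ^ 2
    + 1 / 2 * ‖multiplier (fun ξ => b ξ ^ (-(1 / 2) : ℝ) * l ξ ^ (1 / 2 : ℝ)) u‖ ^ 2
    - 1 / (p + 1) * Q p u

/-- The exponent `s₀ = r/2 + ρ/2`. -/
def s₀ (ρ r : ℝ) : ℝ := r / 2 + ρ / 2

/-- `(u, w) ∈ H^(s₀) × H^(s₀ - ρ/2)`. -/
def MemEnergySpace (ρ r : ℝ) (u w : RealL2) : Prop :=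
  MemSobolev (s₀ ρ r) u ∧ MemSobolev (s₀ ρ r - ρ / 2) w

/-- The depth `d` of the potential well: the infimum of the energy over all
`(u, w) ∈ H^(s₀) × H^(s₀ - ρ/2)` with `u ≠ 0` and `2 I(u) - Q(u) = 0`. -/
def depth (l b : ℝ → ℝ) (ρ r p : ℝ) : ℝ :=
  sInf {e : ℝ | ∃ u w : RealL2, MemEnergySpace ρ r u w ∧ u ≠ 0 ∧
    2 * I l b u - Q p u = 0 ∧ e = energy l b p u w}

/-- The set `Σ₊`. -/
def SigmaPlus (l b : ℝ → ℝ) (ρ r p : ℝ) : Set (RealL2 × RealL2) :=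
  {z | MemEnergySpace ρ r z.1 z.2 ∧ energy l b p z.1 z.2 < depth l b ρ r p ∧
    0 ≤ 2 * I l b z.1 - Q p z.1}

/-- `u ∈ C([0, T), H^s(ℝ))`, for `T ∈ (0, ∞]`. -/
def ContinuousInSobolev (s : ℝ) (T : EReal) (u : ℝ → RealL2) : Prop :=
  (∀ t : ℝ, 0 ≤ t → (t : EReal) < T → MemSobolev s (u t)) ∧
  ∀ t : ℝ, 0 ≤ t → (t : EReal) < T →
    Filter.Tendsto (fun τ => sobolevNorm s (u τ - u t))
      (nhdsWithin t {τ : ℝ | 0 ≤ τ ∧ (τ : EReal) < T}) (nhds 0)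

/-- `(u, w) ∈ C([0, T), H^(s₀)) × C([0, T), H^(s₀ - ρ/2))` solves, on `[0, T)` with
`T ∈ (0, ∞]`, the Cauchy problem
`u_t = w_x`, `w_t = L u_x + B (g(u))_x`, `u(0) = u₀`, `w(0) = w₀`,
the equations holding at every `0 < t < T` in the sense of tempered distributions in `x`. -/
structure IsSolution (l b : ℝ → ℝ) (ρ r p : ℝ) (u₀ w₀ : RealL2) (T : EReal)
    (u w : ℝ → RealL2) : Prop where
  pos : 0 < T
  continuous_u : ContinuousInSobolev (s₀ ρ r) T u
  continuous_w : ContinuousInSobolev (s₀ ρ r - ρ / 2) T w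
  eq_u : ∀ φ : 𝓢(ℝ, ℂ), ∀ t : ℝ, 0 < t → (t : EReal) < T →
    HasDerivAt (fun τ => pairing (u τ) φ) (-pairing (w t) (SchwartzMap.derivCLM ℂ ℂ φ)) t
  eq_w : ∀ φ : 𝓢(ℝ, ℂ), ∀ t : ℝ, 0 < t → (t : EReal) < T →
    HasDerivAt (fun τ => pairing (w τ) φ)
      (-multiplierPairing l (u t) (SchwartzMap.derivCLM ℂ ℂ φ)
        - multiplierPairing b (gL2 p (u t)) (SchwartzMap.derivCLM ℂ ℂ φ)) t
  init_u : u 0 = u₀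
  init_w : w 0 = w₀

/-- The maximal existence time `T_max ∈ (0, ∞]`: the supremum of all `T` such that the Cauchy
problem has a solution on `[0, T)`. -/
def maximalTime (l b : ℝ → ℝ) (ρ r p : ℝ) (u₀ w₀ : RealL2) : EReal :=
  sSup {T : EReal | ∃ u w : ℝ → RealL2, IsSolution l b ρ r p u₀ w₀ T u w}

end

end NonlocalWave

namespace NonlocalWave

noncomputable section

open scoped ComplexConjugate

/-! Put K = B^(1/2) L^(-1/2) and write u = K U, w = B^(1/2) W with U, W in L². Then 2 I(u) = ‖U‖²
and the energy is ½‖W‖² + ½‖U‖² - Q(KU)/(p+1). With y = K W = L^(-1/2) w the equations read u_t = Ω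
y, y_t = Ω u + M g(u), where Ω = ∂ₓ L^(1/2) is skew-adjoint and M = ∂ₓ L^(-1/2) B is bounded on L²
because r + ρ/2 ≥ 1. As s₀ > 1/2, K maps L² into bounded functions; while U stays in a fixed ball, g
may therefore be replaced by a truncation f which is globally Lipschitz.

Conjugation with exp(±tΩ) turns the truncated problem into an ODE in L² × L² with globally Lipschitz
right hand side, hence with global solutions. Regularity is propagated without a Lipschitz estimate
in the energy norm: the linear bound ‖K⁻¹ M f(KU)‖ ≤ C‖U‖ (`exists_strong_bound`) suffices. It holds
because composition with a Lipschitz function is bounded on homogeneous Sobolev spaces of order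
between 0 and 1 (`lintegral_rpow_FT_comp_le`). Balls of the energy space are cut out by the
inequalities |⟪z, φ⟫| ≤ C‖Kφ‖ (`exists_preimage_of_inner_le`), which survive L² limits, so Picard
iteration preserves them (`exists_global_ode_solution`).

The energy is conserved (`energy_conserved`): on frequency bands everything is differentiable, and
the error made by projecting the nonlinearity vanishes in the limit. The potential well argument
(`exists_global_solution`) then bounds U. Inside Q ≤ ‖U‖² the energy controls ‖U‖ by a constant M;
leaving this region requires crossing the Nehari set Q = ‖U‖², U ≠ 0, where the energy is at least
d, and this is impossible below d. With the truncation chosen for the radius M + 1, it is never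
active, so the truncated solution solves the original problem.

For uniqueness, two solutions are lifted to bounded L² curves on a compact time interval, both
satisfy the same truncated equation on every frequency band, and Grönwall applies to the L² norm of
the difference of (u, y), where Ω drops out by skewness. -/

/-! ### Fourier transform of real-valued L² functions -/

/-- The Fourier transform of real-valued square-integrable functions. -/
def FT : RealL2 →ₗᵢ[ℝ] ComplexL2 where
  toLinearMap :=
    { toFun := fun u => 𝓕 (complexify u)
      map_add' := fun u v => by
        have : complexify (u + v) = complexify u + complexify v :=
          (Complex.ofRealCLM.compLpL 2 volume).map_add u v
        rw [this, FourierTransform.fourier_add]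
      map_smul' := fun c u => by
        have : complexify (c • u) = (c : ℂ) • complexify u := by
          apply Lp.ext
          filter_upwards [Complex.ofRealCLM.coeFn_compLp (c • u), Complex.ofRealCLM.coeFn_compLp u,
            Lp.coeFn_smul c u, Lp.coeFn_smul (c : ℂ) (complexify u)] with x h1 h2 h3 h4
          rw [h4]
          simp only [complexify, Pi.smul_apply]
          rw [h1, h2, h3]
          simp
        rw [this, FourierTransform.fourier_smul]
        rfl }
  norm_map' := fun u => by
    change ‖𝓕 (complexify u)‖ = _
    rw [Lp.norm_fourier_eq, Lp.norm_def, Lp.norm_def]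
    congr 1
    apply eLpNorm_congr_norm_ae
    filter_upwards [Complex.ofRealCLM.coeFn_compLp u] with x hx
    simp [complexify, hx]

theorem FT_apply (u : RealL2) : FT u = 𝓕 (complexify u) := rfl

theorem coeFn_complexify (u : RealL2) : ∀ᵐ x, complexify u x = (u x : ℂ) :=
  Complex.ofRealCLM.coeFn_compLp u

theorem FT_ext {u v : RealL2} (h : FT u =ᵐ[volume] FT v) : u = v :=
  FT.injective (Lp.ext h)

/-- The L² transform agrees with the transform of tempered distributions, which is defined by moving
𝓕 to the test function. -/
theorem integral_fourier_mul (f : ComplexL2) (ψ : 𝓢(ℝ, ℂ)) :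
    ∫ η, (𝓕 f : ComplexL2) η * ψ η = ∫ x, f x * (𝓕 ψ : 𝓢(ℝ, ℂ)) x := by
  have h := congrArg (fun T => T ψ) (Lp.fourier_toTemperedDistribution_eq f)
  simp only [TemperedDistribution.fourier_apply, Lp.toTemperedDistribution_apply, smul_eq_mul] at h
  simp_rw [mul_comm _ (ψ _), ← h, mul_comm]

theorem pairing_eq_integral_FT (u : RealL2) (φ : 𝓢(ℝ, ℂ)) :
    pairing u φ = ∫ η, FT u η * (𝓕⁻ φ : 𝓢(ℝ, ℂ)) η := by
  rw [FT_apply, integral_fourier_mul, FourierTransform.fourier_fourierInv_eq, pairing]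
  apply integral_congr_ae
  filter_upwards [coeFn_complexify u] with x hx
  rw [hx]

theorem locallyIntegrable_L2 (f : ComplexL2) : LocallyIntegrable f volume :=
  (Lp.memLp f).locallyIntegrable one_le_two

theorem conj_fourier_real (g : ℝ → ℝ) (x : ℝ) :
    conj (𝓕 (fun y => (g y : ℂ)) x) = 𝓕 (fun y => (g (-y) : ℂ)) x := by
  rw [Real.fourier_eq', Real.fourier_eq', ← integral_conj, ← integral_neg_eq_self]
  congr 1
  ext y
  simp only [smul_eq_mul, map_mul, Complex.conj_ofReal, ← Complex.exp_conj]
  simp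

theorem measurePreserving_neg_real : MeasurePreserving (fun x : ℝ => -x) volume volume :=
  Measure.measurePreserving_neg volume

/-- The Fourier transform of a real-valued function is Hermitian. -/
theorem FT_neg (u : RealL2) : ∀ᵐ η, FT u (-η) = conj (FT u η) := by
  have hm : MemLp (fun η => FT u (-η)) 2 volume :=
    (Lp.memLp (FT u)).comp_measurePreserving measurePreserving_neg_real
  have hc : MemLp (fun η => conj (FT u η)) 2 volume := by
    refine (Lp.memLp (FT u)).of_le ?_ (Filter.Eventually.of_forall fun x => by simp)
    exact Complex.continuous_conj.comp_aestronglyMeasurable (Lp.aestronglyMeasurable _)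
  -- Both sides are compared as distributions: against a real bump the transform moves to the bump,
  -- where reflection and conjugation are explicit.
  apply ae_eq_of_integral_contDiff_smul_eq (hm.locallyIntegrable one_le_two)
    (hc.locallyIntegrable one_le_two)
  intro g hg hgs
  have hg1 : ContDiff ℝ ∞ (fun x => (g x : ℂ)) := Complex.ofRealCLM.contDiff.comp hg
  have hs1 : HasCompactSupport (fun x => (g x : ℂ)) := hgs.comp_left (g := Complex.ofReal) rfl
  have hg2 : ContDiff ℝ ∞ (fun x => (g (-x) : ℂ)) := hg1.comp contDiff_neg
  have hs2 : HasCompactSupport (fun x => (g (-x) : ℂ)) :=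
    hs1.comp_homeomorph (Homeomorph.neg ℝ)
  let ψ1 : 𝓢(ℝ, ℂ) := hs1.toSchwartzMap hg1
  let ψ2 : 𝓢(ℝ, ℂ) := hs2.toSchwartzMap hg2
  have e1 : ∫ x, g x • FT u (-x) = ∫ x, FT u x * ψ2 x := by
    rw [← integral_neg_eq_self]
    congr 1
    ext x
    simp [ψ2, mul_comm]
  have e2 : ∫ x, g x • conj (FT u x) = conj (∫ x, FT u x * ψ1 x) := by
    rw [← integral_conj]
    congr 1
    ext x
    simp [ψ1, mul_comm]
  rw [e1, e2, FT_apply, integral_fourier_mul, integral_fourier_mul, ← integral_conj]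
  apply integral_congr_ae
  filter_upwards [coeFn_complexify u] with x hx
  simp only [hx, map_mul, Complex.conj_ofReal, SchwartzMap.fourier_coe]
  congr 1
  exact (conj_fourier_real g x).symm

/-- Every Hermitian square-integrable function is the Fourier transform of a real-valued one. -/
theorem exists_FT_eq (f : ComplexL2) (hf : ∀ᵐ η, f (-η) = conj (f η)) : ∃ u, FT u = f := by
  set v : ComplexL2 := 𝓕⁻ f with hv
  let a : RealL2 := Complex.reCLM.compLp v
  let c : RealL2 := Complex.imCLM.compLp v
  have hvac : v = complexify a + Complex.I • complexify c := by
    apply Lp.ext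
    filter_upwards [Lp.coeFn_add (complexify a) (Complex.I • complexify c),
      Lp.coeFn_smul Complex.I (complexify c), coeFn_complexify a, coeFn_complexify c,
      Complex.reCLM.coeFn_compLp v, Complex.imCLM.coeFn_compLp v] with x h1 h2 h3 h4 h5 h6
    rw [h1, Pi.add_apply, h2, Pi.smul_apply, h3, h4, h5, h6]
    simp only [Complex.reCLM_apply, Complex.imCLM_apply, smul_eq_mul]
    rw [mul_comm]
    exact (Complex.re_add_im _).symm
  have hf2 : f = FT a + Complex.I • FT c := by
    have : 𝓕 v = f := FourierTransform.fourier_fourierInv_eq f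
    rw [← this, hvac, FourierTransform.fourier_add, FourierTransform.fourier_smul]
    rfl
  have hae : ∀ᵐ η, f η = FT a η + Complex.I * FT c η := by
    rw [hf2]
    filter_upwards [Lp.coeFn_add (FT a) (Complex.I • FT c), Lp.coeFn_smul Complex.I (FT c)]
      with x h1 h2
    rw [h1, Pi.add_apply, h2, Pi.smul_apply, smul_eq_mul]
  -- With f = â + iĉ, and f, â, ĉ all Hermitian, comparing f(-η) with the conjugate of f(η) leaves
  -- twice i times the conjugate of ĉ, which must vanish.
  have hc : FT c = 0 := by
    apply Lp.ext
    have hneg := measurePreserving_neg_real.quasiMeasurePreserving.ae hae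
    filter_upwards [hf, FT_neg a, FT_neg c, hae, hneg, Lp.coeFn_zero ℂ 2 volume]
      with x h1 h2 h3 h4 h5 h6
    rw [h6]
    rw [h5, h4, h2, h3] at h1
    simp only [map_add, map_mul, Complex.conj_I] at h1
    have h7 : 2 * Complex.I * conj (FT c x) = 0 := by linear_combination h1
    simpa using h7
  refine ⟨a, ?_⟩
  rw [hf2, hc]
  simp

/-! ### Bounded Fourier multipliers on real L² -/

/-- Bounded measurable Hermitian symbols: these act on real-valued functions. -/
structure IsSymbol (m : ℝ → ℂ) : Prop where
  measurable : Measurable m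
  herm : ∀ η, m (-η) = conj (m η)
  bounded : ∃ C, ∀ η, ‖m η‖ ≤ C

theorem IsSymbol.exists_mul {m : ℝ → ℂ} (hm : IsSymbol m) (u : RealL2) :
    ∃ v : RealL2, FT v =ᵐ[volume] fun η => m η * FT u η := by
  obtain ⟨C, hC⟩ := hm.bounded
  have hL : MemLp (fun η => m η * FT u η) 2 volume := by
    refine (Lp.memLp (FT u)).of_le_mul (c := C)
      (hm.measurable.aestronglyMeasurable.mul (Lp.aestronglyMeasurable _)) ?_
    refine Filter.Eventually.of_forall fun x => ?_
    rw [norm_mul]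
    exact mul_le_mul_of_nonneg_right (hC x) (norm_nonneg _)
  obtain ⟨v, hv⟩ := exists_FT_eq (hL.toLp _) (by
    have h1 := hL.coeFn_toLp
    have h2 := measurePreserving_neg_real.quasiMeasurePreserving.ae h1
    filter_upwards [h1, h2, FT_neg u] with x h1 h2 h3
    rw [h1, h2, h3, hm.herm, map_mul])
  exact ⟨v, hv ▸ hL.coeFn_toLp⟩

theorem norm_le_of_FT_le {u v : RealL2} {C : ℝ}
    (h : ∀ᵐ η, ‖FT v η‖ ≤ C * ‖FT u η‖) : ‖v‖ ≤ C * ‖u‖ := by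
  rw [← FT.norm_map u, ← FT.norm_map v]
  exact Lp.norm_le_mul_norm_of_ae_le_mul h

open Classical in
/-- The Fourier multiplier with the bounded symbol `m`, in Mathlib's frequency variable. -/
def mulOp (m : ℝ → ℂ) : RealL2 →L[ℝ] RealL2 :=
  if hm : IsSymbol m then
    LinearMap.mkContinuousOfExistsBound
      { toFun := fun u => (hm.exists_mul u).choose
        map_add' := fun u v => by
          apply FT_ext
          have e := map_add FT (hm.exists_mul u).choose (hm.exists_mul v).choose
          filter_upwards [(hm.exists_mul (u + v)).choose_spec, (hm.exists_mul u).choose_spec,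
            (hm.exists_mul v).choose_spec, Lp.coeFn_add (FT u) (FT v),
            Lp.coeFn_add (FT (hm.exists_mul u).choose) (FT (hm.exists_mul v).choose)]
            with x h1 h2 h3 h4 h5
          rw [h1, e, h5, Pi.add_apply, h2, h3, map_add, h4, Pi.add_apply, mul_add]
        map_smul' := fun c u => by
          apply FT_ext
          have e := map_smul FT c (hm.exists_mul u).choose
          filter_upwards [(hm.exists_mul (c • u)).choose_spec, (hm.exists_mul u).choose_spec,
            Lp.coeFn_smul c (FT u), Lp.coeFn_smul c (FT (hm.exists_mul u).choose)]
            with x h1 h2 h3 h4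
          simp only [RingHom.id_apply]
          rw [h1, e, h4, Pi.smul_apply, h2, map_smul, h3, Pi.smul_apply]
          simp only [Complex.real_smul]
          ring }
      (by
        obtain ⟨C, hC⟩ := hm.bounded
        refine ⟨C, fun u => norm_le_of_FT_le ?_⟩
        filter_upwards [(hm.exists_mul u).choose_spec] with x h1
        simp only [LinearMap.coe_mk, AddHom.coe_mk]
        rw [h1, norm_mul]
        exact mul_le_mul_of_nonneg_right (hC x) (norm_nonneg _))
  else 0

theorem FT_mulOp {m : ℝ → ℂ} (hm : IsSymbol m) (u : RealL2) :
    FT (mulOp m u) =ᵐ[volume] fun η => m η * FT u η := by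
  rw [mulOp, dif_pos hm]
  exact (hm.exists_mul u).choose_spec

theorem norm_mulOp_apply_le {m : ℝ → ℂ} (hm : IsSymbol m) {C : ℝ} (hC : ∀ η, ‖m η‖ ≤ C)
    (u : RealL2) : ‖mulOp m u‖ ≤ C * ‖u‖ := by
  apply norm_le_of_FT_le
  filter_upwards [FT_mulOp hm u] with x h1
  rw [h1, norm_mul]
  exact mul_le_mul_of_nonneg_right (hC x) (norm_nonneg _)

theorem norm_mulOp_le {m : ℝ → ℂ} (hm : IsSymbol m) {C : ℝ} (hC : ∀ η, ‖m η‖ ≤ C) :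
    ‖mulOp m‖ ≤ C :=
  ContinuousLinearMap.opNorm_le_bound _ ((norm_nonneg _).trans (hC 0)) (norm_mulOp_apply_le hm hC)

theorem IsSymbol.mul {m n : ℝ → ℂ} (hm : IsSymbol m) (hn : IsSymbol n) :
    IsSymbol (fun η => m η * n η) := by
  obtain ⟨C, hC⟩ := hm.bounded
  obtain ⟨D, hD⟩ := hn.bounded
  exact ⟨hm.measurable.mul hn.measurable, fun η => by rw [hm.herm, hn.herm, map_mul],
    C * D, fun η => by
      rw [norm_mul]
      exact mul_le_mul (hC η) (hD η) (norm_nonneg _) ((norm_nonneg _).trans (hC η))⟩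

theorem IsSymbol.add {m n : ℝ → ℂ} (hm : IsSymbol m) (hn : IsSymbol n) :
    IsSymbol (fun η => m η + n η) := by
  obtain ⟨C, hC⟩ := hm.bounded
  obtain ⟨D, hD⟩ := hn.bounded
  exact ⟨hm.measurable.add hn.measurable, fun η => by rw [hm.herm, hn.herm, map_add],
    C + D, fun η => (norm_add_le _ _).trans (add_le_add (hC η) (hD η))⟩

theorem IsSymbol.real_smul {m : ℝ → ℂ} (hm : IsSymbol m) (c : ℝ) :
    IsSymbol (fun η => c * m η) := by
  obtain ⟨C, hC⟩ := hm.bounded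
  exact ⟨hm.measurable.const_mul _, fun η => by rw [hm.herm, map_mul, Complex.conj_ofReal],
    |c| * C, fun η => by
      rw [norm_mul, Complex.norm_real, Real.norm_eq_abs]
      exact mul_le_mul_of_nonneg_left (hC η) (abs_nonneg _)⟩

theorem isSymbol_ofReal {m : ℝ → ℝ} (hm : Measurable m) (he : ∀ η, m (-η) = m η) {C : ℝ}
    (hC : ∀ η, |m η| ≤ C) : IsSymbol (fun η => (m η : ℂ)) :=
  ⟨Complex.measurable_ofReal.comp hm, fun η => by rw [he, Complex.conj_ofReal], C,
    fun η => by simpa using hC η⟩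

theorem mulOp_mul {m n : ℝ → ℂ} (hm : IsSymbol m) (hn : IsSymbol n) (u : RealL2) :
    mulOp (fun η => m η * n η) u = mulOp m (mulOp n u) := by
  apply FT_ext
  filter_upwards [FT_mulOp (hm.mul hn) u, FT_mulOp hm (mulOp n u), FT_mulOp hn u] with x h1 h2 h3
  rw [h1, h2, h3, mul_assoc]

theorem mulOp_add {m n : ℝ → ℂ} (hm : IsSymbol m) (hn : IsSymbol n) :
    mulOp (fun η => m η + n η) = mulOp m + mulOp n := by
  ext1 u
  apply FT_ext
  rw [add_apply, map_add]
  filter_upwards [FT_mulOp (hm.add hn) u, FT_mulOp hm u, FT_mulOp hn u,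
    Lp.coeFn_add (FT (mulOp m u)) (FT (mulOp n u))] with x h1 h2 h3 h4
  rw [h1, h4, Pi.add_apply, h2, h3, add_mul]

theorem mulOp_real_smul {m : ℝ → ℂ} (hm : IsSymbol m) (c : ℝ) :
    mulOp (fun η => c * m η) = c • mulOp m := by
  ext1 u
  apply FT_ext
  rw [smul_apply, map_smul]
  filter_upwards [FT_mulOp (hm.real_smul c) u, FT_mulOp hm u,
    Lp.coeFn_smul c (FT (mulOp m u))] with x h1 h2 h4
  rw [h1, h4, Pi.smul_apply, h2, Complex.real_smul, mul_assoc]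

theorem mulOp_comm {m n : ℝ → ℂ} (hm : IsSymbol m) (hn : IsSymbol n) (u : RealL2) :
    mulOp m (mulOp n u) = mulOp n (mulOp m u) := by
  rw [← mulOp_mul hm hn, ← mulOp_mul hn hm]
  simp_rw [mul_comm]

theorem mulOp_one (u : RealL2) : mulOp (fun _ => 1) u = u := by
  have h : IsSymbol (fun _ => 1) := ⟨measurable_const, by simp, 1, by simp⟩
  apply FT_ext
  filter_upwards [FT_mulOp h u] with x h1
  rw [h1, one_mul]

theorem inner_complexify (u v : RealL2) :
    inner ℂ (complexify u) (complexify v) = ((inner ℝ u v : ℝ) : ℂ) := by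
  rw [L2.inner_def, L2.inner_def, ← integral_complex_ofReal]
  apply integral_congr_ae
  filter_upwards [coeFn_complexify u, coeFn_complexify v] with x h1 h2
  simp [h1, h2]

theorem inner_FT (u v : RealL2) : inner ℂ (FT u) (FT v) = ((inner ℝ u v : ℝ) : ℂ) := by
  rw [FT_apply, FT_apply, Lp.inner_fourier_eq, inner_complexify]

theorem ofReal_inner_eq_integral (u v : RealL2) :
    ((inner ℝ u v : ℝ) : ℂ) = ∫ η, FT v η * conj (FT u η) := by
  rw [← inner_FT, L2.inner_def]
  simp

theorem IsSymbol.conj {m : ℝ → ℂ} (hm : IsSymbol m) : IsSymbol (fun η => conj (m η)) := by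
  obtain ⟨C, hC⟩ := hm.bounded
  exact ⟨Complex.continuous_conj.measurable.comp hm.measurable, fun η => by rw [hm.herm],
    C, fun η => by simpa using hC η⟩

theorem inner_mulOp {m : ℝ → ℂ} (hm : IsSymbol m) (u v : RealL2) :
    inner ℝ (mulOp m u) v = inner ℝ u (mulOp (fun η => conj (m η)) v) := by
  have : ((inner ℝ (mulOp m u) v : ℝ) : ℂ) = ((inner ℝ u (mulOp (fun η => conj (m η)) v) : ℝ) : ℂ) := by
    rw [ofReal_inner_eq_integral, ofReal_inner_eq_integral]
    apply integral_congr_ae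
    filter_upwards [FT_mulOp hm u, FT_mulOp hm.conj v] with x h1 h2
    rw [h1, h2, map_mul]
    ring
  exact_mod_cast this

theorem inner_mulOp_real {m : ℝ → ℝ} (hm : IsSymbol fun η => (m η : ℂ)) (u v : RealL2) :
    inner ℝ (mulOp (fun η => (m η : ℂ)) u) v = inner ℝ u (mulOp (fun η => (m η : ℂ)) v) := by
  rw [inner_mulOp hm]
  simp_rw [Complex.conj_ofReal]

/-- If the symbol has no zeros, the multiplier is injective. -/
theorem mulOp_injective {m : ℝ → ℂ} (hm : IsSymbol m) (h0 : ∀ η, m η ≠ 0) :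
    Function.Injective (mulOp m) := by
  intro u v h
  apply FT_ext
  have h3 : FT (mulOp m u) = FT (mulOp m v) := by rw [h]
  filter_upwards [FT_mulOp hm u, FT_mulOp hm v] with x h1 h2
  rw [h3, h2] at h1
  exact (mul_left_cancel₀ (h0 x) h1).symm

/-! ### Translations and composition with Lipschitz functions -/

theorem lintegral_enorm_sq_Lp {E : Type*} [NormedAddCommGroup E] (f : Lp E 2 (volume : Measure ℝ)) :
    ∫⁻ x, ‖f x‖ₑ ^ 2 = ENNReal.ofReal (‖f‖ ^ 2) := by
  have h := eLpNorm_nnreal_pow_eq_lintegral (f := f) (μ := volume) (p := 2) two_ne_zero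
  simp only [NNReal.coe_ofNat, ENNReal.rpow_ofNat, ENNReal.coe_ofNat] at h
  rw [← h, Lp.norm_def, ENNReal.ofReal_pow ENNReal.toReal_nonneg,
    ENNReal.ofReal_toReal (Lp.eLpNorm_ne_top f)]

/-- The translate `x ↦ u (x + h)`. -/
def translate (h : ℝ) (u : RealL2) : RealL2 :=
  Lp.compMeasurePreserving (fun x : ℝ => x + h) (measurePreserving_add_right volume h) u

theorem coeFn_translate (h : ℝ) (u : RealL2) : translate h u =ᵐ[volume] fun x => u (x + h) :=
  Lp.coeFn_compMeasurePreserving _ _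

theorem norm_exp_phase (x : ℝ) : ‖Complex.exp (x * Complex.I)‖ = 1 :=
  Complex.norm_exp_ofReal_mul_I x

theorem fourier_exp_mul (φ : ℝ → ℂ) (h x : ℝ) :
    𝓕 (fun η : ℝ => Complex.exp ((2 * Real.pi * h * η : ℝ) * Complex.I) * φ η) x
      = 𝓕 φ (x - h) := by
  rw [Real.fourier_eq', Real.fourier_eq']
  congr 1
  ext η
  simp only [smul_eq_mul]
  rw [← mul_assoc, ← Complex.exp_add]
  congr 2
  simp only [RCLike.inner_apply, conj_trivial]
  push_cast
  ring

theorem FT_translate (h : ℝ) (u : RealL2) :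
    FT (translate h u) =ᵐ[volume]
      fun η => Complex.exp ((2 * Real.pi * h * η : ℝ) * Complex.I) * FT u η := by
  have hcont : ContDiff ℝ ∞
      (fun η : ℝ => Complex.exp ((2 * Real.pi * h * η : ℝ) * Complex.I)) := by
    have : ContDiff ℝ ∞ (fun η : ℝ => 2 * Real.pi * h * η) := by fun_prop
    exact ((Complex.ofRealCLM.contDiff.comp this).mul contDiff_const).cexp
  have hm : MemLp (fun η => Complex.exp ((2 * Real.pi * h * η : ℝ) * Complex.I) * FT u η)
      2 volume := by
    refine (Lp.memLp (FT u)).of_le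
      (hcont.continuous.aestronglyMeasurable.mul (Lp.aestronglyMeasurable _)) ?_
    exact Filter.Eventually.of_forall fun x => by rw [norm_mul, norm_exp_phase, one_mul]
  apply ae_eq_of_integral_contDiff_smul_eq (locallyIntegrable_L2 _)
    (hm.locallyIntegrable one_le_two)
  intro g hg hgs
  have hg1 : ContDiff ℝ ∞ (fun x => (g x : ℂ)) := Complex.ofRealCLM.contDiff.comp hg
  have hs1 : HasCompactSupport (fun x => (g x : ℂ)) := hgs.comp_left (g := Complex.ofReal) rfl
  have hg2 : ContDiff ℝ ∞
      (fun η : ℝ => Complex.exp ((2 * Real.pi * h * η : ℝ) * Complex.I) * (g η : ℂ)) :=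
    hcont.mul hg1
  have hs2 : HasCompactSupport
      (fun η : ℝ => Complex.exp ((2 * Real.pi * h * η : ℝ) * Complex.I) * (g η : ℂ)) :=
    hs1.mul_left
  let ψ1 : 𝓢(ℝ, ℂ) := hs1.toSchwartzMap hg1
  let ψ2 : 𝓢(ℝ, ℂ) := hs2.toSchwartzMap hg2
  have e1 : ∫ x, g x • FT (translate h u) x = ∫ x, FT (translate h u) x * ψ1 x := by
    congr 1; ext x; simp [ψ1, mul_comm]
  have e2 : ∫ x, g x • (Complex.exp ((2 * Real.pi * h * x : ℝ) * Complex.I) * FT u x)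
      = ∫ x, FT u x * ψ2 x := by
    congr 1; ext x; simp [ψ2]; ring
  rw [e1, e2, FT_apply, FT_apply, integral_fourier_mul, integral_fourier_mul,
    ← integral_add_right_eq_self (fun x => complexify u x * (𝓕 ψ2 : 𝓢(ℝ, ℂ)) x) h]
  apply integral_congr_ae
  have hq := (measurePreserving_add_right volume h).quasiMeasurePreserving.ae
    (coeFn_complexify u)
  filter_upwards [coeFn_complexify (translate h u), hq, coeFn_translate h u] with x h1 h2 h3
  rw [h1, h2, h3, SchwartzMap.fourier_coe, SchwartzMap.fourier_coe]
  congr 1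
  have := fourier_exp_mul (fun x => (g x : ℂ)) h (x + h)
  rw [add_sub_cancel_right] at this
  exact this.symm

/-- Plancherel for a translate minus the function. This is the bridge by which pointwise information
on increments becomes a weighted inequality for the Fourier transform. -/
theorem lintegral_FT_difference (h : ℝ) (u : RealL2) :
    ∫⁻ η, ‖Complex.exp ((2 * Real.pi * h * η : ℝ) * Complex.I) - 1‖ₑ ^ 2 * ‖FT u η‖ₑ ^ 2
      = ∫⁻ x, ‖u (x + h) - u x‖ₑ ^ 2 := by
  have h1 : ∫⁻ η, ‖FT (translate h u - u) η‖ₑ ^ 2 = ∫⁻ x, ‖(translate h u - u : RealL2) x‖ₑ ^ 2 := by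
    rw [lintegral_enorm_sq_Lp, lintegral_enorm_sq_Lp, FT.norm_map]
  have e := map_sub FT (translate h u) u
  rw [e] at h1
  convert! h1 using 1
  · apply lintegral_congr_ae
    filter_upwards [FT_translate h u, Lp.coeFn_sub (FT (translate h u)) (FT u)] with x h1 h2
    rw [h2, Pi.sub_apply, h1, ← mul_pow, ← enorm_mul, sub_mul, one_mul]
  · apply lintegral_congr_ae
    filter_upwards [coeFn_translate h u, Lp.coeFn_sub (translate h u) u] with x h1 h2
    rw [h2, Pi.sub_apply, h1]

theorem lintegral_FT_difference_comp_le {f : ℝ → ℝ} {K : NNReal} (hf : LipschitzWith K f)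
    (h0 : f 0 = 0) (u : RealL2) (h : ℝ) :
    ∫⁻ η, ‖Complex.exp ((2 * Real.pi * h * η : ℝ) * Complex.I) - 1‖ₑ ^ 2
        * ‖FT (hf.compLp h0 u) η‖ₑ ^ 2
      ≤ K ^ 2 * ∫⁻ η, ‖Complex.exp ((2 * Real.pi * h * η : ℝ) * Complex.I) - 1‖ₑ ^ 2
        * ‖FT u η‖ₑ ^ 2 := by
  rw [lintegral_FT_difference, lintegral_FT_difference, ← lintegral_const_mul' _ _ (by simp)]
  apply lintegral_mono_ae
  have hc := hf.coeFn_compLp h0 u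
  have hq := (measurePreserving_add_right volume h).quasiMeasurePreserving.ae hc
  filter_upwards [hc, hq] with x h1 h2
  rw [h1, h2, ← mul_pow]
  gcongr
  have := hf.edist_le_mul (u (x + h)) (u x)
  rwa [edist_eq_enorm_sub, edist_eq_enorm_sub] at this

theorem norm_exp_sub_one_eq (x : ℝ) :
    ‖Complex.exp (x * Complex.I) - 1‖ = |2 * Real.sin (x / 2)| := by
  rw [mul_comm, Complex.norm_exp_I_mul_ofReal_sub_one, Real.norm_eq_abs]

theorem norm_exp_sub_one_le (x : ℝ) : ‖Complex.exp (x * Complex.I) - 1‖ ≤ |x| := by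
  rw [mul_comm]
  exact Real.norm_exp_I_mul_ofReal_sub_one_le

theorem norm_exp_sub_one_le_two (x : ℝ) : ‖Complex.exp (x * Complex.I) - 1‖ ≤ 2 := by
  refine (norm_sub_le _ _).trans ?_
  rw [norm_exp_phase, norm_one]
  norm_num

/-- The profile whose scaled averages produce the symbols `|η| ^ (2σ)`. -/
def diffSq (s : ℝ) : ℝ := ‖Complex.exp ((2 * Real.pi * s : ℝ) * Complex.I) - 1‖ ^ 2

theorem continuous_diffSq : Continuous diffSq := by
  unfold diffSq
  fun_prop

theorem diffSq_nonneg (s : ℝ) : 0 ≤ diffSq s := by unfold diffSq; positivity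

theorem diffSq_le_four (s : ℝ) : diffSq s ≤ 4 := by
  have := norm_exp_sub_one_le_two (2 * Real.pi * s)
  unfold diffSq
  nlinarith [norm_nonneg (Complex.exp ((2 * Real.pi * s : ℝ) * Complex.I) - 1)]

theorem diffSq_le_sq (s : ℝ) : diffSq s ≤ (2 * Real.pi) ^ 2 * s ^ 2 := by
  have := norm_exp_sub_one_le (2 * Real.pi * s)
  unfold diffSq
  calc _ ≤ |2 * Real.pi * s| ^ 2 := by gcongr
    _ = _ := by rw [sq_abs]; ring

theorem diffSq_abs (s : ℝ) : diffSq |s| = diffSq s := by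
  rcases abs_choice s with h | h <;> rw [h]
  unfold diffSq
  rw [norm_exp_sub_one_eq, norm_exp_sub_one_eq]
  congr 1
  rw [show 2 * Real.pi * -s / 2 = -(2 * Real.pi * s / 2) by ring, Real.sin_neg, mul_neg, abs_neg]

/-- Near 0 the quadratic vanishing of `diffSq` leaves s^(1-2σ), integrable as σ < 1; at infinity
`diffSq` is bounded and σ > 0 gives decay. -/
theorem integrableOn_rpow_mul_diffSq {σ : ℝ} (h0 : 0 < σ) (h1 : σ < 1) :
    IntegrableOn (fun s => s ^ (-1 - 2 * σ) * diffSq s) (Set.Ioi 0) := by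
  have hmeas : ∀ S : Set ℝ, AEStronglyMeasurable (fun s : ℝ => s ^ (-1 - 2 * σ) * diffSq s)
      (volume.restrict S) := fun S =>
    ((measurable_id.pow_const _).mul continuous_diffSq.measurable).aestronglyMeasurable
  rw [← Set.Ioc_union_Ioi_eq_Ioi zero_le_one]
  apply IntegrableOn.union
  · have hi : IntegrableOn (fun s : ℝ => (2 * Real.pi) ^ 2 * s ^ (1 - 2 * σ)) (Set.Ioc 0 1) := by
      rw [← intervalIntegrable_iff_integrableOn_Ioc_of_le zero_le_one]
      exact (intervalIntegral.intervalIntegrable_rpow' (by linarith)).const_mul _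
    refine Integrable.mono' hi (hmeas _) ?_
    filter_upwards [ae_restrict_mem measurableSet_Ioc] with s hs
    have hs0 : 0 < s := hs.1
    rw [Real.norm_of_nonneg (mul_nonneg (by positivity) (diffSq_nonneg s))]
    calc s ^ (-1 - 2 * σ) * diffSq s ≤ s ^ (-1 - 2 * σ) * ((2 * Real.pi) ^ 2 * s ^ 2) := by
          gcongr; exact diffSq_le_sq s
      _ = (2 * Real.pi) ^ 2 * (s ^ (-1 - 2 * σ) * s ^ (2 : ℝ)) := by
          rw [Real.rpow_two]; ring
      _ = _ := by rw [← Real.rpow_add hs0]; ring_nf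
  · have hi : IntegrableOn (fun s : ℝ => 4 * s ^ (-1 - 2 * σ)) (Set.Ioi 1) :=
      (integrableOn_Ioi_rpow_of_lt (by linarith) zero_lt_one).const_mul 4
    refine Integrable.mono' hi (hmeas _) ?_
    filter_upwards [ae_restrict_mem measurableSet_Ioi] with s hs
    have hs0 : 0 < s := zero_lt_one.trans hs
    rw [Real.norm_of_nonneg (mul_nonneg (by positivity) (diffSq_nonneg s)), mul_comm]
    gcongr
    exact diffSq_le_four s

theorem integral_rpow_mul_diffSq_pos {σ : ℝ} (h0 : 0 < σ) (h1 : σ < 1) :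
    0 < ∫ s in Set.Ioi (0 : ℝ), s ^ (-1 - 2 * σ) * diffSq s := by
  have hnn : ∀ᵐ s ∂(volume.restrict (Set.Ioi (0 : ℝ))), 0 ≤ s ^ (-1 - 2 * σ) * diffSq s := by
    filter_upwards [ae_restrict_mem measurableSet_Ioi] with s hs
    exact mul_nonneg (Real.rpow_nonneg (le_of_lt hs) _) (diffSq_nonneg s)
  rw [setIntegral_pos_iff_support_of_nonneg_ae hnn (integrableOn_rpow_mul_diffSq h0 h1)]
  have hsub : Set.Ioo (0 : ℝ) 1 ⊆
      Function.support (fun s : ℝ => s ^ (-1 - 2 * σ) * diffSq s) ∩ Set.Ioi 0 := by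
    intro s hs
    refine ⟨mul_ne_zero (Real.rpow_pos_of_pos hs.1 _).ne' ?_, hs.1⟩
    unfold diffSq
    rw [norm_exp_sub_one_eq, sq_abs]
    have : 0 < Real.sin (2 * Real.pi * s / 2) := by
      apply Real.sin_pos_of_pos_of_lt_pi
      · have := hs.1; positivity
      · have := hs.2; nlinarith [Real.pi_pos]
    positivity
  exact lt_of_lt_of_le (by simp) (measure_mono hsub)

/-- Substitution s = |η| h: averaging over increments with the weight h^(-1-2σ) produces the
homogeneous symbol |η|^(2σ). -/
theorem lintegral_rpow_mul_diffSq_scale {σ : ℝ} (h0 : 0 < σ) (h1 : σ < 1) (η : ℝ) :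
    ∫⁻ h in Set.Ioi (0 : ℝ), ENNReal.ofReal (h ^ (-1 - 2 * σ) * diffSq (h * η))
      = ENNReal.ofReal (∫ s in Set.Ioi (0 : ℝ), s ^ (-1 - 2 * σ) * diffSq s)
        * ENNReal.ofReal (|η| ^ (2 * σ)) := by
  rcases eq_or_ne η 0 with rfl | hη
  · have : (2 * σ) ≠ 0 := by linarith
    simp [diffSq, Real.zero_rpow this]
  have ha : 0 < |η| := abs_pos.mpr hη
  set G : ℝ → ℝ := fun s => s ^ (-1 - 2 * σ) * diffSq s with hG
  have key : ∀ h ∈ Set.Ioi (0 : ℝ),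
      h ^ (-1 - 2 * σ) * diffSq (h * η) = |η| ^ (1 + 2 * σ) * G (|η| * h) := by
    intro h hh
    have hh0 : 0 < h := hh
    have e1 : diffSq (h * η) = diffSq (|η| * h) := by
      rw [← diffSq_abs (h * η), abs_mul, abs_of_pos hh0, mul_comm]
    simp only [hG]
    rw [e1, Real.mul_rpow ha.le hh0.le, ← mul_assoc, ← mul_assoc, ← Real.rpow_add ha]
    simp
  have hint : IntegrableOn (fun h => |η| ^ (1 + 2 * σ) * G (|η| * h)) (Set.Ioi 0) := by
    apply Integrable.const_mul
    have := (integrableOn_Ioi_comp_mul_left_iff G 0 ha).mpr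
      (by simpa using integrableOn_rpow_mul_diffSq h0 h1)
    exact this
  rw [setLIntegral_congr_fun measurableSet_Ioi (fun h hh => by rw [key h hh]),
    ← ofReal_integral_eq_lintegral_ofReal hint, integral_const_mul,
    integral_comp_mul_left_Ioi G 0 ha, mul_zero, smul_eq_mul, ← ENNReal.ofReal_mul]
  · congr 1
    rw [Real.rpow_add ha, Real.rpow_one]
    field_simp
  · exact (integral_rpow_mul_diffSq_pos h0 h1).le
  · filter_upwards [ae_restrict_mem measurableSet_Ioi] with h hh
    have hh0 : 0 < h := hh
    exact mul_nonneg (by positivity) (mul_nonneg (by positivity) (diffSq_nonneg _))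

theorem enorm_sq_eq_ofReal_diffSq (h η : ℝ) :
    ‖Complex.exp ((2 * Real.pi * h * η : ℝ) * Complex.I) - 1‖ₑ ^ 2
      = ENNReal.ofReal (diffSq (h * η)) := by
  rw [diffSq, ENNReal.ofReal_pow (norm_nonneg _), ofReal_norm, ← mul_assoc]

theorem aemeasurable_FT_sq (u : RealL2) : AEMeasurable (fun η => ‖FT u η‖ₑ ^ 2) volume :=
  ((Lp.aestronglyMeasurable (FT u)).enorm).pow_const 2

/-- Tonelli applied to the scaling identity: the Gagliardo form of the homogeneous Sobolev seminorm.
-/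
theorem lintegral_rpow_FT_eq {σ : ℝ} (h0 : 0 < σ) (h1 : σ < 1) (u : RealL2) :
    ENNReal.ofReal (∫ s in Set.Ioi (0 : ℝ), s ^ (-1 - 2 * σ) * diffSq s)
        * ∫⁻ η, ENNReal.ofReal (|η| ^ (2 * σ)) * ‖FT u η‖ₑ ^ 2
      = ∫⁻ h in Set.Ioi (0 : ℝ), ENNReal.ofReal (h ^ (-1 - 2 * σ)) *
          ∫⁻ η, ‖Complex.exp ((2 * Real.pi * h * η : ℝ) * Complex.I) - 1‖ₑ ^ 2
            * ‖FT u η‖ₑ ^ 2 := by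
  have e1 : ∀ h ∈ Set.Ioi (0 : ℝ), ENNReal.ofReal (h ^ (-1 - 2 * σ)) *
          ∫⁻ η, ‖Complex.exp ((2 * Real.pi * h * η : ℝ) * Complex.I) - 1‖ₑ ^ 2
            * ‖FT u η‖ₑ ^ 2
      = ∫⁻ η, ENNReal.ofReal (h ^ (-1 - 2 * σ) * diffSq (h * η)) * ‖FT u η‖ₑ ^ 2 := by
    intro h hh
    have hh0 : 0 < h := hh
    rw [← lintegral_const_mul' _ _ ENNReal.ofReal_ne_top]
    congr 1
    ext η
    rw [enorm_sq_eq_ofReal_diffSq, ENNReal.ofReal_mul (by positivity), mul_assoc]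
  rw [setLIntegral_congr_fun measurableSet_Ioi e1, ← lintegral_const_mul' _ _ ENNReal.ofReal_ne_top]
  rw [lintegral_lintegral_swap]
  · congr 1
    ext η
    rw [lintegral_mul_const, lintegral_rpow_mul_diffSq_scale h0 h1, mul_assoc]
    refine ENNReal.measurable_ofReal.comp ((measurable_id.pow_const _).mul ?_)
    exact (continuous_diffSq.comp (continuous_id.mul continuous_const)).measurable
  · have hA : Measurable (fun z : ℝ × ℝ =>
        ENNReal.ofReal (z.1 ^ (-1 - 2 * σ) * diffSq (z.1 * z.2))) :=
      ENNReal.measurable_ofReal.comp ((measurable_fst.pow_const _).mul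
        (continuous_diffSq.comp (continuous_fst.mul continuous_snd)).measurable)
    exact hA.aemeasurable.mul (aemeasurable_FT_sq u).comp_snd

/-- The endpoint of order one, where the Gagliardo weight is no longer integrable. Difference
quotients with a vanishing step and Fatou's lemma replace the average. -/
theorem lintegral_sq_FT_comp_le {f : ℝ → ℝ} {K : NNReal} (hf : LipschitzWith K f)
    (h0 : f 0 = 0) (u : RealL2) :
    ∫⁻ η, ENNReal.ofReal (|η| ^ 2) * ‖FT (hf.compLp h0 u) η‖ₑ ^ 2
      ≤ K ^ 2 * ∫⁻ η, ENNReal.ofReal (|η| ^ 2) * ‖FT u η‖ₑ ^ 2 := by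
  set c : ℝ := (2 * Real.pi) ^ 2 with hc
  have hc0 : 0 < c := by positivity
  -- Squared symbol of the difference quotient of step 1/(n+1), normalised by (2π)² so that it
  -- increases at most to its pointwise limit |η|².
  let q : ℕ → ℝ → ℝ := fun n η => (n + 1 : ℝ) ^ 2 / c * diffSq (1 / (n + 1 : ℝ) * η)
  have hq0 : ∀ n η, 0 ≤ q n η := fun n η => mul_nonneg (by positivity) (diffSq_nonneg _)
  have hqle : ∀ n η, q n η ≤ |η| ^ 2 := by
    intro n η
    have hn : (0 : ℝ) < n + 1 := by positivity
    calc q n η ≤ (n + 1 : ℝ) ^ 2 / c * (c * (1 / (n + 1 : ℝ) * η) ^ 2) := by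
          apply mul_le_mul_of_nonneg_left (diffSq_le_sq _) (by positivity)
      _ = |η| ^ 2 := by rw [sq_abs]; field_simp
  have hqlim : ∀ η, Filter.Tendsto (fun n => q n η) Filter.atTop (nhds (|η| ^ 2)) := by
    intro η
    have hd : HasDerivAt (fun s : ℝ => Complex.exp ((2 * Real.pi * (s * η) : ℝ) * Complex.I))
        (2 * Real.pi * η * Complex.I) 0 := by
      have h1 : HasDerivAt (fun s : ℝ => ((2 * Real.pi * (s * η) : ℝ) : ℂ) * Complex.I)
          (2 * Real.pi * η * Complex.I) 0 := by
        have h2 : HasDerivAt (fun s : ℝ => 2 * Real.pi * (s * η)) (2 * Real.pi * η) 0 := by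
          simpa using ((hasDerivAt_id (0 : ℝ)).mul_const η).const_mul (2 * Real.pi)
        have := h2.ofReal_comp.mul_const Complex.I
        push_cast at this ⊢
        exact this
      simpa using h1.cexp
    have hs := hasDerivAt_iff_tendsto_slope_zero.mp hd
    have hseq : Filter.Tendsto (fun n : ℕ => 1 / ((n : ℝ) + 1)) Filter.atTop
        (nhdsWithin 0 {0}ᶜ) := by
      apply tendsto_nhdsWithin_of_tendsto_nhds_of_eventually_within _
        tendsto_one_div_add_atTop_nhds_zero_nat
      exact Filter.Eventually.of_forall fun n => by
        have : (0 : ℝ) < 1 / ((n : ℝ) + 1) := by positivity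
        exact this.ne'
    have h2 := ((hs.comp hseq).norm.pow 2).div_const c
    have e : ‖(2 * Real.pi * η * Complex.I : ℂ)‖ ^ 2 / c = |η| ^ 2 := by
      have : ‖(2 * Real.pi * η * Complex.I : ℂ)‖ = 2 * Real.pi * |η| := by
        simp [abs_of_pos Real.pi_pos]
      rw [this, hc]
      field_simp
    rw [e] at h2
    refine h2.congr fun n => ?_
    simp only [Function.comp, q, diffSq, zero_add, zero_mul, mul_zero, Complex.ofReal_zero,
      Complex.exp_zero, norm_smul, norm_inv, mul_pow]
    have hn : (0 : ℝ) < n + 1 := by positivity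
    rw [Real.norm_of_nonneg (by positivity)]
    field_simp
  have hn : ∀ n, ∫⁻ η, ENNReal.ofReal (q n η) * ‖FT (hf.compLp h0 u) η‖ₑ ^ 2
      ≤ K ^ 2 * ∫⁻ η, ENNReal.ofReal (|η| ^ 2) * ‖FT u η‖ₑ ^ 2 := by
    intro n
    have h1 := lintegral_FT_difference_comp_le hf h0 u (1 / (n + 1 : ℝ))
    simp_rw [enorm_sq_eq_ofReal_diffSq] at h1
    have h2 := mul_le_mul_right h1 (ENNReal.ofReal ((n + 1 : ℝ) ^ 2 / c))
    rw [mul_left_comm, ← lintegral_const_mul' _ _ ENNReal.ofReal_ne_top,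
      ← lintegral_const_mul' _ _ ENNReal.ofReal_ne_top] at h2
    simp_rw [← mul_assoc, ← ENNReal.ofReal_mul (show 0 ≤ (n + 1 : ℝ) ^ 2 / c by positivity)] at h2
    refine h2.trans ?_
    gcongr
    exact hqle n _
  have hlim : ∀ η, ENNReal.ofReal (|η| ^ 2) * ‖FT (hf.compLp h0 u) η‖ₑ ^ 2
      = Filter.liminf (fun n => ENNReal.ofReal (q n η) * ‖FT (hf.compLp h0 u) η‖ₑ ^ 2)
        Filter.atTop := by
    intro η
    refine (Filter.Tendsto.liminf_eq ?_).symm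
    apply ENNReal.Tendsto.mul_const (ENNReal.tendsto_ofReal (hqlim η))
    right
    simp
  simp_rw [hlim]
  refine (lintegral_liminf_le' fun n => ?_).trans ?_
  · refine AEMeasurable.mul ?_ (aemeasurable_FT_sq _)
    apply Measurable.aemeasurable
    refine ENNReal.measurable_ofReal.comp (Measurable.const_mul ?_ _)
    exact (continuous_diffSq.comp (continuous_const.mul continuous_id)).measurable
  · exact Filter.liminf_le_of_le (by isBoundedDefault) fun b hb => by
      obtain ⟨n, hn1⟩ := hb.exists
      exact hn1.trans (hn n)

/-- Composition with a Lipschitz function is bounded on the homogeneous Sobolev spaces of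
order between `0` and `1`. -/
theorem lintegral_rpow_FT_comp_le {f : ℝ → ℝ} {K : NNReal} (hf : LipschitzWith K f)
    (h0 : f 0 = 0) (u : RealL2) {σ : ℝ} (hσ0 : 0 ≤ σ) (hσ1 : σ ≤ 1) :
    ∫⁻ η, ENNReal.ofReal (|η| ^ (2 * σ)) * ‖FT (hf.compLp h0 u) η‖ₑ ^ 2
      ≤ K ^ 2 * ∫⁻ η, ENNReal.ofReal (|η| ^ (2 * σ)) * ‖FT u η‖ₑ ^ 2 := by
  rcases hσ1.eq_or_lt with rfl | hσ1
  · simpa using lintegral_sq_FT_comp_le hf h0 u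
  rcases hσ0.eq_or_lt with rfl | hσ0
  · simp only [mul_zero, Real.rpow_zero, ENNReal.ofReal_one, one_mul]
    rw [lintegral_enorm_sq_Lp, lintegral_enorm_sq_Lp, FT.norm_map, FT.norm_map]
    have := hf.norm_compLp_le h0 u
    calc ENNReal.ofReal (‖hf.compLp h0 u‖ ^ 2) ≤ ENNReal.ofReal ((K * ‖u‖) ^ 2) := by gcongr
      _ = _ := by
        rw [mul_pow, ENNReal.ofReal_mul (by positivity), ENNReal.ofReal_pow (by positivity),
          ENNReal.ofReal_coe_nnreal]
  · set c := ENNReal.ofReal (∫ s in Set.Ioi (0 : ℝ), s ^ (-1 - 2 * σ) * diffSq s) with hc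
    have hc0 : c ≠ 0 := by
      rw [hc, ne_eq, ENNReal.ofReal_eq_zero, not_le]
      exact integral_rpow_mul_diffSq_pos hσ0 hσ1
    have hct : c ≠ ⊤ := ENNReal.ofReal_ne_top
    rw [← ENNReal.mul_le_mul_iff_right hc0 hct, mul_left_comm, lintegral_rpow_FT_eq hσ0 hσ1,
      lintegral_rpow_FT_eq hσ0 hσ1, ← lintegral_const_mul' _ _ (by simp)]
    refine lintegral_mono fun h => ?_
    rw [mul_left_comm]
    gcongr
    exact lintegral_FT_difference_comp_le hf h0 u h

/-! ### Sup bounds from integrable Fourier transforms -/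

theorem integral_fourier_smul_of_integrable {f g : ℝ → ℂ} (hf : Integrable f) (hg : Integrable g) :
    ∫ x, 𝓕 f x * g x = ∫ x, f x * 𝓕 g x := by
  simpa using! VectorFourier.integral_fourierIntegral_smul_eq_flip (L := innerₗ ℝ)
    Real.continuous_fourierChar continuous_inner hf hg

/-- A function with integrable Fourier transform is bounded. -/
theorem ae_abs_le_of_integrable_FT (u : RealL2) (hu : Integrable (FT u)) :
    ∀ᵐ x, |u x| ≤ ∫ η, ‖FT u η‖ := by
  -- The reflection makes the inversion integral a forward transform of an integrable function.
  set f : ℝ → ℂ := fun η => FT u (-η) with hf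
  have hfi : Integrable f := hu.comp_neg
  have hcont : Continuous (𝓕 f) := VectorFourier.fourierIntegral_continuous
    Real.continuous_fourierChar continuous_inner hfi
  have hum : MemLp (fun x => (u x : ℂ)) 2 volume :=
    (Lp.memLp (complexify u)).ae_eq (coeFn_complexify u)
  have hae : ∀ᵐ x, (u x : ℂ) = 𝓕 f x := by
    apply ae_eq_of_integral_contDiff_smul_eq (hum.locallyIntegrable one_le_two)
      hcont.locallyIntegrable
    intro g hg hgs
    have hg1 : ContDiff ℝ ∞ (fun x => (g x : ℂ)) := Complex.ofRealCLM.contDiff.comp hg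
    have hs1 : HasCompactSupport (fun x => (g x : ℂ)) := hgs.comp_left (g := Complex.ofReal) rfl
    let ψ : 𝓢(ℝ, ℂ) := hs1.toSchwartzMap hg1
    have e1 : ∫ x, g x • (u x : ℂ) = pairing u ψ := by
      rw [pairing]; congr 1; ext x; simp [ψ, mul_comm]
    have e2 : ∫ x, g x • 𝓕 f x = ∫ x, 𝓕 f x * ψ x := by
      congr 1; ext x; simp [ψ, mul_comm]
    rw [e1, e2, pairing_eq_integral_FT, integral_fourier_smul_of_integrable hfi ψ.integrable,
      ← integral_neg_eq_self]
    congr 1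
    ext η
    rw [hf, SchwartzMap.fourierInv_coe, Real.fourierInv_eq_fourier_neg, neg_neg]
  filter_upwards [hae] with x hx
  have h1 : |u x| = ‖𝓕 f x‖ := by rw [← hx]; simp
  rw [h1]
  have h2 := VectorFourier.norm_fourierIntegral_le_integral_norm Real.fourierChar
    volume (innerₗ ℝ) f x
  refine le_trans h2 ?_
  rw [← integral_neg_eq_self]
  simp [hf]

theorem norm_sq_eq_integral_FT (u : RealL2) : ‖u‖ ^ 2 = ∫ η, ‖FT u η‖ ^ 2 := by
  have h := ofReal_inner_eq_integral u u
  rw [real_inner_self_eq_norm_sq] at h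
  have h2 : ∫ η, FT u η * conj (FT u η) = ((∫ η, ‖FT u η‖ ^ 2 : ℝ) : ℂ) := by
    rw [← integral_complex_ofReal]
    congr 1
    ext η
    rw [Complex.mul_conj, Complex.normSq_eq_norm_sq]
  rw [h2] at h
  exact_mod_cast h

theorem integrable_FT_sq (u : RealL2) : Integrable (fun η => ‖FT u η‖ ^ 2) :=
  (memLp_two_iff_integrable_sq_norm (Lp.aestronglyMeasurable _)).mp (Lp.memLp (FT u))

/-- A multiplier with square-integrable symbol maps into bounded functions. -/
theorem exists_sup_bound_mulOp {m : ℝ → ℂ} (hm : IsSymbol m) (hm2 : MemLp m 2 volume) :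
    ∃ C, 0 ≤ C ∧ ∀ u, ∀ᵐ x, |mulOp m u x| ≤ C * ‖u‖ := by
  refine ⟨(∫ η, ‖m η‖ ^ (2 : ℝ)) ^ (1 / 2 : ℝ), by positivity, fun u => ?_⟩
  have hi : Integrable (fun η => m η * FT u η) := hm2.integrable_mul (Lp.memLp (FT u))
  have hi2 : Integrable (FT (mulOp m u)) := hi.congr (FT_mulOp hm u).symm
  filter_upwards [ae_abs_le_of_integrable_FT (mulOp m u) hi2] with x hx
  refine hx.trans ?_
  have e1 : ∫ η, ‖FT (mulOp m u) η‖ = ∫ η, ‖m η‖ * ‖FT u η‖ := by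
    apply integral_congr_ae
    filter_upwards [FT_mulOp hm u] with η h
    rw [h, norm_mul]
  rw [e1]
  -- Cauchy–Schwarz in frequency: the L² norm of the symbol is the constant.
  have hH := integral_mul_norm_le_Lp_mul_Lq (μ := (volume : Measure ℝ)) (f := m) (g := FT u)
    Real.HolderConjugate.two_two (by simpa using hm2) (by simpa using Lp.memLp (FT u))
  refine hH.trans (mul_le_mul_of_nonneg_left (le_of_eq ?_) (by positivity))
  simp_rw [Real.rpow_two]
  rw [← norm_sq_eq_integral_FT, ← Real.sqrt_eq_rpow, Real.sqrt_sq (norm_nonneg _)]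

/-! ### Smoothing multipliers and Sobolev spaces -/

/-- Real even symbols in Mathlib's frequency variable `η = ξ / (2π)` of order `-s`, bounded above
and below by multiples of `(1 + ξ²) ^ (-s/2)`. -/
structure IsSmoothing (s : ℝ) (a : ℝ → ℝ) : Prop where
  measurable : Measurable a
  even : ∀ η, a (-η) = a η
  bounds : ∃ c C : ℝ, 0 < c ∧ 0 < C ∧ ∀ η, c * (1 + (2 * Real.pi * η) ^ 2) ^ (-s / 2) ≤ a η ∧
    a η ≤ C * (1 + (2 * Real.pi * η) ^ 2) ^ (-s / 2)

theorem one_le_bracket (x : ℝ) : 1 ≤ 1 + x ^ 2 := by nlinarith [sq_nonneg x]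

theorem bracket_pos (x : ℝ) : 0 < 1 + x ^ 2 := by positivity

section Smoothing

variable {s : ℝ} {a : ℝ → ℝ}

theorem IsSmoothing.pos (ha : IsSmoothing s a) (η : ℝ) : 0 < a η := by
  obtain ⟨c, C, hc, hC, h⟩ := ha.bounds
  exact lt_of_lt_of_le (mul_pos hc (Real.rpow_pos_of_pos (bracket_pos _) _)) (h η).1

theorem IsSmoothing.isSymbol (ha : IsSmoothing s a) (hs : 0 ≤ s) :
    IsSymbol (fun η => (a η : ℂ)) := by
  obtain ⟨c, C, hc, hC, h⟩ := ha.bounds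
  refine isSymbol_ofReal ha.measurable ha.even (C := C) fun η => ?_
  rw [abs_of_pos (ha.pos η)]
  refine (h η).2.trans ?_
  have : (1 + (2 * Real.pi * η) ^ 2) ^ (-s / 2) ≤ 1 :=
    Real.rpow_le_one_of_one_le_of_nonpos (one_le_bracket _) (by linarith)
  nlinarith

/-- The square is of size (1 + ξ²)^(-s), integrable on the line exactly because s > 1/2; this is the
Sobolev embedding in the form used below. -/
theorem IsSmoothing.memLp (ha : IsSmoothing s a) (hs : 1 / 2 < s) :
    MemLp (fun η => (a η : ℂ)) 2 volume := by
  obtain ⟨c, C, hc, hC, h⟩ := ha.bounds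
  have h1 : Integrable (fun x : ℝ => ((1 : ℝ) + ‖x‖ ^ 2) ^ (-(2 * s) / 2)) :=
    integrable_rpow_neg_one_add_norm_sq (by simp; linarith)
  have h2 : Integrable (fun η : ℝ => ((1 : ℝ) + (2 * Real.pi * η) ^ 2) ^ (-s)) := by
    have := h1.comp_mul_left' (R := 2 * Real.pi) (by positivity)
    refine this.congr (Filter.Eventually.of_forall fun x => ?_)
    simp only [Real.norm_eq_abs, sq_abs]
    congr 1
    ring
  refine (memLp_two_iff_integrable_sq_norm
    (Complex.measurable_ofReal.comp ha.measurable).aestronglyMeasurable).mpr ?_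
  refine (h2.const_mul (C ^ 2)).mono'
    ((Complex.measurable_ofReal.comp ha.measurable).norm.pow_const 2).aestronglyMeasurable ?_
  refine Filter.Eventually.of_forall fun η => ?_
  rw [Real.norm_of_nonneg (by positivity), Function.comp_apply, Complex.norm_real,
    Real.norm_of_nonneg (ha.pos η).le]
  calc a η ^ 2 ≤ (C * (1 + (2 * Real.pi * η) ^ 2) ^ (-s / 2)) ^ 2 := by
        gcongr
        · exact (ha.pos η).le
        · exact (h η).2
    _ = _ := by
        rw [mul_pow, ← Real.rpow_natCast (_ ^ _), ← Real.rpow_mul (bracket_pos _).le]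
        congr 2
        push_cast
        ring

theorem hat_eq_FT (u : RealL2) (ξ : ℝ) : hat u ξ = FT u (ξ / (2 * Real.pi)) := rfl

theorem memSobolev_iff (u : RealL2) : MemSobolev s u ↔
    Integrable (fun η => (1 + (2 * Real.pi * η) ^ 2) ^ s * ‖FT u η‖ ^ 2) := by
  have h2pi : (2 * Real.pi) ≠ 0 := by positivity
  have hq : Measure.QuasiMeasurePreserving (fun ξ : ℝ => ξ / (2 * Real.pi)) volume volume := by
    simp_rw [div_eq_inv_mul]
    refine ⟨measurable_const_mul _, ?_⟩
    rw [Real.map_volume_mul_left (inv_ne_zero h2pi)]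
    exact Measure.smul_absolutelyContinuous
  have hmeas : AEStronglyMeasurable
      (fun ξ : ℝ => (((1 + ξ ^ 2) ^ (s / 2) : ℝ) : ℂ) * hat u ξ) volume := by
    refine AEStronglyMeasurable.mul (Measurable.aestronglyMeasurable (by fun_prop)) ?_
    exact (Lp.aestronglyMeasurable (FT u)).comp_quasiMeasurePreserving hq
  rw [MemSobolev, memLp_two_iff_integrable_sq_norm hmeas, ← integrable_comp_mul_left_iff _ h2pi]
  apply integrable_congr
  refine Filter.Eventually.of_forall fun η => ?_
  simp only [norm_mul, Complex.norm_real, mul_pow, hat_eq_FT]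
  rw [mul_div_cancel_left₀ _ h2pi, Real.norm_of_nonneg (by positivity), ← Real.rpow_natCast (_ ^ _),
    ← Real.rpow_mul (by positivity)]
  norm_num

theorem sobolevNorm_eq (u : RealL2) : sobolevNorm s u =
    Real.sqrt (2 * Real.pi * ∫ η, (1 + (2 * Real.pi * η) ^ 2) ^ s * ‖FT u η‖ ^ 2) := by
  have h2pi : (2 * Real.pi) ≠ 0 := by positivity
  have h := Measure.integral_comp_div
    (fun η => (1 + (2 * Real.pi * η) ^ 2) ^ s * ‖FT u η‖ ^ 2) (2 * Real.pi)
  rw [abs_of_pos (by positivity), smul_eq_mul] at h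
  rw [sobolevNorm, ← h]
  congr 2
  ext ξ
  rw [hat_eq_FT, mul_div_cancel₀ _ h2pi]

theorem rpow_mul_sq_rpow_half (x : ℝ) :
    (1 + x ^ 2) ^ s * ((1 + x ^ 2) ^ (-s / 2)) ^ 2 = 1 := by
  rw [← Real.rpow_natCast (_ ^ _), ← Real.rpow_mul (bracket_pos _).le, ← Real.rpow_add
    (bracket_pos _)]
  have : s + -s / 2 * ((2 : ℕ) : ℝ) = 0 := by push_cast; ring
  rw [this, Real.rpow_zero]

/-- The weighted square of the symbol lies between positive constants. -/
theorem IsSmoothing.weight_bounds (ha : IsSmoothing s a) : ∃ c C : ℝ, 0 < c ∧ 0 < C ∧ ∀ η,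
    c ≤ (1 + (2 * Real.pi * η) ^ 2) ^ s * a η ^ 2 ∧
      (1 + (2 * Real.pi * η) ^ 2) ^ s * a η ^ 2 ≤ C := by
  obtain ⟨c, C, hc, hC, h⟩ := ha.bounds
  refine ⟨c ^ 2, C ^ 2, by positivity, by positivity, fun η => ?_⟩
  have hp : 0 ≤ (1 + (2 * Real.pi * η) ^ 2) ^ s := by positivity
  have e := rpow_mul_sq_rpow_half (s := s) (2 * Real.pi * η)
  constructor
  · calc c ^ 2 = (1 + (2 * Real.pi * η) ^ 2) ^ s *
          (c * (1 + (2 * Real.pi * η) ^ 2) ^ (-s / 2)) ^ 2 := by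
          rw [mul_pow c]; linear_combination (-c ^ 2) * e
      _ ≤ _ := by
          gcongr
          exact (h η).1
  · calc _ ≤ (1 + (2 * Real.pi * η) ^ 2) ^ s *
          (C * (1 + (2 * Real.pi * η) ^ 2) ^ (-s / 2)) ^ 2 := by
          gcongr
          · exact (ha.pos η).le
          · exact (h η).2
      _ = C ^ 2 := by rw [mul_pow C]; linear_combination (C ^ 2) * e

theorem IsSmoothing.memSobolev_mulOp (ha : IsSmoothing s a) (hs : 0 ≤ s) (U : RealL2) :
    MemSobolev s (mulOp (fun η => (a η : ℂ)) U) := by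
  obtain ⟨c, C, hc, hC, h⟩ := ha.weight_bounds
  rw [memSobolev_iff]
  refine ((integrable_FT_sq U).const_mul C).mono'
    (AEStronglyMeasurable.mul (Measurable.aestronglyMeasurable (by fun_prop))
      ((Lp.aestronglyMeasurable _).norm.pow 2)) ?_
  filter_upwards [FT_mulOp (ha.isSymbol hs) U] with η h1
  rw [Real.norm_of_nonneg (by positivity), h1, norm_mul, mul_pow ‖(a η : ℂ)‖, ← mul_assoc,
    Complex.norm_real, Real.norm_eq_abs, sq_abs]
  exact mul_le_mul_of_nonneg_right (h η).2 (by positivity)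

/-- Division by the symbol keeps Hermitian symmetry. Together with `memSobolev_mulOp` this makes H^s
the range of the multiplier, so Sobolev curves can be handled as L² curves. -/
theorem IsSmoothing.exists_eq_mulOp (ha : IsSmoothing s a) (hs : 0 ≤ s) {u : RealL2}
    (hu : MemSobolev s u) : ∃ U, u = mulOp (fun η => (a η : ℂ)) U := by
  obtain ⟨c, C, hc, hC, h⟩ := ha.weight_bounds
  rw [memSobolev_iff] at hu
  have hmeas : AEStronglyMeasurable (fun η => ((a η)⁻¹ : ℂ) * FT u η) volume :=
    (Complex.measurable_ofReal.comp ha.measurable).inv.aestronglyMeasurable.mul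
      (Lp.aestronglyMeasurable _)
  have hL : MemLp (fun η => ((a η)⁻¹ : ℂ) * FT u η) 2 volume := by
    rw [memLp_two_iff_integrable_sq_norm hmeas]
    refine (hu.const_mul c⁻¹).mono' (hmeas.norm.pow 2) (Filter.Eventually.of_forall fun η => ?_)
    have hp := ha.pos η
    rw [Real.norm_of_nonneg (by positivity), norm_mul, mul_pow, norm_inv, Complex.norm_real,
      Real.norm_of_nonneg hp.le, ← mul_assoc]
    refine mul_le_mul_of_nonneg_right ?_ (by positivity)
    rw [inv_pow, inv_mul_eq_div, inv_eq_one_div, div_le_div_iff₀ (by positivity) hc]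
    linarith [(h η).1]
  obtain ⟨U, hU⟩ := exists_FT_eq (hL.toLp _) (by
    have h1 := hL.coeFn_toLp
    have h2 := measurePreserving_neg_real.quasiMeasurePreserving.ae h1
    filter_upwards [h1, h2, FT_neg u] with x h1 h2 h3
    rw [h1, h2, h3, ha.even, map_mul, map_inv₀, Complex.conj_ofReal])
  refine ⟨U, FT_ext ?_⟩
  filter_upwards [FT_mulOp (ha.isSymbol hs) U, hL.coeFn_toLp] with η h1 h2
  rw [h1, hU, h2, ← mul_assoc, mul_inv_cancel₀, one_mul]
  exact_mod_cast (ha.pos η).ne'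

theorem IsSmoothing.sobolevNorm_equiv (ha : IsSmoothing s a) (hs : 0 ≤ s) :
    ∃ c C : ℝ, 0 < c ∧ 0 < C ∧ ∀ U, sobolevNorm s (mulOp (fun η => (a η : ℂ)) U) ≤ C * ‖U‖ ∧
      c * ‖U‖ ≤ sobolevNorm s (mulOp (fun η => (a η : ℂ)) U) := by
  obtain ⟨c, C, hc, hC, h⟩ := ha.weight_bounds
  refine ⟨Real.sqrt (2 * Real.pi * c), Real.sqrt (2 * Real.pi * C), by positivity, by positivity,
    fun U => ?_⟩
  have hi := (memSobolev_iff _).mp (ha.memSobolev_mulOp hs U)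
  have e : ∀ᵐ η, (1 + (2 * Real.pi * η) ^ 2) ^ s * ‖FT (mulOp (fun η => (a η : ℂ)) U) η‖ ^ 2
      = ((1 + (2 * Real.pi * η) ^ 2) ^ s * a η ^ 2) * ‖FT U η‖ ^ 2 := by
    filter_upwards [FT_mulOp (ha.isSymbol hs) U] with η h1
    rw [h1, norm_mul, mul_pow ‖(a η : ℂ)‖, ← mul_assoc, Complex.norm_real, Real.norm_eq_abs, sq_abs]
  rw [sobolevNorm_eq]
  constructor
  · rw [← Real.sqrt_sq (norm_nonneg U), ← Real.sqrt_mul (by positivity), mul_assoc (2 * Real.pi) C]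
    apply Real.sqrt_le_sqrt
    refine mul_le_mul_of_nonneg_left ?_ (by positivity)
    rw [norm_sq_eq_integral_FT, ← integral_const_mul]
    apply integral_mono_ae hi ((integrable_FT_sq U).const_mul C)
    filter_upwards [e] with η he
    rw [he]
    exact mul_le_mul_of_nonneg_right (h η).2 (by positivity)
  · rw [← Real.sqrt_sq (norm_nonneg U), ← Real.sqrt_mul (by positivity), mul_assoc (2 * Real.pi) c]
    apply Real.sqrt_le_sqrt
    refine mul_le_mul_of_nonneg_left ?_ (by positivity)
    rw [norm_sq_eq_integral_FT, ← integral_const_mul]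
    apply integral_mono_ae ((integrable_FT_sq U).const_mul c) hi
    filter_upwards [e] with η he
    rw [he]
    exact mul_le_mul_of_nonneg_right (h η).1 (by positivity)

/-- The symbol m inverts a pointwise, hence the quadratic forms in the energy are exactly L² norms
of preimages. The product being the transform of U, the default value 0 of `multiplier` does not
occur. -/
theorem norm_multiplier_mulOp (ha : IsSmoothing s a) (hs : 0 ≤ s) {m : ℝ → ℝ}
    (hm : ∀ η, m (2 * Real.pi * η) * a η = 1) (U : RealL2) :
    ‖multiplier m (mulOp (fun η => (a η : ℂ)) U)‖ = ‖U‖ := by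
  have hae : (fun η : ℝ => (m (2 * Real.pi * η) : ℂ) *
      (𝓕 (complexify (mulOp (fun η => (a η : ℂ)) U)) : ComplexL2) η) =ᵐ[volume] FT U := by
    filter_upwards [FT_mulOp (ha.isSymbol hs) U] with η h1
    rw [FT_apply] at h1
    rw [h1, ← mul_assoc, ← Complex.ofReal_mul, hm, Complex.ofReal_one, one_mul]
  have hL : MemLp (fun η : ℝ => (m (2 * Real.pi * η) : ℂ) *
      (𝓕 (complexify (mulOp (fun η => (a η : ℂ)) U)) : ComplexL2) η) 2 volume :=
    (Lp.memLp (FT U)).ae_eq hae.symm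
  rw [multiplier, dif_pos hL]
  have e : hL.toLp _ = FT U := Lp.ext (hL.coeFn_toLp.trans hae)
  rw [e, ← FT.norm_map U, ← Lp.norm_fourier_eq, FourierTransform.fourier_fourierInv_eq]

end Smoothing

/-! ### Balls in operator ranges and a global Picard theorem -/

/-- The range of the `M`-ball under an injective symmetric operator is described by the
inequalities `|⟪z, φ⟫| ≤ M ‖K φ‖`. -/
theorem exists_preimage_of_inner_le {H : Type*} [NormedAddCommGroup H] [InnerProductSpace ℝ H]
    [CompleteSpace H] {K : H →L[ℝ] H} (hK : ∀ u v, inner ℝ (K u) v = inner ℝ u (K v))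
    (hinj : Function.Injective K) {z : H} {M : ℝ} (hM : 0 ≤ M)
    (h : ∀ φ, |inner ℝ z φ| ≤ M * ‖K φ‖) : ∃ Z, K Z = z ∧ ‖Z‖ ≤ M := by
  let e := LinearEquiv.ofInjective (K : H →ₗ[ℝ] H) hinj
  -- The functional K φ ↦ ⟪z, φ⟫ on the range of K is bounded by M; Hahn–Banach extends it without
  -- enlarging the norm and Riesz represents it by the preimage.
  let f : StrongDual ℝ (LinearMap.range (K : H →ₗ[ℝ] H)) :=
    LinearMap.mkContinuous ((innerSL ℝ z : H →ₗ[ℝ] ℝ) ∘ₗ (e.symm : _ →ₗ[ℝ] H)) M (by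
      intro x
      have hx : K (e.symm x) = x := congrArg Subtype.val (e.apply_symm_apply x)
      have := h (e.symm x)
      rw [hx] at this
      exact this)
  obtain ⟨g, hg, hgn⟩ := exists_extension_norm_eq _ f
  refine ⟨(InnerProductSpace.toDual ℝ H).symm g, ?_, ?_⟩
  · apply ext_inner_right ℝ
    intro φ
    rw [hK, InnerProductSpace.toDual_symm_apply]
    have h1 := hg (e φ)
    have h2 : f (e φ) = inner ℝ z φ := by
      simp [f]
    rw [← h2, ← h1]
    rfl
  · rw [LinearIsometryEquiv.norm_map, hgn]
    exact LinearMap.mkContinuous_norm_le _ hM _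

/-- Integration in time gains 1/lam on functions of growth exp(lam |t|). In the correspondingly
weighted sup norm the Picard map contracts on the whole time line at once. -/
theorem norm_integral_le_exp {X : Type*} [NormedAddCommGroup X] [NormedSpace ℝ X]
    {f : ℝ → X} {A lam : ℝ} (hlam : 0 < lam) (hA : 0 ≤ A)
    (hf : ∀ s, ‖f s‖ ≤ A * Real.exp (lam * |s|)) (t : ℝ) :
    ‖∫ s in (0 : ℝ)..t, f s‖ ≤ A * Real.exp (lam * |t|) / lam := by
  have key : ∀ (g : ℝ → X), (∀ s, ‖g s‖ ≤ A * Real.exp (lam * |s|)) → ∀ t, 0 ≤ t →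
      ‖∫ s in (0 : ℝ)..t, g s‖ ≤ A * Real.exp (lam * |t|) / lam := by
    intro g hg t ht
    have h1 : ‖∫ s in (0 : ℝ)..t, g s‖ ≤ ∫ s in (0 : ℝ)..t, A * Real.exp (lam * s) := by
      apply intervalIntegral.norm_integral_le_of_norm_le ht
      · refine Filter.Eventually.of_forall fun s hs => ?_
        have := hg s
        rwa [abs_of_pos hs.1] at this
      · exact (by fun_prop : Continuous fun s : ℝ => A * Real.exp (lam * s)).intervalIntegrable _ _
    refine h1.trans ?_
    rw [intervalIntegral.integral_const_mul,
      intervalIntegral.integral_comp_mul_left (fun x => Real.exp x) hlam.ne', integral_exp,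
      mul_zero, Real.exp_zero, smul_eq_mul, abs_of_nonneg ht, mul_div_assoc]
    apply mul_le_mul_of_nonneg_left _ hA
    rw [inv_mul_eq_div]
    gcongr
    linarith
  rcases le_total 0 t with ht | ht
  · exact key f hf t ht
  · have h1 := key (fun s => f (-s)) (fun s => by simpa using hf (-s)) (-t) (by linarith)
    rw [intervalIntegral.integral_comp_neg (fun s => f s), neg_neg, neg_zero,
      intervalIntegral.integral_symm, norm_neg, abs_neg] at h1
    exact h1

section ODE

variable {X : Type*} [NormedAddCommGroup X] [NormedSpace ℝ X] [CompleteSpace X]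

/-- Global solvability of a globally Lipschitz ordinary differential equation whose right hand side
preserves a family of linear bounds. -/
theorem exists_global_ode_solution (G : ℝ → X → X) (hG : Continuous (Function.uncurry G))
    {L : ℝ} (hL : 0 < L) (hlip : ∀ t x y, ‖G t x - G t y‖ ≤ L * ‖x - y‖) (h0 : ∀ t, G t 0 = 0)
    (x₀ : X) {ι : Type*} (ℓ : ι → X →L[ℝ] ℝ) (c : ι → ℝ)
    (hstab : ∀ M, 0 ≤ M → ∀ t x, (∀ i, |ℓ i x| ≤ M * c i) → ∀ i, |ℓ i (G t x)| ≤ L * M * c i)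
    {M₀ : ℝ} (hM₀ : 0 ≤ M₀) (hx₀ : ∀ i, |ℓ i x₀| ≤ M₀ * c i) :
    ∃ z : ℝ → X, z 0 = x₀ ∧ (∀ t, HasDerivAt z (G t (z t)) t) ∧
      ∀ t i, |ℓ i (z t)| ≤ 2 * M₀ * Real.exp (2 * L * |t|) * c i := by
  -- Twice the Lipschitz constant: the contraction factor is L / lam = 1/2, and the same half closes
  -- the linear bounds below.
  set lam := 2 * L with hlam
  have hlam0 : 0 < lam := by positivity
  have hgrow : ∀ t x, ‖G t x‖ ≤ L * ‖x‖ := fun t x => by simpa [h0] using hlip t x 0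
  have hexp : ∀ t : ℝ, Real.exp (-(lam * |t|)) * Real.exp (lam * |t|) = 1 := fun t => by
    rw [← Real.exp_add]; simp
  have hcont : ∀ v : BoundedContinuousFunction ℝ X,
      Continuous (fun s => G s (Real.exp (lam * |s|) • v s)) := fun v =>
    hG.comp (continuous_id.prodMk
      ((by fun_prop : Continuous fun s : ℝ => Real.exp (lam * |s|)).smul v.continuous))
  have hprim : ∀ v : BoundedContinuousFunction ℝ X,
      Continuous (fun t => ∫ s in (0 : ℝ)..t, G s (Real.exp (lam * |s|) • v s)) := fun v =>
    intervalIntegral.continuous_primitive (fun a b => (hcont v).intervalIntegrable a b) 0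
  have hle1 : ∀ t : ℝ, Real.exp (-(lam * |t|)) ≤ 1 := fun t =>
    Real.exp_le_one_iff.mpr (by have := abs_nonneg t; nlinarith)
  have hbound : ∀ (v : BoundedContinuousFunction ℝ X) (t : ℝ),
      ‖Real.exp (-(lam * |t|)) • (x₀ + ∫ s in (0 : ℝ)..t, G s (Real.exp (lam * |s|) • v s))‖
        ≤ ‖x₀‖ + L * ‖v‖ / lam := by
    intro v t
    have h1 : ‖∫ s in (0 : ℝ)..t, G s (Real.exp (lam * |s|) • v s)‖
        ≤ (L * ‖v‖) * Real.exp (lam * |t|) / lam := by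
      apply norm_integral_le_exp hlam0 (by positivity)
      intro s
      refine (hgrow _ _).trans ?_
      rw [norm_smul, Real.norm_of_nonneg (Real.exp_pos _).le]
      have := v.norm_coe_le_norm s
      have he := Real.exp_pos (lam * |s|)
      calc L * (Real.exp (lam * |s|) * ‖v s‖) ≤ L * (Real.exp (lam * |s|) * ‖v‖) := by gcongr
        _ = _ := by ring
    rw [norm_smul, Real.norm_of_nonneg (Real.exp_pos _).le]
    calc _ ≤ Real.exp (-(lam * |t|)) * (‖x₀‖ + (L * ‖v‖) * Real.exp (lam * |t|) / lam) := by
          gcongr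
          exact (norm_add_le _ _).trans (by gcongr)
      _ = Real.exp (-(lam * |t|)) * ‖x₀‖ + L * ‖v‖ / lam := by
          linear_combination (L * ‖v‖ / lam) * hexp t
      _ ≤ _ := by
          gcongr
          exact mul_le_of_le_one_left (norm_nonneg _) (hle1 t)
  let Φ : BoundedContinuousFunction ℝ X → BoundedContinuousFunction ℝ X := fun v =>
    BoundedContinuousFunction.ofNormedAddCommGroup
      (fun t => Real.exp (-(lam * |t|)) •
        (x₀ + ∫ s in (0 : ℝ)..t, G s (Real.exp (lam * |s|) • v s)))
      ((by fun_prop : Continuous fun t : ℝ => Real.exp (-(lam * |t|))).smul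
        (continuous_const.add (hprim v))) (‖x₀‖ + L * ‖v‖ / lam) (hbound v)
  have hΦ : ∀ v t, Φ v t = Real.exp (-(lam * |t|)) •
        (x₀ + ∫ s in (0 : ℝ)..t, G s (Real.exp (lam * |s|) • v s)) := fun v t => rfl
  have hcontr : ContractingWith (1 / 2) Φ := by
    refine ⟨by norm_num, LipschitzWith.of_dist_le_mul fun v w => ?_⟩
    rw [BoundedContinuousFunction.dist_le (by positivity)]
    intro t
    rw [dist_eq_norm, hΦ, hΦ, ← smul_sub, add_sub_add_left_eq_sub,
      ← intervalIntegral.integral_sub ((hcont v).intervalIntegrable _ _)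
        ((hcont w).intervalIntegrable _ _), norm_smul, Real.norm_of_nonneg (Real.exp_pos _).le]
    have h1 : ‖∫ s in (0 : ℝ)..t, (G s (Real.exp (lam * |s|) • v s) -
        G s (Real.exp (lam * |s|) • w s))‖ ≤ (L * dist v w) * Real.exp (lam * |t|) / lam := by
      apply norm_integral_le_exp hlam0 (by positivity)
      intro s
      refine (hlip _ _ _).trans ?_
      rw [← smul_sub, norm_smul, Real.norm_of_nonneg (Real.exp_pos _).le, ← dist_eq_norm]
      have := v.dist_coe_le_dist (g := w) s
      have he := Real.exp_pos (lam * |s|)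
      calc L * (Real.exp (lam * |s|) * dist (v s) (w s))
          ≤ L * (Real.exp (lam * |s|) * dist v w) := by gcongr
        _ = _ := by ring
    calc _ ≤ Real.exp (-(lam * |t|)) * ((L * dist v w) * Real.exp (lam * |t|) / lam) := by gcongr
      _ = L * dist v w / lam := by linear_combination (L * dist v w / lam) * hexp t
      _ = _ := by
          rw [hlam]
          push_cast
          field_simp
  have hc0 : ∀ i, 0 ≤ M₀ * c i := fun i => (abs_nonneg _).trans (hx₀ i)
  -- Closed under uniform limits because each bound involves a continuous functional. The constant 2
  -- M₀ reproduces itself: M₀ from the datum plus L · 2 M₀ / lam = M₀ from the integral.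
  let S : Set (BoundedContinuousFunction ℝ X) := {v | ∀ t i, |ℓ i (v t)| ≤ 2 * M₀ * c i}
  have hS : IsClosed S := by
    simp only [S, Set.ofPred_forall]
    refine isClosed_iInter fun t => isClosed_iInter fun i => ?_
    refine isClosed_le ?_ continuous_const
    exact ((ℓ i).continuous.comp (BoundedContinuousFunction.evalCLM ℝ t).continuous).abs
  have hmap : Set.MapsTo Φ S S := by
    intro v hv t i
    rw [hΦ, map_smul, map_add, smul_eq_mul, abs_mul, abs_of_pos (Real.exp_pos _),
      ← (ℓ i).intervalIntegral_comp_comm ((hcont v).intervalIntegrable _ _)]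
    have h1 : ‖∫ s in (0 : ℝ)..t, ℓ i (G s (Real.exp (lam * |s|) • v s))‖
        ≤ (L * (2 * M₀ * c i)) * Real.exp (lam * |t|) / lam := by
      apply norm_integral_le_exp hlam0 (by have := hc0 i; nlinarith)
      intro s
      have he := Real.exp_pos (lam * |s|)
      have h2 := hstab (2 * M₀ * Real.exp (lam * |s|)) (by positivity) s
        (Real.exp (lam * |s|) • v s) (fun j => by
          rw [map_smul, smul_eq_mul, abs_mul, abs_of_pos he]
          nlinarith [hv s j]) i
      rw [Real.norm_eq_abs]
      linarith
    rw [Real.norm_eq_abs] at h1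
    calc _ ≤ Real.exp (-(lam * |t|)) * (M₀ * c i
            + (L * (2 * M₀ * c i)) * Real.exp (lam * |t|) / lam) := by
          gcongr
          exact (abs_add_le _ _).trans (add_le_add (hx₀ i) h1)
      _ = Real.exp (-(lam * |t|)) * (M₀ * c i) + M₀ * c i := by
          rw [mul_add]
          congr 1
          rw [hlam] at *
          field_simp
          linear_combination (M₀ * c i) * hexp t
      _ ≤ 1 * (M₀ * c i) + M₀ * c i := by
          gcongr
          · exact hc0 i
          · exact hle1 t
      _ = _ := by ring
  have hzero : (0 : BoundedContinuousFunction ℝ X) ∈ S := fun t i => by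
    have := hc0 i
    simp only [BoundedContinuousFunction.coe_zero, Pi.zero_apply, map_zero, abs_zero]
    linarith
  set v := hcontr.fixedPoint Φ with hv
  have hfix : Φ v = v := hcontr.fixedPoint_isFixedPt
  have hvS : v ∈ S := by
    -- The fixed point is the limit of iterates started at 0, all of which lie in the closed
    -- invariant set.
    refine hS.mem_of_tendsto (hcontr.tendsto_iterate_fixedPoint 0)
      (Filter.Eventually.of_forall fun n => ?_)
    exact (hmap.iterate n) hzero
  have hz : ∀ t, Real.exp (lam * |t|) • v t
      = x₀ + ∫ s in (0 : ℝ)..t, G s (Real.exp (lam * |s|) • v s) := by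
    intro t
    conv_lhs => rw [← hfix, hΦ, smul_smul, mul_comm, hexp, one_smul]
  refine ⟨fun t => Real.exp (lam * |t|) • v t, ?_, fun t => ?_, fun t i => ?_⟩
  · have h1 := hz 0
    rw [intervalIntegral.integral_same, add_zero] at h1
    exact h1
  · have h1 : HasDerivAt (fun t => x₀ + ∫ s in (0 : ℝ)..t, G s (Real.exp (lam * |s|) • v s))
        (G t (Real.exp (lam * |t|) • v t)) t :=
      (intervalIntegral.integral_hasDerivAt_right ((hcont v).intervalIntegrable _ _)
        (hcont v).aestronglyMeasurable.stronglyMeasurableAtFilter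
        (hcont v).continuousAt).const_add _
    exact h1.congr_of_eventuallyEq (Filter.Eventually.of_forall hz)
  · rw [map_smul, smul_eq_mul, abs_mul, abs_of_pos (Real.exp_pos _)]
    have := mul_le_mul_of_nonneg_left (hvS t i) (Real.exp_pos (lam * |t|)).le
    linarith

end ODE

/-! ### Frequency bands and projections -/

theorem mulOp_mulOp {m n q : ℝ → ℂ} (hm : IsSymbol m) (hn : IsSymbol n)
    (h : ∀ η, m η * n η = q η) (u : RealL2) : mulOp m (mulOp n u) = mulOp q u := by
  rw [← mulOp_mul hm hn]
  simp_rw [h]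

theorem mulOp_sub {m n : ℝ → ℂ} (hm : IsSymbol m) (hn : IsSymbol n) :
    mulOp (fun η => m η - n η) = mulOp m - mulOp n := by
  have h1 := mulOp_add hm (hn.real_smul (-1))
  rw [mulOp_real_smul hn] at h1
  rw [neg_one_smul, ← sub_eq_add_neg] at h1
  rw [← h1]
  congr 1
  ext η
  push_cast
  ring

/-- Measurable Hermitian symbols bounded on bounded sets of frequencies. -/
structure IsLocSymbol (m : ℝ → ℂ) : Prop where
  measurable : Measurable m
  herm : ∀ η, m (-η) = conj (m η)
  bounded : ∀ n : ℕ, ∃ C : ℝ, ∀ η : ℝ, |η| < n → ‖m η‖ ≤ C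

/-- The restriction of a symbol to the frequency band `|η| < n`. -/
def band (n : ℕ) (m : ℝ → ℂ) (η : ℝ) : ℂ := if |η| < n then m η else 0

theorem IsSymbol.isLocSymbol {m : ℝ → ℂ} (hm : IsSymbol m) : IsLocSymbol m :=
  ⟨hm.measurable, hm.herm, fun _ => hm.bounded.imp fun _ h η _ => h η⟩

theorem IsLocSymbol.mul {m q : ℝ → ℂ} (hm : IsLocSymbol m) (hq : IsLocSymbol q) :
    IsLocSymbol (fun η => m η * q η) := by
  refine ⟨hm.measurable.mul hq.measurable, fun η => by rw [hm.herm, hq.herm, map_mul], fun n => ?_⟩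
  obtain ⟨C, hC⟩ := hm.bounded n
  obtain ⟨D, hD⟩ := hq.bounded n
  refine ⟨C * D, fun η hη => ?_⟩
  rw [norm_mul]
  exact mul_le_mul (hC η hη) (hD η hη) (norm_nonneg _) ((norm_nonneg _).trans (hC η hη))

theorem norm_band_le {m : ℝ → ℂ} (n : ℕ) {C : ℝ} (hC0 : 0 ≤ C)
    (hC : ∀ η : ℝ, |η| < n → ‖m η‖ ≤ C) (η : ℝ) : ‖band n m η‖ ≤ C := by
  unfold band
  split_ifs with h
  · exact hC η h
  · simpa using hC0

theorem IsLocSymbol.band {m : ℝ → ℂ} (hm : IsLocSymbol m) (n : ℕ) : IsSymbol (band n m) := by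
  refine ⟨Measurable.ite (measurableSet_lt measurable_id.abs measurable_const) hm.measurable
    measurable_const, fun η => ?_, ?_⟩
  · unfold NonlocalWave.band
    rw [abs_neg, hm.herm]
    split_ifs <;> simp
  · obtain ⟨C, hC⟩ := hm.bounded n
    exact ⟨max C 0, norm_band_le n (le_max_right _ _)
      fun η hη => (hC η hη).trans (le_max_left _ _)⟩

theorem isSymbol_one : IsSymbol (fun _ => 1) := ⟨measurable_const, by simp, 1, by simp⟩

theorem isSymbol_band_one (n : ℕ) : IsSymbol (band n fun _ => 1) :=
  isSymbol_one.isLocSymbol.band n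

/-- The projection to the frequency band `|η| < n`. -/
def proj (n : ℕ) : RealL2 →L[ℝ] RealL2 := mulOp (band n fun _ => 1)

theorem FT_proj (n : ℕ) (u : RealL2) :
    ∀ᵐ η, FT (proj n u) η = if |η| < n then FT u η else 0 := by
  filter_upwards [FT_mulOp (isSymbol_band_one n) u] with η h
  rw [proj, h, band]
  split_ifs <;> simp

theorem norm_proj_le (n : ℕ) (u : RealL2) : ‖proj n u‖ ≤ ‖u‖ := by
  have := norm_mulOp_apply_le (isSymbol_band_one n) (C := 1)
    (norm_band_le n zero_le_one fun η _ => by simp) u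
  simpa [proj] using this

theorem norm_sub_sq_eq (u v : RealL2) : ‖u - v‖ ^ 2 = ∫ η, ‖FT u η - FT v η‖ ^ 2 := by
  rw [norm_sq_eq_integral_FT]
  apply integral_congr_ae
  rw [map_sub]
  filter_upwards [Lp.coeFn_sub (FT u) (FT v)] with η h
  rw [h, Pi.sub_apply]

theorem tendsto_of_norm_sub_sq {ι : Type*} {l : Filter ι} {f : ι → RealL2} {u : RealL2}
    (h : Filter.Tendsto (fun i => ‖f i - u‖ ^ 2) l (nhds 0)) : Filter.Tendsto f l (nhds u) := by
  rw [tendsto_iff_norm_sub_tendsto_zero]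
  have := h.sqrt
  simpa [Real.sqrt_sq (norm_nonneg _)] using this

theorem tendsto_proj (u : RealL2) :
    Filter.Tendsto (fun n => proj n u) Filter.atTop (nhds u) := by
  apply tendsto_of_norm_sub_sq
  have h0 : (0 : ℝ) = ∫ _ : ℝ, (0 : ℝ) := by simp
  simp_rw [norm_sub_sq_eq]
  rw [h0]
  apply tendsto_integral_of_dominated_convergence (fun η => ‖FT u η‖ ^ 2)
  · intro n
    exact (((Lp.aestronglyMeasurable _).sub (Lp.aestronglyMeasurable _)).norm.pow 2)
  · exact integrable_FT_sq u
  · intro n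
    filter_upwards [FT_proj n u] with η h
    rw [h, Real.norm_of_nonneg (by positivity)]
    split_ifs <;> simp
  · have hall : ∀ᵐ η, ∀ n, FT (proj n u) η = if |η| < (n : ℕ) then FT u η else 0 :=
      ae_all_iff.mpr fun n => FT_proj n u
    filter_upwards [hall] with η h
    apply tendsto_const_nhds.congr'
    obtain ⟨N, hN⟩ := exists_nat_gt |η|
    filter_upwards [Filter.eventually_ge_atTop N] with n hn
    rw [h n, if_pos (hN.trans_le (by exact_mod_cast hn))]
    simp

/-! ### The operators of the wave system -/

/-- The symbols `kap` of `B^(1/2) L^(-1/2)` and `om` of `-i ∂ₓ L^(1/2)` of the wave equation. -/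
structure IsAdmissible (s : ℝ) (kap om : ℝ → ℝ) : Prop where
  half_lt : 1 / 2 < s
  smoothing : IsSmoothing s kap
  om_measurable : Measurable om
  om_odd : ∀ η, om (-η) = -om η
  bounded : ∃ C, ∀ η, |kap η ^ 2 * om η| ≤ C
  growth : ∃ σ C : ℝ, 0 ≤ σ ∧ σ ≤ 1 ∧ σ ≤ s ∧ 0 ≤ C ∧ ∀ η, |kap η * om η| ≤ C * (1 + |η| ^ σ)

section Admissible

variable {s : ℝ} {kap om : ℝ → ℝ}

theorem IsAdmissible.kap_pos (h : IsAdmissible s kap om) (η : ℝ) : 0 < kap η := h.smoothing.pos η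

theorem IsAdmissible.s_nonneg (h : IsAdmissible s kap om) : 0 ≤ s := by linarith [h.half_lt]

theorem IsAdmissible.isSymbol_kap (h : IsAdmissible s kap om) : IsSymbol (fun η => (kap η : ℂ)) :=
  h.smoothing.isSymbol h.s_nonneg

theorem IsAdmissible.isLocSymbol_kap_inv (h : IsAdmissible s kap om) :
    IsLocSymbol (fun η => ((kap η)⁻¹ : ℂ)) := by
  refine ⟨(Complex.measurable_ofReal.comp h.smoothing.measurable).inv,
    fun η => by rw [h.smoothing.even, map_inv₀, Complex.conj_ofReal], fun n => ?_⟩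
  obtain ⟨c, C, hc, hC, hb⟩ := h.smoothing.bounds
  set D := c * (1 + (2 * Real.pi * n) ^ 2) ^ (-s / 2) with hD
  have hD0 : 0 < D := by positivity
  refine ⟨D⁻¹, fun η hη => ?_⟩
  rw [norm_inv, Complex.norm_real, Real.norm_of_nonneg (h.kap_pos η).le]
  apply inv_anti₀ hD0
  refine le_trans ?_ (hb η).1
  rw [hD]
  gcongr c * ?_
  apply Real.rpow_le_rpow_of_nonpos (by positivity)
  · rw [← sq_abs (2 * Real.pi * η), abs_mul, abs_of_pos (by positivity : 0 < 2 * Real.pi)]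
    gcongr
  · have := h.s_nonneg
    linarith

theorem IsAdmissible.isSymbol_kap_sq_om (h : IsAdmissible s kap om) :
    IsSymbol (fun η => Complex.I * ((kap η ^ 2 * om η : ℝ) : ℂ)) := by
  refine ⟨measurable_const.mul (Complex.measurable_ofReal.comp
    ((h.smoothing.measurable.pow_const 2).mul h.om_measurable)), fun η => ?_, ?_⟩
  · rw [h.om_odd, h.smoothing.even, map_mul, Complex.conj_I, Complex.conj_ofReal]
    push_cast
    ring
  · obtain ⟨C, hC⟩ := h.bounded
    exact ⟨C, fun η => by simpa [abs_mul] using hC η⟩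

/-- Local boundedness is inherited from kap² om, since 1/kap is bounded on bounded frequency sets.
-/
theorem IsAdmissible.isLocSymbol_om (h : IsAdmissible s kap om) :
    IsLocSymbol (fun η => Complex.I * (om η : ℂ)) := by
  have h1 := (h.isSymbol_kap_sq_om.isLocSymbol.mul h.isLocSymbol_kap_inv).mul h.isLocSymbol_kap_inv
  convert h1 using 1
  ext η
  have := (h.kap_pos η).ne'
  have h2 : (kap η : ℂ) ≠ 0 := by exact_mod_cast this
  push_cast
  field_simp

theorem IsAdmissible.isSymbol_exp (h : IsAdmissible s kap om) (t : ℝ) :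
    IsSymbol (fun η => Complex.exp ((t * om η : ℝ) * Complex.I)) := by
  refine ⟨?_, fun η => ?_, 1, fun η => (norm_exp_phase _).le⟩
  · exact ((Complex.measurable_ofReal.comp (h.om_measurable.const_mul t)).mul_const _).cexp
  · rw [h.om_odd, ← Complex.exp_conj, map_mul, Complex.conj_I, Complex.conj_ofReal]
    congr 1
    push_cast
    ring

/-- The operator `B^(1/2) L^(-1/2)`. -/
def opK (kap : ℝ → ℝ) : RealL2 →L[ℝ] RealL2 := mulOp (fun η => (kap η : ℂ))

/-- The group `exp (t ∂ₓ L^(1/2))`. -/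
def opE (om : ℝ → ℝ) (t : ℝ) : RealL2 →L[ℝ] RealL2 :=
  mulOp (fun η => Complex.exp ((t * om η : ℝ) * Complex.I))

/-- The operator `∂ₓ L^(-1/2) B`. -/
def opM (kap om : ℝ → ℝ) : RealL2 →L[ℝ] RealL2 :=
  mulOp (fun η => Complex.I * ((kap η ^ 2 * om η : ℝ) : ℂ))

/-- The operator `∂ₓ L^(1/2)` restricted to a frequency band. -/
def opOm (om : ℝ → ℝ) (n : ℕ) : RealL2 →L[ℝ] RealL2 :=
  mulOp (band n fun η => Complex.I * (om η : ℂ))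

theorem IsAdmissible.inner_opK (h : IsAdmissible s kap om) (u v : RealL2) :
    inner ℝ (opK kap u) v = inner ℝ u (opK kap v) := inner_mulOp_real h.isSymbol_kap u v

theorem IsAdmissible.opK_injective (h : IsAdmissible s kap om) :
    Function.Injective (opK kap) :=
  mulOp_injective h.isSymbol_kap fun η => by exact_mod_cast (h.kap_pos η).ne'

theorem IsAdmissible.norm_opE (h : IsAdmissible s kap om) (t : ℝ) (u : RealL2) :
    ‖opE om t u‖ = ‖u‖ := by
  rw [← sq_eq_sq₀ (norm_nonneg _) (norm_nonneg _), norm_sq_eq_integral_FT,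
    norm_sq_eq_integral_FT]
  apply integral_congr_ae
  filter_upwards [FT_mulOp (h.isSymbol_exp t) u] with η h1
  rw [opE, h1, norm_mul, norm_exp_phase, one_mul]

theorem opE_zero (om : ℝ → ℝ) (u : RealL2) :
    opE om 0 u = u := by
  simp [opE, mulOp_one]

theorem IsAdmissible.opE_neg_opE (h : IsAdmissible s kap om) (t : ℝ) (u : RealL2) :
    opE om (-t) (opE om t u) = u := by
  rw [opE, opE, mulOp_mulOp (h.isSymbol_exp _) (h.isSymbol_exp _) (q := fun _ => 1), mulOp_one]
  intro η
  rw [← Complex.exp_add]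
  simp

theorem IsAdmissible.opE_opE_neg (h : IsAdmissible s kap om) (t : ℝ) (u : RealL2) :
    opE om t (opE om (-t) u) = u := by
  simpa using h.opE_neg_opE (-t) u

theorem IsAdmissible.opE_opK (h : IsAdmissible s kap om) (t : ℝ) (u : RealL2) :
    opE om t (opK kap u) = opK kap (opE om t u) :=
  mulOp_comm (h.isSymbol_exp t) h.isSymbol_kap u

theorem IsAdmissible.continuous_opE_apply (h : IsAdmissible s kap om) (u : RealL2) :
    Continuous (fun t => opE om t u) := by
  rw [continuous_iff_continuousAt]
  intro t₀
  apply tendsto_of_norm_sub_sq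
  set q : ℝ → ℝ → ℝ := fun t η => ‖Complex.exp ((t * om η : ℝ) * Complex.I) * FT u η
    - Complex.exp ((t₀ * om η : ℝ) * Complex.I) * FT u η‖ ^ 2 with hq
  have e : ∀ t, ‖opE om t u - opE om t₀ u‖ ^ 2 = ∫ η, q t η := by
    intro t
    rw [norm_sub_sq_eq]
    apply integral_congr_ae
    filter_upwards [FT_mulOp (h.isSymbol_exp t) u, FT_mulOp (h.isSymbol_exp t₀) u] with η h1 h2
    rw [opE, opE, h1, h2]
  simp_rw [e]
  have hcont : Continuous (fun t => ∫ η, q t η) := by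
    apply continuous_of_dominated (bound := fun η => 4 * ‖FT u η‖ ^ 2)
    · intro t
      exact ((((h.isSymbol_exp t).measurable.aestronglyMeasurable.mul
        (Lp.aestronglyMeasurable _)).sub ((h.isSymbol_exp t₀).measurable.aestronglyMeasurable.mul
        (Lp.aestronglyMeasurable _))).norm.pow 2)
    · intro t
      refine Filter.Eventually.of_forall fun η => ?_
      rw [Real.norm_of_nonneg (by positivity)]
      have h1 : ‖Complex.exp ((t * om η : ℝ) * Complex.I) * FT u η
          - Complex.exp ((t₀ * om η : ℝ) * Complex.I) * FT u η‖ ≤ 2 * ‖FT u η‖ := by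
        refine (norm_sub_le _ _).trans ?_
        rw [norm_mul, norm_mul, norm_exp_phase, norm_exp_phase]
        linarith
      calc q t η ≤ (2 * ‖FT u η‖) ^ 2 := by
            simp only [hq]
            gcongr
        _ = _ := by ring
    · exact (integrable_FT_sq u).const_mul 4
    · refine Filter.Eventually.of_forall fun η => ?_
      simp only [hq]
      fun_prop
  have := hcont.tendsto t₀
  simpa [hq] using this

/-- Strong continuity upgrades to joint continuity because the group acts by isometries. -/
theorem IsAdmissible.continuous_opE (h : IsAdmissible s kap om) :
    Continuous (fun z : ℝ × RealL2 => opE om z.1 z.2) := by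
  rw [continuous_iff_continuousAt]
  rintro ⟨t₀, u₀⟩
  have h1 : Filter.Tendsto (fun z : ℝ × RealL2 => ‖z.2 - u₀‖ + ‖opE om z.1 u₀ - opE om t₀ u₀‖)
      (nhds (t₀, u₀)) (nhds 0) := by
    have : Continuous (fun z : ℝ × RealL2 => ‖z.2 - u₀‖ + ‖opE om z.1 u₀ - opE om t₀ u₀‖) :=
      (continuous_snd.sub continuous_const).norm.add
        ((((h.continuous_opE_apply u₀).comp continuous_fst).sub continuous_const).norm)
    simpa using this.tendsto (t₀, u₀)
  apply tendsto_iff_norm_sub_tendsto_zero.mpr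
  refine squeeze_zero (fun _ => norm_nonneg _) (fun z => ?_) h1
  have e : opE om z.1 z.2 - opE om t₀ u₀
      = opE om z.1 (z.2 - u₀) + (opE om z.1 u₀ - opE om t₀ u₀) := by
    rw [map_sub]; abel
  rw [e]
  refine (norm_add_le _ _).trans ?_
  rw [h.norm_opE]

/-- On a band the generator is bounded, so the group is differentiable in operator norm: the symbol
of the remainder is a second order Taylor remainder of exp, bounded by (C k)². -/
theorem IsAdmissible.hasDerivAt_band_exp (h : IsAdmissible s kap om) (n : ℕ) (t : ℝ) :
    HasDerivAt (fun τ => mulOp (band n fun η => Complex.exp ((τ * om η : ℝ) * Complex.I)))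
      (mulOp (band n fun η => Complex.I * om η * Complex.exp ((t * om η : ℝ) * Complex.I))) t := by
  obtain ⟨C₀, hC₀⟩ := h.isLocSymbol_om.bounded n
  set C := max C₀ 1 with hCdef
  have hC1 : 1 ≤ C := le_max_right _ _
  have hC : ∀ η : ℝ, |η| < n → |om η| ≤ C := fun η hη => by
    have := hC₀ η hη
    simp only [norm_mul, Complex.norm_I, one_mul, Complex.norm_real, Real.norm_eq_abs] at this
    exact this.trans (le_max_left _ _)
  rw [hasDerivAt_iff_isLittleO_nhds_zero]
  have hs : ∀ τ, IsSymbol (band n fun η => Complex.exp ((τ * om η : ℝ) * Complex.I)) := fun τ =>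
    (h.isSymbol_exp τ).isLocSymbol.band n
  have hd : IsSymbol (band n fun η =>
      Complex.I * om η * Complex.exp ((t * om η : ℝ) * Complex.I)) :=
    (h.isLocSymbol_om.mul (h.isSymbol_exp t).isLocSymbol).band n
  have hO : (fun k => mulOp (band n fun η => Complex.exp (((t + k) * om η : ℝ) * Complex.I))
      - mulOp (band n fun η => Complex.exp ((t * om η : ℝ) * Complex.I))
      - k • mulOp (band n fun η => Complex.I * om η * Complex.exp ((t * om η : ℝ) * Complex.I)))
      =O[nhds 0] (fun k : ℝ => k ^ 2) := by
    apply Asymptotics.IsBigO.of_bound (C ^ 2)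
    -- Keeps |k om| ≤ 1 on the band, the range in which the quadratic remainder estimate for exp is
    -- available.
    have hev : ∀ᶠ k : ℝ in nhds 0, |k| < C⁻¹ := by
      have := Metric.ball_mem_nhds (0 : ℝ) (inv_pos.mpr (zero_lt_one.trans_le hC1))
      filter_upwards [this] with k hk
      simpa using hk
    filter_upwards [hev] with k hk
    rw [← mulOp_real_smul hd, ← mulOp_sub (hs _) (hs _),
      ← mulOp_sub (by simpa [sub_eq_add_neg] using (hs (t + k)).add ((hs t).real_smul (-1)))
        (hd.real_smul k)]
    apply norm_mulOp_le
    · have := ((hs (t + k)).add ((hs t).real_smul (-1))).add ((hd.real_smul k).real_smul (-1))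
      simpa [sub_eq_add_neg] using this
    intro η
    unfold band
    split_ifs with hη
    · have hx : ‖((k * om η : ℝ) : ℂ) * Complex.I‖ ≤ 1 := by
        rw [norm_mul, Complex.norm_I, mul_one, Complex.norm_real, Real.norm_eq_abs, abs_mul]
        calc |k| * |om η| ≤ C⁻¹ * C := by
              gcongr
              exact hC η hη
          _ = 1 := inv_mul_cancel₀ (by linarith)
      have h2 := Complex.norm_exp_sub_one_sub_id_le hx
      have e : Complex.exp (((t + k) * om η : ℝ) * Complex.I)
          - Complex.exp ((t * om η : ℝ) * Complex.I)
          - (k : ℂ) * (Complex.I * om η * Complex.exp ((t * om η : ℝ) * Complex.I))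
          = Complex.exp ((t * om η : ℝ) * Complex.I) *
            (Complex.exp (((k * om η : ℝ) : ℂ) * Complex.I) - 1 -
              ((k * om η : ℝ) : ℂ) * Complex.I) := by
        have : Complex.exp (((t + k) * om η : ℝ) * Complex.I)
            = Complex.exp ((t * om η : ℝ) * Complex.I) *
              Complex.exp (((k * om η : ℝ) : ℂ) * Complex.I) := by
          rw [← Complex.exp_add]
          congr 1
          push_cast
          ring
        rw [this]
        push_cast
        ring
      rw [e, norm_mul, norm_exp_phase, one_mul]
      refine h2.trans ?_
      rw [norm_mul, Complex.norm_I, mul_one, Complex.norm_real, Real.norm_eq_abs, abs_mul, mul_pow,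
        Real.norm_of_nonneg (sq_nonneg k), sq_abs, mul_comm]
      gcongr
      exact hC η hη
    · simp only [sub_zero, mul_zero, norm_zero]
      positivity
  refine hO.trans_isLittleO ?_
  simpa using Asymptotics.isLittleO_pow_id (𝕜 := ℝ) (n := 2) one_lt_two

end Admissible

/-! ### Lipschitz nonlinearities in the energy space -/

theorem memLp_two_of_lintegral_ne_top {f : ℝ → ℂ} (hf : AEStronglyMeasurable f volume)
    (h : ∫⁻ x, ‖f x‖ₑ ^ 2 ≠ ⊤) : MemLp f 2 volume := by
  refine ⟨hf, ?_⟩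
  have h1 := eLpNorm_nnreal_pow_eq_lintegral (f := f) (μ := volume) (p := 2) two_ne_zero
  simp only [NNReal.coe_ofNat, ENNReal.rpow_ofNat, ENNReal.coe_ofNat] at h1
  rw [← h1] at h
  by_contra hc
  rw [not_lt, top_le_iff] at hc
  rw [hc] at h
  simp at h

theorem enorm_sq_eq_ofReal (z : ℂ) : ‖z‖ₑ ^ 2 = ENNReal.ofReal (‖z‖ ^ 2) := by
  rw [ENNReal.ofReal_pow (norm_nonneg _), ofReal_norm]

section Admissible

variable {s : ℝ} {kap om : ℝ → ℝ} {f : ℝ → ℝ} {Kf : NNReal}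

/-- One constant serves all orders τ in [0, s]; the orders 0 and σ of `growth` are the ones needed.
-/
theorem IsAdmissible.exists_rpow_mul_kap_sq_le (h : IsAdmissible s kap om) :
    ∃ D, 0 < D ∧ ∀ τ, 0 ≤ τ → τ ≤ s → ∀ η, |η| ^ (2 * τ) * kap η ^ 2 ≤ D := by
  obtain ⟨c, D, hc, hD, hb⟩ := h.smoothing.weight_bounds
  refine ⟨D, hD, fun τ h0 h1 η => le_trans ?_ (hb η).2⟩
  gcongr
  have h2 : |η| ^ 2 ≤ 1 + (2 * Real.pi * η) ^ 2 := by
    rw [sq_abs, mul_pow]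
    have : 1 ≤ (2 * Real.pi) ^ 2 := by nlinarith [Real.pi_gt_three]
    nlinarith [sq_nonneg η]
  calc |η| ^ (2 * τ) = (|η| ^ 2) ^ τ := by rw [Real.rpow_mul (abs_nonneg _), Real.rpow_two]
    _ ≤ (1 + (2 * Real.pi * η) ^ 2) ^ τ := by gcongr
    _ ≤ _ := Real.rpow_le_rpow_of_exponent_le (one_le_bracket _) h1

theorem IsAdmissible.lintegral_rpow_comp_le (h : IsAdmissible s kap om)
    (hf : LipschitzWith Kf f) (f0 : f 0 = 0) {D : ℝ} (hD0 : 0 < D) {τ : ℝ} (h0 : 0 ≤ τ) (h1 : τ ≤ 1)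
    (hD : ∀ η, |η| ^ (2 * τ) * kap η ^ 2 ≤ D) (U : RealL2) :
    ∫⁻ η, ENNReal.ofReal (|η| ^ (2 * τ)) * ‖FT (hf.compLp f0 (opK kap U)) η‖ₑ ^ 2
      ≤ ENNReal.ofReal (Kf ^ 2 * D * ‖U‖ ^ 2) := by
  refine (lintegral_rpow_FT_comp_le hf f0 _ h0 h1).trans ?_
  rw [mul_assoc, ENNReal.ofReal_mul (by positivity), ENNReal.ofReal_pow (by positivity),
    ENNReal.ofReal_coe_nnreal, ENNReal.ofReal_mul hD0.le, ← FT.norm_map U,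
    ← lintegral_enorm_sq_Lp, ← lintegral_const_mul' _ _ ENNReal.ofReal_ne_top]
  refine mul_le_mul' le_rfl (lintegral_mono_ae ?_)
  filter_upwards [FT_mulOp h.isSymbol_kap U] with η h2
  rw [opK, h2, enorm_mul, mul_pow, ← mul_assoc, enorm_sq_eq_ofReal, Complex.norm_real,
    Real.norm_eq_abs, sq_abs, ← ENNReal.ofReal_mul (by positivity)]
  gcongr
  exact hD η

/-- The candidate V has transform i kap om times that of f(KU), and |kap om| ≤ C(1 + |η|^σ). Since σ
≤ 1, Lipschitz composition is bounded in the orders 0 and σ, and since σ ≤ s both seminorms of KU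
are controlled by ‖U‖. This is a growth bound, not a Lipschitz bound, in the energy norm. -/
theorem IsAdmissible.exists_strong_bound (h : IsAdmissible s kap om)
    (hf : LipschitzWith Kf f) (f0 : f 0 = 0) : ∃ C, 0 ≤ C ∧ ∀ U, ∃ V,
      opK kap V = opM kap om (hf.compLp f0 (opK kap U)) ∧ ‖V‖ ≤ C * ‖U‖ := by
  obtain ⟨D, hD0, hD⟩ := h.exists_rpow_mul_kap_sq_le
  obtain ⟨σ, C, hσ0, hσ1, hσs, hC0, hC⟩ := h.growth
  -- A factor 2 C² comes from squaring C(1 + |η|^σ), another factor 2 from adding the two seminorms,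
  -- each at most Kf² D ‖U‖².
  refine ⟨Real.sqrt (4 * C ^ 2 * Kf ^ 2 * D), by positivity, fun U => ?_⟩
  set q := FT (hf.compLp f0 (opK kap U)) with hq
  have hmeas : Measurable (fun η => Complex.I * ((kap η * om η : ℝ) : ℂ)) :=
    measurable_const.mul
      (Complex.measurable_ofReal.comp (h.smoothing.measurable.mul h.om_measurable))
  have hae : AEStronglyMeasurable (fun η => Complex.I * ((kap η * om η : ℝ) : ℂ) * q η) volume :=
    hmeas.aestronglyMeasurable.mul (Lp.aestronglyMeasurable _)
  have hle : ∫⁻ η, ‖Complex.I * ((kap η * om η : ℝ) : ℂ) * q η‖ₑ ^ 2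
      ≤ ENNReal.ofReal ((Real.sqrt (4 * C ^ 2 * Kf ^ 2 * D) * ‖U‖) ^ 2) := by
    calc _ ≤ ∫⁻ η, ENNReal.ofReal (2 * C ^ 2) * (ENNReal.ofReal (|η| ^ (2 * (0 : ℝ))) * ‖q η‖ₑ ^ 2
            + ENNReal.ofReal (|η| ^ (2 * σ)) * ‖q η‖ₑ ^ 2) := by
          apply lintegral_mono
          intro η
          simp only
          rw [enorm_mul, mul_pow, ← add_mul, ← mul_assoc, ← ENNReal.ofReal_add (by positivity)
            (by positivity), ← ENNReal.ofReal_mul (by positivity), enorm_sq_eq_ofReal]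
          gcongr
          rw [norm_mul, Complex.norm_I, one_mul, Complex.norm_real, Real.norm_eq_abs, mul_zero,
            Real.rpow_zero]
          calc |kap η * om η| ^ 2 ≤ (C * (1 + |η| ^ σ)) ^ 2 := by
                gcongr
                exact hC η
            _ ≤ 2 * C ^ 2 * (1 + (|η| ^ σ) ^ 2) := by
                nlinarith [mul_nonneg (sq_nonneg C) (sq_nonneg (1 - |η| ^ σ))]
            _ = _ := by
                rw [← Real.rpow_natCast (|η| ^ σ), ← Real.rpow_mul (abs_nonneg _), mul_comm σ]
                norm_num
      _ = ENNReal.ofReal (2 * C ^ 2) * ((∫⁻ η, ENNReal.ofReal (|η| ^ (2 * (0 : ℝ))) * ‖q η‖ₑ ^ 2)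
            + ∫⁻ η, ENNReal.ofReal (|η| ^ (2 * σ)) * ‖q η‖ₑ ^ 2) := by
          rw [lintegral_const_mul' _ _ ENNReal.ofReal_ne_top, lintegral_add_left']
          exact (Measurable.aemeasurable (by fun_prop)).mul (aemeasurable_FT_sq _)
      _ ≤ ENNReal.ofReal (2 * C ^ 2) * (ENNReal.ofReal (Kf ^ 2 * D * ‖U‖ ^ 2)
            + ENNReal.ofReal (Kf ^ 2 * D * ‖U‖ ^ 2)) := by
          refine mul_le_mul' le_rfl (add_le_add ?_ ?_)
          · exact h.lintegral_rpow_comp_le hf f0 hD0 le_rfl zero_le_one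
              (hD 0 le_rfl h.s_nonneg) U
          · exact h.lintegral_rpow_comp_le hf f0 hD0 hσ0 hσ1 (hD σ hσ0 hσs) U
      _ = _ := by
          rw [← ENNReal.ofReal_add (by positivity) (by positivity),
            ← ENNReal.ofReal_mul (by positivity), mul_pow, Real.sq_sqrt (by positivity)]
          congr 1
          ring
  have hL := memLp_two_of_lintegral_ne_top hae (ne_top_of_le_ne_top ENNReal.ofReal_ne_top hle)
  obtain ⟨V, hV⟩ := exists_FT_eq (hL.toLp _) (by
    have h1 := hL.coeFn_toLp
    have h2 := measurePreserving_neg_real.quasiMeasurePreserving.ae h1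
    filter_upwards [h1, h2, FT_neg (hf.compLp f0 (opK kap U))] with x h1 h2 h3
    rw [h1, h2, hq, h3, h.om_odd, h.smoothing.even, map_mul, map_mul, Complex.conj_I,
      Complex.conj_ofReal]
    push_cast
    ring)
  refine ⟨V, FT_ext ?_, ?_⟩
  · filter_upwards [FT_mulOp h.isSymbol_kap V, hL.coeFn_toLp,
      FT_mulOp h.isSymbol_kap_sq_om (hf.compLp f0 (opK kap U))] with η h1 h2 h3
    rw [show FT (opK kap V) η = _ from h1, hV, h2,
      show FT (opM kap om (hf.compLp f0 (opK kap U))) η = _ from h3]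
    push_cast
    ring
  · have h1 : ENNReal.ofReal (‖V‖ ^ 2)
        ≤ ENNReal.ofReal ((Real.sqrt (4 * C ^ 2 * Kf ^ 2 * D) * ‖U‖) ^ 2) := by
      rw [← FT.norm_map V, ← lintegral_enorm_sq_Lp, hV]
      refine le_trans (le_of_eq (lintegral_congr_ae ?_)) hle
      filter_upwards [hL.coeFn_toLp] with η h2
      rw [h2]
    rw [ENNReal.ofReal_le_ofReal_iff (by positivity)] at h1
    exact le_of_sq_le_sq h1 (by positivity)

/-- Global solvability, in the energy space, of the problem with a globally Lipschitz
nonlinearity; the equations are expressed on frequency bands. -/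
theorem IsAdmissible.exists_lipschitz_solution (h : IsAdmissible s kap om)
    (hf : LipschitzWith Kf f) (f0 : f 0 = 0) (U₀ W₀ : RealL2) :
    ∃ U W : ℝ → RealL2, Continuous U ∧ Continuous W ∧ U 0 = U₀ ∧ W 0 = W₀ ∧
      ∀ (n : ℕ) (t : ℝ),
        HasDerivAt (fun τ => proj n (opK kap (U τ))) (opOm om n (opK kap (W t))) t ∧
        HasDerivAt (fun τ => proj n (opK kap (W τ))) (opOm om n (opK kap (U t))
          + proj n (opM kap om (hf.compLp f0 (opK kap (U t))))) t := by
  obtain ⟨Cs, hCs0, hCs⟩ := h.exists_strong_bound hf f0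
  set K := opK kap with hK
  set E := opE om with hE
  set F : RealL2 → RealL2 := fun u => opM kap om (hf.compLp f0 u) with hF
  have hFlip : ∀ u v, ‖F u - F v‖ ≤ (‖opM kap om‖ * Kf) * ‖u - v‖ := by
    intro u v
    simp only [hF]
    rw [← map_sub, mul_assoc]
    exact (ContinuousLinearMap.le_opNorm _ _).trans
      (mul_le_mul_of_nonneg_left (hf.norm_compLp_sub_le f0 u v) (norm_nonneg _))
  have hFcont : Continuous F :=
    (opM kap om).continuous.comp (hf.continuous_compLp f0)
  have hF0 : F 0 = 0 := by
    obtain ⟨V, hV, hVn⟩ := hCs 0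
    rw [norm_zero, mul_zero, norm_le_zero_iff] at hVn
    simp only [hF]
    rw [map_zero] at hV
    rw [← hV, hVn, map_zero]
  -- The characteristic variables are z₁ = E(-t)(u + y) and z₂ = E(t)(u - y); this recovers u from
  -- them.
  set uu : ℝ → RealL2 × RealL2 → RealL2 := fun t z => (1 / 2 : ℝ) • (E t z.1 + E (-t) z.2) with huu
  -- In characteristic variables the unbounded generator has disappeared; only the nonlinearity,
  -- bounded on L², remains.
  set G : ℝ → RealL2 × RealL2 → RealL2 × RealL2 := fun t z =>
    (E (-t) (F (uu t z)), -E t (F (uu t z))) with hGdef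
  set L := max (max (‖opM kap om‖ * Kf) Cs) 1 with hL
  have hL1 : (‖opM kap om‖ * Kf) ≤ L := (le_max_left _ _).trans (le_max_left _ _)
  have hL2 : Cs ≤ L := (le_max_right _ _).trans (le_max_left _ _)
  have hLpos : 0 < L := zero_lt_one.trans_le (le_max_right _ _)
  have hEc : Continuous (fun z : ℝ × RealL2 => E z.1 z.2) := h.continuous_opE
  have huuc : Continuous (Function.uncurry uu) := by
    refine Continuous.const_smul (Continuous.add ?_ ?_) (1 / 2 : ℝ)
    · exact hEc.comp (continuous_fst.prodMk (continuous_fst.comp continuous_snd))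
    · exact hEc.comp (continuous_fst.neg.prodMk (continuous_snd.comp continuous_snd))
  have hGc : Continuous (Function.uncurry G) := by
    refine Continuous.prodMk ?_ (Continuous.neg ?_)
    · exact hEc.comp (continuous_fst.neg.prodMk (hFcont.comp huuc))
    · exact hEc.comp (continuous_fst.prodMk (hFcont.comp huuc))
  have huulip : ∀ t z z', ‖uu t z - uu t z'‖ ≤ ‖z - z'‖ := by
    intro t z z'
    have e : uu t z - uu t z' = (1 / 2 : ℝ) • (E t (z - z').1 + E (-t) (z - z').2) := by
      simp only [huu, Prod.fst_sub, Prod.snd_sub, map_sub]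
      module
    rw [e, norm_smul]
    have h1 : ‖E t (z - z').1‖ ≤ ‖z - z'‖ := by
      rw [hE, h.norm_opE]; exact norm_fst_le _
    have h2 : ‖E (-t) (z - z').2‖ ≤ ‖z - z'‖ := by
      rw [hE, h.norm_opE]; exact norm_snd_le _
    have h3 := norm_add_le (E t (z - z').1) (E (-t) (z - z').2)
    rw [Real.norm_of_nonneg (by norm_num)]
    linarith
  have hGlip : ∀ t z z', ‖G t z - G t z'‖ ≤ L * ‖z - z'‖ := by
    intro t z z'
    have hb : ‖F (uu t z) - F (uu t z')‖ ≤ L * ‖z - z'‖ :=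
      (hFlip _ _).trans (mul_le_mul hL1 (huulip t z z') (norm_nonneg _) hLpos.le)
    rw [Prod.norm_def]
    apply max_le
    · simp only [hGdef, Prod.fst_sub]
      rw [← map_sub, hE, h.norm_opE]
      exact hb
    · simp only [hGdef, Prod.snd_sub]
      rw [neg_sub_neg, ← map_sub, hE, h.norm_opE, norm_sub_rev]
      exact hb
  have hG0 : ∀ t, G t 0 = 0 := by
    intro t
    simp [hGdef, huu, hF0]
  -- Functionals ⟪φ, ·⟫ on each component, weighted by ‖Kφ‖: the bounds with constant M say exactly
  -- that both components lie in the image under K of the M-ball.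
  let ℓ : RealL2 × Bool → (RealL2 × RealL2) →L[ℝ] ℝ := fun i =>
    if i.2 then (innerSL ℝ i.1).comp (ContinuousLinearMap.fst ℝ RealL2 RealL2)
    else (innerSL ℝ i.1).comp (ContinuousLinearMap.snd ℝ RealL2 RealL2)
  let c : RealL2 × Bool → ℝ := fun i => ‖K i.1‖
  have hstrong : ∀ {M : ℝ} {z : RealL2 × RealL2}, 0 ≤ M → (∀ i, |ℓ i z| ≤ M * c i) →
      (∃ Z, K Z = z.1 ∧ ‖Z‖ ≤ M) ∧ ∃ Z, K Z = z.2 ∧ ‖Z‖ ≤ M := by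
    intro M z hM hz
    constructor
    · apply exists_preimage_of_inner_le h.inner_opK h.opK_injective hM
      intro φ
      rw [real_inner_comm]
      simpa [ℓ, c] using hz (φ, true)
    · apply exists_preimage_of_inner_le h.inner_opK h.opK_injective hM
      intro φ
      rw [real_inner_comm]
      simpa [ℓ, c] using hz (φ, false)
  have hweak : ∀ {M : ℝ} {Z₁ Z₂ : RealL2}, ‖Z₁‖ ≤ M → ‖Z₂‖ ≤ M →
      ∀ i, |ℓ i (K Z₁, K Z₂)| ≤ M * c i := by
    have hone : ∀ {M : ℝ} {Z φ : RealL2}, ‖Z‖ ≤ M → |inner ℝ φ (K Z)| ≤ M * ‖K φ‖ := by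
      intro M Z φ hZ
      rw [hK, ← h.inner_opK, mul_comm]
      exact (abs_real_inner_le_norm _ _).trans
        (mul_le_mul_of_nonneg_left hZ (norm_nonneg _))
    rintro M Z₁ Z₂ h1 h2 ⟨φ, _ | _⟩
    · simpa [ℓ, c] using hone h2
    · simpa [ℓ, c] using hone h1
  -- The strong bound in weak form. The group commutes with K and is isometric, so it does not
  -- affect the size of preimages.
  have hstab : ∀ M, 0 ≤ M → ∀ t z, (∀ i, |ℓ i z| ≤ M * c i) →
      ∀ i, |ℓ i (G t z)| ≤ L * M * c i := by
    intro M hM t z hz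
    obtain ⟨⟨Z₁, hZ₁, hn₁⟩, Z₂, hZ₂, hn₂⟩ := hstrong hM hz
    have hu : uu t z = K ((1 / 2 : ℝ) • (E t Z₁ + E (-t) Z₂)) := by
      simp only [huu]
      rw [map_smul, map_add, ← hZ₁, ← hZ₂, hE, hK, h.opE_opK, h.opE_opK]
    obtain ⟨V, hV, hVn⟩ := hCs ((1 / 2 : ℝ) • (E t Z₁ + E (-t) Z₂))
    have hUn : ‖(1 / 2 : ℝ) • (E t Z₁ + E (-t) Z₂)‖ ≤ M := by
      rw [norm_smul]
      have h3 := norm_add_le (E t Z₁) (E (-t) Z₂)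
      rw [hE, h.norm_opE, h.norm_opE] at h3
      rw [Real.norm_of_nonneg (by norm_num)]
      linarith
    have hVM : ‖V‖ ≤ L * M := hVn.trans (mul_le_mul hL2 hUn (norm_nonneg _) hLpos.le)
    have eG : G t z = (K (E (-t) V), K (-E t V)) := by
      simp only [hGdef, hF]
      rw [hu, ← hV, map_neg, hE, h.opE_opK, h.opE_opK]
    rw [eG]
    apply hweak
    · rwa [hE, h.norm_opE]
    · rwa [norm_neg, hE, h.norm_opE]
  set M₀ := max ‖U₀ + W₀‖ ‖U₀ - W₀‖ with hM₀
  have hM₀0 : 0 ≤ M₀ := (norm_nonneg _).trans (le_max_left _ _)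
  obtain ⟨z, hz0, hzd, hzb⟩ := exists_global_ode_solution G hGc hLpos hGlip hG0
    (K (U₀ + W₀), K (U₀ - W₀)) ℓ c hstab hM₀0 (hweak (le_max_left _ _) (le_max_right _ _))
  set B : ℝ → ℝ := fun t => 2 * M₀ * Real.exp (2 * L * |t|) with hB
  have hB0 : ∀ t, 0 ≤ B t := fun t => by positivity
  have hZex := fun t => hstrong (hB0 t) (hzb t)
  choose hZ1 hZ2 using hZex
  choose Z₁ hZ₁ hZ₁n using hZ1
  choose Z₂ hZ₂ hZ₂n using hZ2
  have hinj : Function.Injective K := h.opK_injective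
  -- The ODE gives continuity of z only in L². Applying the mean value inequality to every ℓ i
  -- separately gives a Lipschitz bound in the weak form, hence local Lipschitz continuity of the
  -- preimages; the window |t - t₀| ≤ 1 fixes the exponential bound.
  have hZcont : Continuous Z₁ ∧ Continuous Z₂ := by
    have hloc : ∀ t₀ t : ℝ, |t - t₀| ≤ 1 →
        ‖Z₁ t - Z₁ t₀‖ ≤ L * B (|t₀| + 1) * |t - t₀| ∧
        ‖Z₂ t - Z₂ t₀‖ ≤ L * B (|t₀| + 1) * |t - t₀| := by
      intro t₀ t ht
      have hgauge : ∀ i, |ℓ i (z t - z t₀)| ≤ L * B (|t₀| + 1) * |t - t₀| * c i := by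
        intro i
        have hd : ∀ τ ∈ Set.uIcc t₀ t, HasDerivWithinAt (fun τ => ℓ i (z τ)) (ℓ i (G τ (z τ)))
            (Set.uIcc t₀ t) τ := fun τ _ =>
          ((ℓ i).hasFDerivAt.comp_hasDerivAt τ (hzd τ)).hasDerivWithinAt
        have hbd : ∀ τ ∈ Set.uIcc t₀ t, ‖ℓ i (G τ (z τ))‖ ≤ L * B (|t₀| + 1) * c i := by
          intro τ hτ
          rw [Real.norm_eq_abs]
          refine hstab (B (|t₀| + 1)) (hB0 _) τ (z τ) (fun j => (hzb τ j).trans ?_) i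
          have hτ1 : |τ| ≤ |t₀| + 1 := by
            have h1 : |τ - t₀| ≤ |t - t₀| := Set.abs_sub_left_of_mem_uIcc hτ
            have h2 := abs_sub_abs_le_abs_sub τ t₀
            linarith
          refine mul_le_mul_of_nonneg_right ?_ (norm_nonneg _)
          simp only [hB]
          rw [abs_of_nonneg (by positivity : 0 ≤ |t₀| + 1)]
          gcongr
        have := (convex_uIcc t₀ t).norm_image_sub_le_of_norm_hasDerivWithin_le hd hbd
          Set.left_mem_uIcc Set.right_mem_uIcc
        rw [Real.norm_eq_abs, Real.norm_eq_abs, ← map_sub] at this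
        linarith
      have hnn : 0 ≤ L * B (|t₀| + 1) * |t - t₀| :=
        mul_nonneg (mul_nonneg hLpos.le (hB0 _)) (abs_nonneg _)
      obtain ⟨⟨V₁, hV₁, hn₁⟩, V₂, hV₂, hn₂⟩ := hstrong hnn hgauge
      constructor
      · have : V₁ = Z₁ t - Z₁ t₀ := by
          apply hinj
          rw [hV₁, map_sub, hZ₁, hZ₁]
          rfl
        rwa [← this]
      · have : V₂ = Z₂ t - Z₂ t₀ := by
          apply hinj
          rw [hV₂, map_sub, hZ₂, hZ₂]
          rfl
        rwa [← this]
    have hgen : ∀ Z : ℝ → RealL2, (∀ t₀ t : ℝ, |t - t₀| ≤ 1 →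
        ‖Z t - Z t₀‖ ≤ L * B (|t₀| + 1) * |t - t₀|) → Continuous Z := by
      intro Z hZ
      rw [continuous_iff_continuousAt]
      intro t₀
      apply tendsto_iff_norm_sub_tendsto_zero.mpr
      have h1 : Filter.Tendsto (fun t => L * B (|t₀| + 1) * |t - t₀|) (nhds t₀) (nhds 0) := by
        have : Continuous (fun t => L * B (|t₀| + 1) * |t - t₀|) := by fun_prop
        simpa using this.tendsto t₀
      refine squeeze_zero' (Filter.Eventually.of_forall fun _ => norm_nonneg _) ?_ h1
      filter_upwards [Metric.closedBall_mem_nhds t₀ zero_lt_one] with t ht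
      exact hZ t₀ t (by simpa [Real.dist_eq] using ht)
    exact ⟨hgen Z₁ fun t₀ t ht => (hloc t₀ t ht).1, hgen Z₂ fun t₀ t ht => (hloc t₀ t ht).2⟩
  have hE1 : Continuous (fun t => E t (Z₁ t)) := hEc.comp (continuous_id.prodMk hZcont.1)
  have hE2 : Continuous (fun t => E (-t) (Z₂ t)) := hEc.comp (continuous_neg.prodMk hZcont.2)
  have hZ10 : Z₁ 0 = U₀ + W₀ := hinj (by rw [hZ₁, hz0])
  have hZ20 : Z₂ 0 = U₀ - W₀ := hinj (by rw [hZ₂, hz0])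
  have hKU : ∀ t, K ((1 / 2 : ℝ) • (E t (Z₁ t) + E (-t) (Z₂ t)))
      = (1 / 2 : ℝ) • (E t (z t).1 + E (-t) (z t).2) := by
    intro t
    rw [map_smul, map_add, hE, hK, ← h.opE_opK, ← h.opE_opK, ← hK, hZ₁, hZ₂]
  have hKW : ∀ t, K ((1 / 2 : ℝ) • (E t (Z₁ t) - E (-t) (Z₂ t)))
      = (1 / 2 : ℝ) • (E t (z t).1 - E (-t) (z t).2) := by
    intro t
    rw [map_smul, map_sub, hE, hK, ← h.opE_opK, ← h.opE_opK, ← hK, hZ₁, hZ₂]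
  refine ⟨fun t => (1 / 2 : ℝ) • (E t (Z₁ t) + E (-t) (Z₂ t)),
    fun t => (1 / 2 : ℝ) • (E t (Z₁ t) - E (-t) (Z₂ t)),
    (hE1.add hE2).const_smul (1 / 2 : ℝ), (hE1.sub hE2).const_smul (1 / 2 : ℝ), ?_, ?_, ?_⟩
  · simp only [neg_zero, hE]
    rw [opE_zero, opE_zero, hZ10, hZ20]
    module
  · simp only [neg_zero, hE]
    rw [opE_zero, opE_zero, hZ10, hZ20]
    module
  intro n t
  -- Undoing the conjugation differentiates the group, which is legitimate after projection to a
  -- band.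
  set En : ℝ → RealL2 →L[ℝ] RealL2 := fun τ =>
    mulOp (band n fun η => Complex.exp ((τ * om η : ℝ) * Complex.I)) with hEn
  set En' : ℝ → RealL2 →L[ℝ] RealL2 := fun τ =>
    mulOp (band n fun η => Complex.I * om η * Complex.exp ((τ * om η : ℝ) * Complex.I)) with hEn'
  have hsE : ∀ τ, IsSymbol (band n fun η => Complex.exp ((τ * om η : ℝ) * Complex.I)) := fun τ =>
    (h.isSymbol_exp τ).isLocSymbol.band n
  have hpE : ∀ τ v, proj n (E τ v) = En τ v := fun τ v =>
    mulOp_mulOp (isSymbol_band_one n) (h.isSymbol_exp τ) (fun η => by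
      unfold band; split_ifs <;> simp) v
  have hOE : ∀ τ v, opOm om n (E τ v) = En' τ v := fun τ v =>
    mulOp_mulOp (h.isLocSymbol_om.band n) (h.isSymbol_exp τ) (fun η => by
      unfold band; split_ifs <;> simp) v
  have hd1 : ∀ τ, HasDerivAt En (En' τ) τ := fun τ => h.hasDerivAt_band_exp n τ
  have hd2 : HasDerivAt (fun τ => En (-τ)) (-En' (-t)) t := by
    have := (hd1 (-t)).scomp t (hasDerivAt_neg t)
    simpa using! this
  have hz1 : HasDerivAt (fun τ => (z τ).1) (E (-t) (F (uu t (z t)))) t :=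
    (ContinuousLinearMap.fst ℝ RealL2 RealL2).hasFDerivAt.comp_hasDerivAt t (hzd t)
  have hz2 : HasDerivAt (fun τ => (z τ).2) (-E t (F (uu t (z t)))) t :=
    (ContinuousLinearMap.snd ℝ RealL2 RealL2).hasFDerivAt.comp_hasDerivAt t (hzd t)
  have hda := (hd1 t).clm_apply hz1
  have hdb := hd2.clm_apply hz2
  have hEF1 : En t (E (-t) (F (uu t (z t)))) = proj n (F (uu t (z t))) := by
    rw [← hpE, hE, h.opE_opE_neg]
  have hEF2 : En (-t) (E t (F (uu t (z t)))) = proj n (F (uu t (z t))) := by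
    rw [← hpE, hE, h.opE_neg_opE]
  rw [hEF1] at hda
  rw [map_neg, hEF2] at hdb
  simp only [neg_apply] at hdb
  have huz : uu t (z t) = (1 / 2 : ℝ) • (E t (z t).1 + E (-t) (z t).2) := rfl
  simp only [hKU, hKW, map_smul, map_add, map_sub, hpE, hOE]
  rw [← huz]
  constructor
  · have := (hda.add hdb).const_smul (1 / 2 : ℝ)
    convert! this using 1
    module
  · have := (hda.sub hdb).const_smul (1 / 2 : ℝ)
    convert! this using 1
    simp only [hF]
    module

end Admissible

/-! ### Potential energy of a Lipschitz nonlinearity -/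

/-- The primitive of `f` vanishing at `0`. -/
def prim (f : ℝ → ℝ) (v : ℝ) : ℝ := ∫ x in (0 : ℝ)..v, f x

/-- The potential energy `∫ F(u) dx`, `F' = f`. -/
def potential (f : ℝ → ℝ) (u : RealL2) : ℝ := ∫ x, prim f (u x)

section Potential

variable {f : ℝ → ℝ} {Kf : NNReal}

theorem prim_taylor (hf : LipschitzWith Kf f) (a h : ℝ) :
    |prim f (a + h) - prim f a - f a * h| ≤ Kf * h ^ 2 := by
  have hi : ∀ x y, IntervalIntegrable f volume x y := fun x y =>
    hf.continuous.intervalIntegrable x y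
  have e : prim f (a + h) - prim f a - f a * h = ∫ x in a..(a + h), (f x - f a) := by
    rw [intervalIntegral.integral_sub (hi _ _) (by simp), intervalIntegral.integral_const, prim,
      prim, intervalIntegral.integral_interval_sub_left (hi _ _) (hi _ _), smul_eq_mul]
    ring
  have h1 := intervalIntegral.norm_integral_le_of_norm_le_const (a := a) (b := a + h)
    (f := fun x => f x - f a) (C := Kf * |h|) (fun x hx => by
      have h2 := hf.dist_le_mul x a
      rw [Real.dist_eq, Real.dist_eq] at h2
      refine h2.trans ?_
      refine mul_le_mul_of_nonneg_left ?_ Kf.coe_nonneg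
      have h3 := Set.abs_sub_left_of_mem_uIcc (Set.uIoc_subset_uIcc hx)
      rwa [add_sub_cancel_left] at h3)
  rw [e, ← Real.norm_eq_abs]
  refine h1.trans (le_of_eq ?_)
  rw [add_sub_cancel_left, mul_assoc, ← sq, sq_abs]

theorem continuous_prim (hf : LipschitzWith Kf f) : Continuous (prim f) :=
  intervalIntegral.continuous_primitive (fun x y => hf.continuous.intervalIntegrable x y) 0

theorem integrable_sq_RealL2 (u : RealL2) : Integrable (fun x => u x ^ 2) :=
  (memLp_two_iff_integrable_sq (Lp.aestronglyMeasurable u)).mp (Lp.memLp u)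

theorem integrable_mul_RealL2 (u v : RealL2) : Integrable (fun x => u x * v x) :=
  (Lp.memLp u).integrable_mul (Lp.memLp v)

theorem inner_eq_integral_mul (u v : RealL2) : inner ℝ u v = ∫ x, u x * v x := by
  rw [L2.inner_def]
  congr 1
  ext x
  simp [mul_comm]

theorem norm_sq_eq_integral (u : RealL2) : ‖u‖ ^ 2 = ∫ x, u x ^ 2 := by
  rw [← real_inner_self_eq_norm_sq, inner_eq_integral_mul]
  simp_rw [sq]

theorem integrable_prim (hf : LipschitzWith Kf f) (f0 : f 0 = 0) (u : RealL2) :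
    Integrable (fun x => prim f (u x)) := by
  refine ((integrable_sq_RealL2 u).const_mul Kf).mono'
    ((continuous_prim hf).comp_aestronglyMeasurable (Lp.aestronglyMeasurable u))
    (Filter.Eventually.of_forall fun x => ?_)
  have := prim_taylor hf 0 (u x)
  simpa [f0, prim] using this

/-- The Lipschitz bound on f makes the pointwise Taylor remainder quadratic in the increment, and a
quadratic remainder integrates to O(‖k‖²). -/
theorem hasFDerivAt_potential (hf : LipschitzWith Kf f) (f0 : f 0 = 0) (u : RealL2) :
    HasFDerivAt (potential f) (innerSL ℝ (hf.compLp f0 u)) u := by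
  rw [hasFDerivAt_iff_isLittleO_nhds_zero]
  have hO : (fun k => potential f (u + k) - potential f u - innerSL ℝ (hf.compLp f0 u) k)
      =O[nhds 0] (fun k : RealL2 => ‖k‖ ^ 2) := by
    apply Asymptotics.IsBigO.of_bound Kf
    refine Filter.Eventually.of_forall fun k => ?_
    have e : potential f (u + k) - potential f u - innerSL ℝ (hf.compLp f0 u) k
        = ∫ x, (prim f ((u + k : RealL2) x) - prim f (u x) - hf.compLp f0 u x * k x) := by
      have i1 := integrable_prim hf f0 (u + k)
      have i2 := integrable_prim hf f0 u
      have i3 := integral_sub (f := fun x => prim f ((u + k : RealL2) x) - prim f (u x))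
        (i1.sub i2) (integrable_mul_RealL2 (hf.compLp f0 u) k)
      rw [i3, integral_sub i1 i2, innerSL_apply_apply, inner_eq_integral_mul]
      rfl
    rw [e, Real.norm_of_nonneg (by positivity : 0 ≤ ‖k‖ ^ 2), norm_sq_eq_integral,
      ← integral_const_mul]
    apply norm_integral_le_of_norm_le ((integrable_sq_RealL2 k).const_mul _)
    filter_upwards [Lp.coeFn_add u k, hf.coeFn_compLp f0 u] with x h1 h2
    rw [h1, h2, Pi.add_apply]
    exact prim_taylor hf (u x) (k x)
  refine hO.trans_isLittleO ?_
  exact Asymptotics.isLittleO_norm_pow_id one_lt_two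

theorem continuous_potential (hf : LipschitzWith Kf f) (f0 : f 0 = 0) :
    Continuous (potential f) :=
  continuous_iff_continuousAt.mpr fun u => (hasFDerivAt_potential hf f0 u).continuousAt

end Potential

/-! ### Conservation of energy -/

section Admissible

variable {s : ℝ} {kap om : ℝ → ℝ} {f : ℝ → ℝ} {Kf : NNReal}

theorem inner_proj (n : ℕ) (u v : RealL2) : inner ℝ (proj n u) v = inner ℝ u (proj n v) := by
  rw [proj, inner_mulOp (isSymbol_band_one n)]
  congr 3
  ext η
  unfold band
  split_ifs <;> simp

theorem IsAdmissible.inner_opOm (h : IsAdmissible s kap om) (n : ℕ) (u v : RealL2) :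
    inner ℝ (opOm om n u) v = -inner ℝ u (opOm om n v) := by
  have hs := h.isLocSymbol_om.band n
  rw [opOm, inner_mulOp hs, ← inner_neg_right, ← neg_one_smul ℝ, ← smul_apply,
    ← mulOp_real_smul hs]
  congr 3
  ext η
  unfold band
  split_ifs <;> simp

theorem IsAdmissible.proj_opOm (h : IsAdmissible s kap om) {m n : ℕ} (hmn : n ≤ m) (u : RealL2) :
    proj m (opOm om n u) = opOm om n u :=
  mulOp_mulOp (isSymbol_band_one m) (h.isLocSymbol_om.band n) (fun η => by
    have : (n : ℝ) ≤ m := by exact_mod_cast hmn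
    unfold band
    split_ifs <;> simp
    linarith) u

/-- The inverse of `opK` on a frequency band. -/
def opKinv (kap : ℝ → ℝ) (n : ℕ) : RealL2 →L[ℝ] RealL2 :=
  mulOp (band n fun η => ((kap η)⁻¹ : ℂ))

/-- The operator `∂ₓ B^(1/2)` on a frequency band. -/
def opJ (kap om : ℝ → ℝ) (n : ℕ) : RealL2 →L[ℝ] RealL2 :=
  mulOp (band n fun η => (kap η : ℂ) * (Complex.I * om η))

theorem IsAdmissible.isSymbol_J (h : IsAdmissible s kap om) (n : ℕ) :
    IsSymbol (band n fun η => (kap η : ℂ) * (Complex.I * om η)) :=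
  (h.isSymbol_kap.isLocSymbol.mul h.isLocSymbol_om).band n

theorem IsAdmissible.kap_ne (h : IsAdmissible s kap om) (η : ℝ) : (kap η : ℂ) ≠ 0 := by
  exact_mod_cast (h.kap_pos η).ne'

theorem IsAdmissible.opKinv_proj_opK (h : IsAdmissible s kap om) (n : ℕ) (u : RealL2) :
    opKinv kap n (proj n (opK kap u)) = proj n u := by
  rw [proj, opK, mulOp_mulOp (isSymbol_band_one n) h.isSymbol_kap (q := band n fun η => kap η)
    (fun η => by unfold band; split_ifs <;> simp), opKinv,
    mulOp_mulOp (h.isLocSymbol_kap_inv.band n) (h.isSymbol_kap.isLocSymbol.band n)]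
  intro η
  have := h.kap_ne η
  unfold band
  split_ifs <;> simp [this]

theorem IsAdmissible.opKinv_opOm_opK (h : IsAdmissible s kap om) (n : ℕ) (u : RealL2) :
    opKinv kap n (opOm om n (opK kap u)) = opOm om n u := by
  rw [opOm, opK, mulOp_mulOp (h.isLocSymbol_om.band n) h.isSymbol_kap
    (q := band n fun η => (Complex.I * om η) * kap η)
    (fun η => by unfold band; split_ifs <;> simp), opKinv,
    mulOp_mulOp (h.isLocSymbol_kap_inv.band n)
      ((h.isLocSymbol_om.mul h.isSymbol_kap.isLocSymbol).band n)]
  intro η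
  have := h.kap_ne η
  unfold band
  split_ifs
  · field_simp
  · simp

theorem IsAdmissible.opKinv_opM (h : IsAdmissible s kap om) (n : ℕ) (u : RealL2) :
    opKinv kap n (proj n (opM kap om u)) = opJ kap om n u := by
  rw [proj, opM, mulOp_mulOp (isSymbol_band_one n) h.isSymbol_kap_sq_om
    (q := band n fun η => Complex.I * ((kap η ^ 2 * om η : ℝ) : ℂ))
    (fun η => by unfold band; split_ifs <;> simp), opKinv, opJ,
    mulOp_mulOp (h.isLocSymbol_kap_inv.band n) (h.isSymbol_kap_sq_om.isLocSymbol.band n)]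
  intro η
  have := h.kap_ne η
  unfold band
  split_ifs
  · push_cast
    field_simp
  · simp

theorem IsAdmissible.opK_opOm (h : IsAdmissible s kap om) (n : ℕ) (u : RealL2) :
    opK kap (opOm om n u) = opJ kap om n u :=
  mulOp_mulOp h.isSymbol_kap (h.isLocSymbol_om.band n) (fun η => by
    unfold band; split_ifs <;> simp) u

theorem IsAdmissible.proj_opJ (h : IsAdmissible s kap om) {m n : ℕ} (hmn : m ≤ n) (u : RealL2) :
    proj m (opJ kap om n u) = opJ kap om m u :=
  mulOp_mulOp (isSymbol_band_one m) (h.isSymbol_J n) (fun η => by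
    have : (m : ℝ) ≤ n := by exact_mod_cast hmn
    unfold band
    split_ifs <;> simp
    exfalso
    linarith) u

theorem IsAdmissible.proj_opK (h : IsAdmissible s kap om) (n : ℕ) (u : RealL2) :
    proj n (opK kap u) = opK kap (proj n u) :=
  mulOp_comm (isSymbol_band_one n) h.isSymbol_kap u

/-- Moves Ω and K off w: the work of the force along u_t is minus the pairing of W with ∂ₓ B^(1/2)
of the force, the term that must cancel in the energy balance. -/
theorem IsAdmissible.inner_opOm_opK (h : IsAdmissible s kap om) (n : ℕ) (w v : RealL2) :
    inner ℝ v (opOm om n (opK kap w)) = -inner ℝ w (opJ kap om n v) := by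
  rw [real_inner_comm, h.inner_opOm, h.inner_opK, h.opK_opOm]

/-- Conservation of energy. -/
theorem IsAdmissible.energy_conserved (h : IsAdmissible s kap om)
    (hf : LipschitzWith Kf f) (f0 : f 0 = 0) {U W : ℝ → RealL2} (hU : Continuous U)
    (hW : Continuous W)
    (hband : ∀ (n : ℕ) (t : ℝ),
        HasDerivAt (fun τ => proj n (opK kap (U τ))) (opOm om n (opK kap (W t))) t ∧
        HasDerivAt (fun τ => proj n (opK kap (W τ))) (opOm om n (opK kap (U t))
          + proj n (opM kap om (hf.compLp f0 (opK kap (U t))))) t) (t : ℝ) :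
    1 / 2 * ‖W t‖ ^ 2 + 1 / 2 * ‖U t‖ ^ 2 + potential f (opK kap (U t))
      = 1 / 2 * ‖W 0‖ ^ 2 + 1 / 2 * ‖U 0‖ ^ 2 + potential f (opK kap (U 0)) := by
  obtain ⟨C, hC0, hC⟩ := h.exists_strong_bound hf f0
  set N : RealL2 → RealL2 := fun u => hf.compLp f0 u with hN
  have hNc : Continuous N := hf.continuous_compLp f0
  -- Although the norms of the band operators need not be bounded in n, their values on N(KV) are
  -- projections of one L² function supplied by the strong bound.
  have hJ : ∀ n V, ‖opJ kap om n (N (opK kap V))‖ ≤ C * ‖V‖ := by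
    intro n V
    obtain ⟨V', hV', hn⟩ := hC V
    rw [← h.opKinv_opM, ← hV', h.opKinv_proj_opK]
    exact (norm_proj_le _ _).trans hn
  -- The only non-cancelling term in the band energy balance: the force at u against the force at
  -- the projection of u.
  set δ : ℕ → ℝ → ℝ := fun n t =>
    inner ℝ (W t) (opJ kap om n (N (opK kap (U t)) - N (proj n (opK kap (U t))))) with hδ
  set e : ℕ → ℝ → ℝ := fun n t => 1 / 2 * ‖proj n (W t)‖ ^ 2 + 1 / 2 * ‖proj n (U t)‖ ^ 2
    + potential f (proj n (opK kap (U t))) with he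
  have hde : ∀ n t, HasDerivAt (e n) (δ n t) t := by
    intro n t
    obtain ⟨h1, h2⟩ := hband n t
    have h1' : HasDerivAt (fun τ => proj n (U τ)) (opOm om n (W t)) t := by
      have := (opKinv kap n).hasFDerivAt.comp_hasDerivAt t h1
      simp only [Function.comp_def, h.opKinv_proj_opK, h.opKinv_opOm_opK] at this
      exact this
    have h2' : HasDerivAt (fun τ => proj n (W τ))
        (opOm om n (U t) + opJ kap om n (N (opK kap (U t)))) t := by
      have := (opKinv kap n).hasFDerivAt.comp_hasDerivAt t h2
      simp only [Function.comp_def, map_add, h.opKinv_proj_opK, h.opKinv_opOm_opK,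
        h.opKinv_opM] at this
      exact this
    have h3 := (hasFDerivAt_potential hf f0 (proj n (opK kap (U t)))).comp_hasDerivAt t h1
    have h4 := ((h2'.norm_sq.const_mul (1 / 2 : ℝ)).add (h1'.norm_sq.const_mul (1 / 2 : ℝ))).add h3
    convert! h4 using 1
    rw [innerSL_apply_apply, h.inner_opOm_opK, inner_add_right, inner_proj, inner_proj,
      h.proj_opOm le_rfl, inner_proj, h.proj_opOm le_rfl, h.proj_opJ le_rfl, ← real_inner_comm,
      h.inner_opOm]
    simp only [hδ, map_sub, inner_sub_right]
    simp only [hN]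
    ring
  have hδc : ∀ n, Continuous (δ n) := by
    intro n
    have hKU : Continuous (fun t => opK kap (U t)) := (opK kap).continuous.comp hU
    exact hW.inner ((opJ kap om n).continuous.comp
      ((hNc.comp hKU).sub (hNc.comp ((proj n).continuous.comp hKU))))
  have hJD : ∀ n t, ‖opJ kap om n (N (opK kap (U t)) - N (proj n (opK kap (U t))))‖
      ≤ 2 * C * ‖U t‖ := by
    intro n t
    rw [map_sub]
    have h1 := hJ n (U t)
    have h2 := hJ n (proj n (U t))
    rw [← h.proj_opK] at h2
    have h3 := mul_le_mul_of_nonneg_left (norm_proj_le n (U t)) hC0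
    have h4 := norm_sub_le (opJ kap om n (N (opK kap (U t))))
      (opJ kap om n (N (proj n (opK kap (U t)))))
    linarith
  have hδ0 : ∀ t, Filter.Tendsto (fun n => δ n t) Filter.atTop (nhds 0) := by
    intro t
    have hD : Filter.Tendsto (fun n => N (opK kap (U t)) - N (proj n (opK kap (U t))))
        Filter.atTop (nhds 0) := by
      have := ((hNc.tendsto _).comp (tendsto_proj (opK kap (U t)))).const_sub
        (N (opK kap (U t)))
      simpa using this
    rw [Metric.tendsto_atTop]
    intro ε hε
    -- A weak convergence argument: the high frequencies of W are small against the uniform bound on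
    -- `opJ`, and on the remaining fixed band `opJ kap om m` is a bounded operator applied to a
    -- vanishing difference.
    have hWm : Filter.Tendsto (fun m => ‖W t - proj m (W t)‖ * (2 * C * ‖U t‖))
        Filter.atTop (nhds 0) := by
      have := (((tendsto_proj (W t)).const_sub (W t)).norm).mul_const (2 * C * ‖U t‖)
      simpa using this
    obtain ⟨m, hm⟩ := ((tendsto_order.mp hWm).2 (ε / 2) (by linarith)).exists
    have hJm : Filter.Tendsto (fun n => ‖W t‖ *
        ‖opJ kap om m (N (opK kap (U t)) - N (proj n (opK kap (U t))))‖) Filter.atTop (nhds 0) := by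
      have := ((((opJ kap om m).continuous.tendsto 0).comp hD).norm).const_mul ‖W t‖
      simpa [Function.comp_def] using this
    obtain ⟨n₀, hn₀⟩ := Filter.eventually_atTop.mp
      ((tendsto_order.mp hJm).2 (ε / 2) (by linarith))
    refine ⟨max m n₀, fun n hn => ?_⟩
    rw [dist_zero_right, Real.norm_eq_abs]
    set D := N (opK kap (U t)) - N (proj n (opK kap (U t))) with hDdef
    have esplit : δ n t = inner ℝ (W t - proj m (W t)) (opJ kap om n D)
        + inner ℝ (W t) (opJ kap om m D) := by
      rw [inner_sub_left, inner_proj, h.proj_opJ ((le_max_left _ _).trans hn)]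
      simp only [hδ]
      rw [← hDdef]
      ring
    rw [esplit]
    have h1 := abs_real_inner_le_norm (W t - proj m (W t)) (opJ kap om n D)
    have h2 := abs_real_inner_le_norm (W t) (opJ kap om m D)
    have h3 := mul_le_mul_of_nonneg_left (hJD n t) (norm_nonneg (W t - proj m (W t)))
    have h4 := hn₀ n ((le_max_right _ _).trans hn)
    have h5 := abs_add_le (inner ℝ (W t - proj m (W t)) (opJ kap om n D))
      (inner ℝ (W t) (opJ kap om m D))
    linarith
  have hint : ∀ n, ∫ τ in (0 : ℝ)..t, δ n τ = e n t - e n 0 := fun n =>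
    intervalIntegral.integral_eq_sub_of_hasDerivAt (fun τ _ => hde n τ)
      ((hδc n).intervalIntegrable _ _)
  have hlim1 : Filter.Tendsto (fun n => ∫ τ in (0 : ℝ)..t, δ n τ) Filter.atTop
      (nhds (∫ _ in (0 : ℝ)..t, (0 : ℝ))) := by
    apply intervalIntegral.tendsto_integral_filter_of_dominated_convergence
      (fun τ => ‖W τ‖ * (2 * C * ‖U τ‖))
    · exact Filter.Eventually.of_forall fun n => (hδc n).aestronglyMeasurable
    · refine Filter.Eventually.of_forall fun n => Filter.Eventually.of_forall fun τ _ => ?_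
      exact (abs_real_inner_le_norm _ _).trans
        (mul_le_mul_of_nonneg_left (hJD n τ) (norm_nonneg _))
    · exact (hW.norm.mul (hU.norm.const_mul (2 * C))).intervalIntegrable _ _
    · exact Filter.Eventually.of_forall fun τ _ => hδ0 τ
  have hlim2 : ∀ τ, Filter.Tendsto (fun n => e n τ) Filter.atTop (nhds
      (1 / 2 * ‖W τ‖ ^ 2 + 1 / 2 * ‖U τ‖ ^ 2 + potential f (opK kap (U τ)))) := fun τ =>
    ((((tendsto_proj (W τ)).norm.pow 2).const_mul (1 / 2)).add
      (((tendsto_proj (U τ)).norm.pow 2).const_mul (1 / 2))).add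
      (((continuous_potential hf f0).tendsto _).comp (tendsto_proj (opK kap (U τ))))
  simp_rw [hint] at hlim1
  have := tendsto_nhds_unique hlim1 ((hlim2 t).sub (hlim2 0))
  simp only [intervalIntegral.integral_zero] at this
  linarith

end Admissible

/-! ### Truncation of the nonlinearity -/

section Truncation

variable {p R : ℝ}

/-- The nonlinearity `g`, truncated to `[-R, R]`. -/
def gTrunc (p R : ℝ) (v : ℝ) : ℝ := g p (max (-R) (min v R))

theorem gTrunc_eq {v : ℝ} (hv : |v| ≤ R) : gTrunc p R v = g p v := by
  obtain ⟨h1, h2⟩ := abs_le.mp hv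
  rw [gTrunc, min_eq_left h2, max_eq_right h1]

theorem g_zero (p : ℝ) : g p 0 = 0 := by simp [g]

theorem gTrunc_zero (hR : 0 ≤ R) : gTrunc p R 0 = 0 := by
  rw [gTrunc_eq (by simpa using hR), g_zero]

/-- A C¹ function is Lipschitz on a compact interval and clamping to that interval is 1-Lipschitz.
-/
theorem exists_lipschitzWith_gTrunc (hg : ContDiff ℝ 1 (g p)) (hR : 0 ≤ R) :
    ∃ K, LipschitzWith K (gTrunc p R) := by
  obtain ⟨K, hK⟩ := hg.contDiffOn.exists_lipschitzOnWith one_ne_zero (convex_Icc (-R) R)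
    isCompact_Icc
  refine ⟨K, LipschitzWith.of_dist_le_mul fun x y => ?_⟩
  have hm : ∀ v : ℝ, max (-R) (min v R) ∈ Set.Icc (-R) R := fun v =>
    ⟨le_max_left _ _, max_le (by linarith) (min_le_right _ _)⟩
  refine (hK.dist_le_mul _ (hm x) _ (hm y)).trans ?_
  gcongr
  rw [Real.dist_eq, Real.dist_eq]
  rw [max_comm (-R), max_comm (-R)]
  refine (abs_max_sub_max_le_abs _ _ _).trans ((abs_min_sub_min_le_max x R y R).trans ?_)
  simp

theorem prim_gTrunc (hp : 1 < p) {v : ℝ} (hv : |v| ≤ R) :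
    prim (gTrunc p R) v = -(1 / (p + 1)) * |v| ^ (p + 1) := by
  have h1 : prim (gTrunc p R) v = ∫ x in (0 : ℝ)..v, g p x := by
    apply intervalIntegral.integral_congr
    intro x hx
    apply gTrunc_eq
    have := Set.abs_sub_left_of_mem_uIcc hx
    simp only [sub_zero] at this
    exact this.trans hv
  have hd : ∀ x : ℝ, HasDerivAt (fun x => -(1 / (p + 1)) * |x| ^ (p + 1)) (g p x) x := by
    intro x
    convert! (hasDerivAt_abs_rpow x (by linarith : 1 < p + 1)).const_mul (-(1 / (p + 1))) using 1
    have : p + 1 - 2 = p - 1 := by ring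
    rw [g, this]
    field_simp
  have hc : Continuous (g p) := by
    have h2 : Continuous (fun v : ℝ => |v| ^ (p - 1)) :=
      continuous_abs.rpow_const fun x => Or.inr (by linarith)
    exact h2.neg.mul continuous_id
  rw [h1, intervalIntegral.integral_eq_sub_of_hasDerivAt (fun x _ => hd x)
    (hc.intervalIntegrable _ _), abs_zero, Real.zero_rpow (by linarith)]
  ring

theorem potential_gTrunc (hp : 1 < p) {u : RealL2} (hu : ∀ᵐ x, |u x| ≤ R) :
    potential (gTrunc p R) u = -(1 / (p + 1)) * Q p u := by
  rw [potential, Q, ← integral_const_mul]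
  apply integral_congr_ae
  filter_upwards [hu] with x hx
  exact prim_gTrunc hp hx

/-- Below the truncation level the two nonlinearities agree almost everywhere, which also shows that
g(u) is in L², so the default value in `gL2` is not used. -/
theorem gL2_eq_compLp {K : NNReal} (hK : LipschitzWith K (gTrunc p R)) (h0 : gTrunc p R 0 = 0)
    {u : RealL2} (hu : ∀ᵐ x, |u x| ≤ R) : gL2 p u = hK.compLp h0 u := by
  have e : (fun x => g p (u x)) =ᵐ[volume] hK.compLp h0 u := by
    filter_upwards [hu, hK.coeFn_compLp h0 u] with x hx h1
    rw [h1, Function.comp_apply, gTrunc_eq hx]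
  have hm : MemLp (fun x => g p (u x)) 2 volume := (Lp.memLp (hK.compLp h0 u)).ae_eq e.symm
  rw [gL2, dif_pos hm]
  exact Lp.ext (hm.coeFn_toLp.trans e)

/-- Split |u|^(p+1) as |u|^(p-1) u² and bound the first factor by the sup norm. -/
theorem Q_le_of_abs_le (hp : 1 < p) {u : RealL2} (hu : ∀ᵐ x, |u x| ≤ R) :
    Q p u ≤ R ^ (p - 1) * ‖u‖ ^ 2 := by
  rw [Q, norm_sq_eq_integral, ← integral_const_mul]
  have hb : ∀ᵐ x, |u x| ^ (p + 1) ≤ R ^ (p - 1) * u x ^ 2 := by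
    filter_upwards [hu] with x hx
    have : p + 1 = (p - 1) + 2 := by ring
    rw [this, Real.rpow_add' (abs_nonneg _) (by linarith), Real.rpow_two, sq_abs]
    gcongr
  have hi := (integrable_sq_RealL2 u).const_mul (R ^ (p - 1))
  apply integral_mono_of_nonneg (Filter.Eventually.of_forall fun x => by positivity) hi hb

end Truncation

/-! ### The potential well -/

section Well

variable {s p : ℝ} {kap om : ℝ → ℝ}

/-- Small functions satisfy `Q(u) ≤ 2 I(u)`. -/
theorem IsAdmissible.exists_small (h : IsAdmissible s kap om) (hp : 1 < p) :
    ∃ δ, 0 < δ ∧ ∀ U : RealL2, ‖U‖ < δ → Q p (opK kap U) ≤ ‖U‖ ^ 2 := by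
  obtain ⟨C, hC0, hC⟩ := exists_sup_bound_mulOp h.isSymbol_kap (h.smoothing.memLp h.half_lt)
  -- The ratio of the bound for Q to ‖U‖² carries a positive power p - 1 of ‖U‖, so it drops below 1
  -- near the origin.
  have hc : Filter.Tendsto (fun x : ℝ => (C * x) ^ (p - 1) * ‖opK kap‖ ^ 2) (nhds 0) (nhds 0) := by
    have h1 : Continuous (fun x : ℝ => (C * x) ^ (p - 1) * ‖opK kap‖ ^ 2) :=
      ((continuous_const.mul continuous_id).rpow_const fun x => Or.inr (by linarith)).mul
        continuous_const
    have := h1.tendsto 0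
    rwa [mul_zero, Real.zero_rpow (by linarith), zero_mul] at this
  obtain ⟨δ, hδ, hδ1⟩ := Metric.eventually_nhds_iff.mp ((tendsto_order.mp hc).2 1 one_pos)
  refine ⟨δ, hδ, fun U hU => ?_⟩
  have h1 := Q_le_of_abs_le hp (hC U)
  have h2 := (hδ1 (y := ‖U‖) (by simpa using hU)).le
  refine h1.trans ?_
  calc (C * ‖U‖) ^ (p - 1) * ‖opK kap U‖ ^ 2
      ≤ (C * ‖U‖) ^ (p - 1) * (‖opK kap‖ * ‖U‖) ^ 2 := by
        gcongr
        exact (opK kap).le_opNorm U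
    _ = ((C * ‖U‖) ^ (p - 1) * ‖opK kap‖ ^ 2) * ‖U‖ ^ 2 := by ring
    _ ≤ 1 * ‖U‖ ^ 2 := by gcongr
    _ = _ := one_mul _

/-- Global solutions in the potential well. -/
theorem IsAdmissible.exists_global_solution (h : IsAdmissible s kap om) (hp : 1 < p)
    (hg : ContDiff ℝ 1 (g p)) {d : ℝ}
    (hd : ∀ U W : RealL2, opK kap U ≠ 0 → ‖U‖ ^ 2 - Q p (opK kap U) = 0 →
      d ≤ 1 / 2 * ‖W‖ ^ 2 + 1 / 2 * ‖U‖ ^ 2 - 1 / (p + 1) * Q p (opK kap U))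
    {U₀ W₀ : RealL2}
    (hE : 1 / 2 * ‖W₀‖ ^ 2 + 1 / 2 * ‖U₀‖ ^ 2 - 1 / (p + 1) * Q p (opK kap U₀) < d)
    (hQ : Q p (opK kap U₀) ≤ ‖U₀‖ ^ 2) :
    ∃ U W : ℝ → RealL2, Continuous U ∧ Continuous W ∧ U 0 = U₀ ∧ W 0 = W₀ ∧
      Continuous (fun t => gL2 p (opK kap (U t))) ∧
      ∀ (n : ℕ) (t : ℝ),
        HasDerivAt (fun τ => proj n (opK kap (U τ))) (opOm om n (opK kap (W t))) t ∧
        HasDerivAt (fun τ => proj n (opK kap (W τ))) (opOm om n (opK kap (U t))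
          + proj n (opM kap om (gL2 p (opK kap (U t))))) t := by
  obtain ⟨C, hC0, hC⟩ := exists_sup_bound_mulOp h.isSymbol_kap (h.smoothing.memLp h.half_lt)
  change ∀ U, ∀ᵐ x, |opK kap U x| ≤ C * ‖U‖ at hC
  obtain ⟨δ, hδ, hsmall⟩ := h.exists_small hp
  set E₀ := 1 / 2 * ‖W₀‖ ^ 2 + 1 / 2 * ‖U₀‖ ^ 2 - 1 / (p + 1) * Q p (opK kap U₀) with hE₀
  -- When Q ≤ ‖U‖², the energy is at least (1/2 - 1/(p+1)) ‖U‖², with coefficient (p-1)/(2(p+1)) >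
  -- 0; M solves for ‖U‖.
  set M := Real.sqrt (2 * (p + 1) / (p - 1) * E₀) with hM
  have hM0 : 0 ≤ M := Real.sqrt_nonneg _
  have hbound : ∀ U W : RealL2,
      1 / 2 * ‖W‖ ^ 2 + 1 / 2 * ‖U‖ ^ 2 - 1 / (p + 1) * Q p (opK kap U) = E₀ →
      Q p (opK kap U) ≤ ‖U‖ ^ 2 → ‖U‖ ≤ M := by
    intro U W h1 h2
    apply Real.le_sqrt_of_sq_le
    have h3 : 1 / (p + 1) * Q p (opK kap U) ≤ 1 / (p + 1) * ‖U‖ ^ 2 := by gcongr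
    have h4 : (1 / 2 - 1 / (p + 1)) * ‖U‖ ^ 2 ≤ E₀ := by nlinarith [sq_nonneg ‖W‖]
    have h5 : (1 / 2 - 1 / (p + 1)) = (p - 1) / (2 * (p + 1)) := by field_simp; ring
    rw [h5] at h4
    have hp1 : 0 < p - 1 := by linarith
    calc ‖U‖ ^ 2 = 2 * (p + 1) / (p - 1) * ((p - 1) / (2 * (p + 1)) * ‖U‖ ^ 2) := by
          field_simp
      _ ≤ _ := by gcongr
  -- The extra 1 leaves room: near a time with ‖U‖ ≤ M the truncation is still inactive, so
  -- conservation of the true energy can be used to improve M + 1 back to M.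
  set R := C * (M + 1) with hRdef
  have hR : 0 ≤ R := by positivity
  obtain ⟨K, hK⟩ := exists_lipschitzWith_gTrunc hg hR
  have h0 : gTrunc p R 0 = 0 := gTrunc_zero hR
  obtain ⟨U, W, hU, hW, hU0, hW0, hband⟩ := h.exists_lipschitz_solution hK h0 U₀ W₀
  have hcons := h.energy_conserved hK h0 hU hW hband
  have hle : ∀ V : RealL2, ‖V‖ ≤ M + 1 → ∀ᵐ x, |opK kap V x| ≤ R := by
    intro V hV
    filter_upwards [hC V] with x hx
    exact hx.trans (mul_le_mul_of_nonneg_left hV hC0)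
  have hpot : ∀ V : RealL2, ‖V‖ ≤ M + 1 →
      potential (gTrunc p R) (opK kap V) = -(1 / (p + 1)) * Q p (opK kap V) :=
    fun V hV => potential_gTrunc hp (hle V hV)
  have hp1 : 0 < p + 1 := by linarith
  have hE0' : 1 / 2 * ‖W 0‖ ^ 2 + 1 / 2 * ‖U 0‖ ^ 2 + potential (gTrunc p R) (opK kap (U 0))
      = E₀ := by
    rw [hU0, hW0, hpot U₀ ((hbound U₀ W₀ rfl hQ).trans (by linarith))]
    ring
  have hcons' : ∀ t, ‖U t‖ ≤ M + 1 →
      1 / 2 * ‖W t‖ ^ 2 + 1 / 2 * ‖U t‖ ^ 2 - 1 / (p + 1) * Q p (opK kap (U t)) = E₀ := by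
    intro t ht
    rw [← hE0', ← hcons t, hpot _ ht]
    ring
  -- The second condition is Q ≤ ‖U‖² written with the truncated potential, which is continuous on
  -- all of L². A clopen argument shows that the set contains every time.
  set S : Set ℝ := {t | ‖U t‖ ≤ M ∧ -(p + 1) * potential (gTrunc p R) (opK kap (U t)) ≤ ‖U t‖ ^ 2}
    with hS
  have hqc : Continuous (fun t => -(p + 1) * potential (gTrunc p R) (opK kap (U t))) :=
    continuous_const.mul ((continuous_potential hK h0).comp ((opK kap).continuous.comp hU))
  have hq : ∀ V : RealL2, ‖V‖ ≤ M + 1 →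
      -(p + 1) * potential (gTrunc p R) (opK kap V) = Q p (opK kap V) := by
    intro V hV
    rw [hpot V hV]
    field_simp
  have hSclosed : IsClosed S :=
    (isClosed_le hU.norm continuous_const).inter (isClosed_le hqc (hU.norm.pow 2))
  have hSopen : IsOpen S := by
    rw [isOpen_iff_mem_nhds]
    rintro t ⟨ht1, ht2⟩
    have ev1 : ∀ᶠ τ in nhds t, ‖U τ‖ < M + 1 :=
      hU.norm.continuousAt.eventually_lt_const (by linarith)
    have ev2 : ∀ᶠ τ in nhds t, -(p + 1) * potential (gTrunc p R) (opK kap (U τ)) ≤ ‖U τ‖ ^ 2 := by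
      rcases ht2.lt_or_eq with hlt | heq
      · exact (hqc.continuousAt.eventually_lt (hU.norm.pow 2).continuousAt hlt).mono
          fun _ => le_of_lt
      -- Equality holds either at the origin, near which Q ≤ ‖U‖² is automatic, or on the Nehari
      -- set, where the conserved energy E₀ < d contradicts the definition of d.
      · by_cases hUt : U t = 0
        · have ev3 : ∀ᶠ τ in nhds t, ‖U τ‖ < δ :=
            hU.norm.continuousAt.eventually_lt_const (by simpa [hUt] using hδ)
          filter_upwards [ev1, ev3] with τ h1 h3
          rw [hq _ h1.le]
          exact hsmall _ h3
        · exfalso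
          have hne : opK kap (U t) ≠ 0 := fun hz =>
            hUt (h.opK_injective (hz.trans (map_zero _).symm))
          rw [hq _ (by linarith)] at heq
          have := hd (U t) (W t) hne (by rw [heq, sub_self])
          rw [hcons' t (by linarith)] at this
          linarith
    filter_upwards [ev1, ev2] with τ h1 h2
    refine ⟨hbound _ (W τ) (hcons' τ h1.le) ?_, h2⟩
    rwa [hq _ h1.le] at h2
  have hSuniv : S = Set.univ := by
    refine IsClopen.eq_univ ⟨hSclosed, hSopen⟩ ⟨0, ?_⟩
    have := hbound U₀ W₀ rfl hQ
    refine ⟨by rwa [hU0], ?_⟩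
    rw [hU0, hq _ (by linarith)]
    exact hQ
  have hall : ∀ t, ‖U t‖ ≤ M + 1 := fun t => by
    have : t ∈ S := hSuniv ▸ Set.mem_univ t
    linarith [this.1]
  refine ⟨U, W, hU, hW, hU0, hW0, ?_, fun n t => ?_⟩
  · simp_rw [fun t => gL2_eq_compLp hK h0 (hle _ (hall t))]
    exact (hK.continuous_compLp h0).comp ((opK kap).continuous.comp hU)
  rw [gL2_eq_compLp hK h0 (hle _ (hall t))]
  exact hband n t

end Well

/-! ### Admissibility of the concrete symbols -/

section Symbols

variable {k ρ r : ℝ} {m l b : ℝ → ℝ}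

theorem IsEllipticSymbol.pos (hm : IsEllipticSymbol m k) (ξ : ℝ) : 0 < m ξ := by
  obtain ⟨c, C, hc, -, h⟩ := hm.coercive
  exact lt_of_lt_of_le (by positivity) (h ξ).1

/-- Raising to a negative power reverses the two inequalities, hence the case distinction on the
sign of the exponent. -/
theorem IsEllipticSymbol.rpow_bounds (hm : IsEllipticSymbol m k) (e : ℝ) :
    ∃ c C : ℝ, 0 < c ∧ 0 < C ∧ ∀ ξ : ℝ, c * (1 + ξ ^ 2) ^ (k * e / 2) ≤ m ξ ^ e ∧
      m ξ ^ e ≤ C * (1 + ξ ^ 2) ^ (k * e / 2) := by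
  obtain ⟨c, C, hc, hC, h⟩ := hm.coercive
  have key : ∀ a ξ : ℝ, 0 < a →
      (a ^ 2 * (1 + ξ ^ 2) ^ (k / 2)) ^ e = (a ^ 2) ^ e * (1 + ξ ^ 2) ^ (k * e / 2) := by
    intro a ξ ha
    rw [Real.mul_rpow (by positivity) (by positivity), ← Real.rpow_mul (by positivity)]
    congr 2
    ring
  rcases le_total 0 e with he | he
  · refine ⟨(c ^ 2) ^ e, (C ^ 2) ^ e, by positivity, by positivity, fun ξ => ?_⟩
    rw [← key c ξ hc, ← key C ξ hC]
    exact ⟨Real.rpow_le_rpow (by positivity) (h ξ).1 he,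
      Real.rpow_le_rpow (hm.pos ξ).le (h ξ).2 he⟩
  · refine ⟨(C ^ 2) ^ e, (c ^ 2) ^ e, by positivity, by positivity, fun ξ => ?_⟩
    rw [← key c ξ hc, ← key C ξ hC]
    exact ⟨Real.rpow_le_rpow_of_nonpos (hm.pos ξ) (h ξ).2 he,
      Real.rpow_le_rpow_of_nonpos (by positivity) (h ξ).1 he⟩

theorem IsEllipticSymbol.measurable_rpow (hm : IsEllipticSymbol m k) (e : ℝ) :
    Measurable (fun η : ℝ => m (2 * Real.pi * η) ^ e) :=
  (hm.smooth.continuous.measurable.comp (measurable_const_mul _)).pow_const e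

theorem IsEllipticSymbol.even_rpow (hm : IsEllipticSymbol m k) (e η : ℝ) :
    m (2 * Real.pi * -η) ^ e = m (2 * Real.pi * η) ^ e := by
  rw [mul_neg, hm.even]

/-- The symbol of `B^(1/2) L^(-1/2)`. -/
def symK (l b : ℝ → ℝ) (η : ℝ) : ℝ :=
  b (2 * Real.pi * η) ^ (1 / 2 : ℝ) * l (2 * Real.pi * η) ^ (-(1 / 2) : ℝ)

/-- The symbol of `B^(1/2)`. -/
def symB (b : ℝ → ℝ) (η : ℝ) : ℝ := b (2 * Real.pi * η) ^ (1 / 2 : ℝ)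

/-- The symbol of `-i ∂ₓ L^(1/2)`. -/
def symOm (l : ℝ → ℝ) (η : ℝ) : ℝ := 2 * Real.pi * η * l (2 * Real.pi * η) ^ (1 / 2 : ℝ)

theorem isSmoothing_symK (hl : IsEllipticSymbol l ρ) (hb : IsEllipticSymbol b (-r)) :
    IsSmoothing (s₀ ρ r) (symK l b) := by
  obtain ⟨c, C, hc, hC, h⟩ := hl.rpow_bounds (-(1 / 2))
  obtain ⟨c', C', hc', hC', h'⟩ := hb.rpow_bounds (1 / 2)
  refine ⟨(hb.measurable_rpow _).mul (hl.measurable_rpow _), fun η => ?_,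
    c' * c, C' * C, by positivity, by positivity, fun η => ?_⟩
  · rw [symK, symK, hl.even_rpow, hb.even_rpow]
  · have e : (1 + (2 * Real.pi * η) ^ 2) ^ (-s₀ ρ r / 2)
        = (1 + (2 * Real.pi * η) ^ 2) ^ (-r * (1 / 2) / 2)
          * (1 + (2 * Real.pi * η) ^ 2) ^ (ρ * -(1 / 2) / 2) := by
      rw [← Real.rpow_add (bracket_pos _), s₀]
      congr 1
      ring
    rw [e, mul_mul_mul_comm c', mul_mul_mul_comm C']
    exact ⟨mul_le_mul (h' _).1 (h _).1 (by positivity) ((by positivity : (0 : ℝ) ≤ _).trans (h' _).1),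
      mul_le_mul (h' _).2 (h _).2 ((by positivity : (0 : ℝ) ≤ _).trans (h _).1) (by positivity)⟩

theorem isSmoothing_symB (hb : IsEllipticSymbol b (-r)) :
    IsSmoothing (s₀ ρ r - ρ / 2) (symB b) := by
  obtain ⟨c, C, hc, hC, h⟩ := hb.rpow_bounds (1 / 2)
  refine ⟨hb.measurable_rpow _, fun η => hb.even_rpow _ _, c, C, hc, hC, fun η => ?_⟩
  have e : -(s₀ ρ r - ρ / 2) / 2 = -r * (1 / 2) / 2 := by
    rw [s₀]
    ring
  rw [e]
  exact h _

/-- Twice s₀ is (r + ρ/2) + ρ/2, which is at least 1 with equality only at the excluded point. -/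
theorem half_lt_s₀ (hρ : 0 ≤ ρ) (hρr : 1 ≤ r + ρ / 2) (hne : ¬ (ρ = 0 ∧ r = 1)) :
    1 / 2 < s₀ ρ r := by
  rw [s₀]
  rcases hρ.lt_or_eq with h | h
  · linarith
  · subst h
    have h1 : 1 < r := lt_of_le_of_ne (by linarith) fun h => hne ⟨rfl, h.symm⟩
    linarith

theorem abs_le_bracket_rpow (x : ℝ) : |x| ≤ (1 + x ^ 2) ^ (1 / 2 : ℝ) := by
  rw [← Real.sqrt_eq_rpow]
  exact Real.abs_le_sqrt (by linarith)

theorem bracket_rpow_le {σ : ℝ} (h0 : 0 ≤ σ) (h1 : σ ≤ 1) (x : ℝ) :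
    (1 + x ^ 2) ^ (σ / 2) ≤ 1 + |x| ^ σ := by
  have e1 : (1 + x ^ 2) ^ (σ / 2) ≤ 1 ^ (σ / 2) + (x ^ 2) ^ (σ / 2) :=
    Real.rpow_add_le_add_rpow zero_le_one (sq_nonneg x) (by positivity) (by linarith)
  rw [Real.one_rpow, ← sq_abs, ← Real.rpow_two, ← Real.rpow_mul (abs_nonneg _)] at e1
  rw [← sq_abs, ← Real.rpow_two]
  convert e1 using 3
  ring

theorem IsEllipticSymbol.rpow_neg_half_mul (hm : IsEllipticSymbol m k) (ξ : ℝ) :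
    m ξ ^ (-(1 / 2) : ℝ) * m ξ ^ (1 / 2 : ℝ) = 1 := by
  rw [← Real.rpow_add (hm.pos ξ)]
  norm_num

/-- Order counting. kap² om = ξ b l^(-1/2) has order 1 - r - ρ/2 ≤ 0, and kap om = ξ b^(1/2) has
order 1 - r/2. Its positive part σ is at most 1 since r ≥ 0, and at most s₀ since 1 - r/2 ≤ r/2 +
ρ/2 is again r + ρ/2 ≥ 1. -/
theorem isAdmissible (hρ : 0 ≤ ρ) (hr : 0 ≤ r) (hl : IsEllipticSymbol l ρ)
    (hb : IsEllipticSymbol b (-r)) (hρr : 1 ≤ r + ρ / 2) (hne : ¬ (ρ = 0 ∧ r = 1)) :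
    IsAdmissible (s₀ ρ r) (symK l b) (symOm l) := by
  have hs := half_lt_s₀ hρ hρr hne
  refine ⟨hs, isSmoothing_symK hl hb, (measurable_const_mul _).mul (hl.measurable_rpow _),
    fun η => ?_, ?_, ?_⟩
  · rw [symOm, symOm, hl.even_rpow]
    ring
  · obtain ⟨c, C, hc, hC, h⟩ := hl.rpow_bounds (-(1 / 2))
    obtain ⟨c', C', hc', hC', h'⟩ := hb.rpow_bounds 1
    refine ⟨C' * C, fun η => ?_⟩
    set ξ := 2 * Real.pi * η with hξ
    have hlp := hl.pos ξ
    have hbp := hb.pos ξ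
    have e : symK l b η ^ 2 * symOm l η = ξ * b ξ ^ (1 : ℝ) * l ξ ^ (-(1 / 2) : ℝ) := by
      have e1 := hl.rpow_neg_half_mul ξ
      have e2 : b ξ ^ (1 / 2 : ℝ) * b ξ ^ (1 / 2 : ℝ) = b ξ ^ (1 : ℝ) := by
        rw [← Real.rpow_add hbp]
        norm_num
      rw [symK, symOm, ← hξ, ← e2]
      linear_combination (ξ * b ξ ^ (1 / 2 : ℝ) * b ξ ^ (1 / 2 : ℝ) * l ξ ^ (-(1 / 2) : ℝ)) * e1
    rw [e, abs_mul, abs_mul, abs_of_pos (Real.rpow_pos_of_pos hbp _),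
      abs_of_pos (Real.rpow_pos_of_pos hlp _)]
    calc |ξ| * b ξ ^ (1 : ℝ) * l ξ ^ (-(1 / 2) : ℝ)
        ≤ (1 + ξ ^ 2) ^ (1 / 2 : ℝ) * (C' * (1 + ξ ^ 2) ^ (-r * 1 / 2))
          * (C * (1 + ξ ^ 2) ^ (ρ * -(1 / 2) / 2)) := by
          gcongr
          · exact abs_le_bracket_rpow ξ
          · exact (h' ξ).2
          · exact (h ξ).2
      _ = C' * C * (1 + ξ ^ 2) ^ (1 / 2 + -r * 1 / 2 + ρ * -(1 / 2) / 2) := by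
          rw [Real.rpow_add (bracket_pos _), Real.rpow_add (bracket_pos _)]
          ring
      _ ≤ C' * C * 1 := by
          gcongr
          exact Real.rpow_le_one_of_one_le_of_nonpos (one_le_bracket _) (by linarith)
      _ = _ := mul_one _
  · obtain ⟨c, C, hc, hC, h⟩ := hb.rpow_bounds (1 / 2)
    have h1 : max 0 (1 - r / 2) ≤ 1 := max_le zero_le_one (by linarith)
    have h0 : 0 ≤ max 0 (1 - r / 2) := le_max_left _ _
    refine ⟨max 0 (1 - r / 2), C * (2 * Real.pi), h0, h1,
      max_le (by linarith) (by rw [s₀]; linarith), by positivity, fun η => ?_⟩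
    set σ := max 0 (1 - r / 2) with hσ
    set ξ := 2 * Real.pi * η with hξ
    have hlp := hl.pos ξ
    have hbp := hb.pos ξ
    have e : symK l b η * symOm l η = ξ * b ξ ^ (1 / 2 : ℝ) := by
      have e1 := hl.rpow_neg_half_mul ξ
      rw [symK, symOm, ← hξ]
      linear_combination (ξ * b ξ ^ (1 / 2 : ℝ)) * e1
    rw [e, abs_mul, abs_of_pos (Real.rpow_pos_of_pos hbp _)]
    have hpi : 1 ≤ 2 * Real.pi := by linarith [Real.pi_gt_three]
    calc |ξ| * b ξ ^ (1 / 2 : ℝ)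
        ≤ (1 + ξ ^ 2) ^ (1 / 2 : ℝ) * (C * (1 + ξ ^ 2) ^ (-r * (1 / 2) / 2)) := by
          gcongr
          · exact abs_le_bracket_rpow ξ
          · exact (h ξ).2
      _ = C * (1 + ξ ^ 2) ^ (1 / 2 + -r * (1 / 2) / 2) := by
          rw [Real.rpow_add (bracket_pos _)]
          ring
      _ ≤ C * (1 + ξ ^ 2) ^ (σ / 2) := by
          gcongr
          · exact one_le_bracket _
          · have := le_max_right 0 (1 - r / 2)
            linarith
      _ ≤ C * (1 + |ξ| ^ σ) := by
          gcongr
          exact bracket_rpow_le h0 h1 ξ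
      _ = C * (1 + (2 * Real.pi) ^ σ * |η| ^ σ) := by
          rw [hξ, abs_mul, abs_of_pos (by positivity : 0 < 2 * Real.pi),
            Real.mul_rpow (by positivity) (abs_nonneg _)]
      _ ≤ C * (2 * Real.pi + 2 * Real.pi * |η| ^ σ) := by
          gcongr
          calc (2 * Real.pi) ^ σ ≤ (2 * Real.pi) ^ (1 : ℝ) := Real.rpow_le_rpow_of_exponent_le hpi h1
            _ = _ := Real.rpow_one _
      _ = _ := by ring

end Symbols

/-! ### The energy in L² variables -/

section Energy

variable {ρ r p : ℝ} {l b : ℝ → ℝ}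

/-- The operator `B^(1/2)`. -/
def opB (b : ℝ → ℝ) : RealL2 →L[ℝ] RealL2 := mulOp (fun η => (symB b η : ℂ))

theorem norm_multiplier_opK (hs : 0 ≤ s₀ ρ r) (hl : IsEllipticSymbol l ρ)
    (hb : IsEllipticSymbol b (-r)) (U : RealL2) :
    ‖multiplier (fun ξ => b ξ ^ (-(1 / 2) : ℝ) * l ξ ^ (1 / 2 : ℝ)) (opK (symK l b) U)‖ = ‖U‖ := by
  apply norm_multiplier_mulOp (isSmoothing_symK hl hb) hs
  intro η
  rw [symK]
  have h1 := hb.rpow_neg_half_mul (2 * Real.pi * η)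
  have h2 := hl.rpow_neg_half_mul (2 * Real.pi * η)
  linear_combination (l (2 * Real.pi * η) ^ (-(1 / 2) : ℝ) * l (2 * Real.pi * η) ^ (1 / 2 : ℝ)) * h1
    + h2

theorem norm_multiplier_opB (hr : 0 ≤ r) (hb : IsEllipticSymbol b (-r)) (W : RealL2) :
    ‖multiplier (fun ξ => b ξ ^ (-(1 / 2) : ℝ)) (opB b W)‖ = ‖W‖ := by
  apply norm_multiplier_mulOp (isSmoothing_symB (ρ := 0) hb) (by rw [s₀]; linarith)
  intro η
  exact hb.rpow_neg_half_mul _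

theorem energy_opK_opB (hs : 0 ≤ s₀ ρ r) (hr : 0 ≤ r) (hl : IsEllipticSymbol l ρ)
    (hb : IsEllipticSymbol b (-r)) (U W : RealL2) :
    energy l b p (opK (symK l b) U) (opB b W)
      = 1 / 2 * ‖W‖ ^ 2 + 1 / 2 * ‖U‖ ^ 2 - 1 / (p + 1) * Q p (opK (symK l b) U) := by
  rw [energy, norm_multiplier_opK hs hl hb, norm_multiplier_opB hr hb]

theorem two_mul_I_opK (hs : 0 ≤ s₀ ρ r) (hl : IsEllipticSymbol l ρ)
    (hb : IsEllipticSymbol b (-r)) (U : RealL2) :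
    2 * I l b (opK (symK l b) U) = ‖U‖ ^ 2 := by
  rw [I, norm_multiplier_opK hs hl hb]
  ring

theorem memEnergySpace_opK_opB (hs : 0 ≤ s₀ ρ r) (hr : 0 ≤ r) (hl : IsEllipticSymbol l ρ)
    (hb : IsEllipticSymbol b (-r)) (U W : RealL2) :
    MemEnergySpace ρ r (opK (symK l b) U) (opB b W) :=
  ⟨(isSmoothing_symK hl hb).memSobolev_mulOp hs U,
    (isSmoothing_symB hb).memSobolev_mulOp (by rw [s₀]; linarith) W⟩

theorem exists_of_memEnergySpace (hs : 0 ≤ s₀ ρ r) (hr : 0 ≤ r) (hl : IsEllipticSymbol l ρ)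
    (hb : IsEllipticSymbol b (-r)) {u w : RealL2} (h : MemEnergySpace ρ r u w) :
    ∃ U W, u = opK (symK l b) U ∧ w = opB b W := by
  obtain ⟨U, hU⟩ := (isSmoothing_symK hl hb).exists_eq_mulOp hs h.1
  obtain ⟨W, hW⟩ := (isSmoothing_symB hb).exists_eq_mulOp (by rw [s₀]; linarith) h.2
  exact ⟨U, W, hU, hW⟩

/-- The depth is a lower bound for the energy on the Nehari manifold. -/
theorem depth_le (hs : 0 ≤ s₀ ρ r) (hr : 0 ≤ r) (hp : 1 < p) (hl : IsEllipticSymbol l ρ)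
    (hb : IsEllipticSymbol b (-r)) (U W : RealL2) (hU : opK (symK l b) U ≠ 0)
    (hQ : ‖U‖ ^ 2 - Q p (opK (symK l b) U) = 0) :
    depth l b ρ r p
      ≤ 1 / 2 * ‖W‖ ^ 2 + 1 / 2 * ‖U‖ ^ 2 - 1 / (p + 1) * Q p (opK (symK l b) U) := by
  apply csInf_le
  -- A real infimum is a lower bound only for a set bounded below; on the Nehari set the energy is
  -- ½‖W‖² plus a positive multiple of ‖U‖².
  · refine ⟨0, ?_⟩
    rintro e ⟨u, w, hm, -, h0, rfl⟩
    obtain ⟨U, W, rfl, rfl⟩ := exists_of_memEnergySpace hs hr hl hb hm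
    rw [two_mul_I_opK hs hl hb] at h0
    rw [energy_opK_opB hs hr hl hb, ← sub_eq_zero.mp h0]
    have h1 : 1 / (p + 1) ≤ 1 / 2 := one_div_le_one_div_of_le two_pos (by linarith)
    nlinarith [sq_nonneg ‖W‖, sq_nonneg ‖U‖]
  · exact ⟨_, _, memEnergySpace_opK_opB hs hr hl hb U W, hU, by rw [two_mul_I_opK hs hl hb, hQ],
      (energy_opK_opB hs hr hl hb U W).symm⟩

end Energy

/-! ### From frequency bands to the distributional equations -/

/-- The functional `u ↦ ∫ û χ` defined by a square-integrable function `χ`. -/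
theorem exists_functional {χ : ℝ → ℂ} (hχ : MemLp χ 2 volume) :
    ∃ A : RealL2 →L[ℝ] ℂ, ∀ u, A u = ∫ η, FT u η * χ η := by
  have hc : MemLp (fun η => conj (χ η)) 2 volume := hχ.star
  refine ⟨((innerSL ℂ hc.toLp).restrictScalars ℝ).comp FT.toContinuousLinearMap, fun u => ?_⟩
  change inner ℂ hc.toLp (FT u) = _
  rw [L2.inner_def]
  apply integral_congr_ae
  filter_upwards [hc.coeFn_toLp] with η h
  rw [h]
  simp

theorem integral_FT_proj_mul (n : ℕ) (u : RealL2) (χ : ℝ → ℂ) :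
    ∫ η, FT (proj n u) η * χ η = ∫ η, FT u η * band n χ η := by
  apply integral_congr_ae
  filter_upwards [FT_proj n u] with η h
  rw [h, band]
  split_ifs <;> simp

section Weak

variable {s p : ℝ} {kap om : ℝ → ℝ}

/-- Passing from the equation on all frequency bands to the weak equation. -/
theorem IsAdmissible.hasDerivAt_weak (h : IsAdmissible s kap om) {χ : ℝ → ℂ}
    (hχ : MemLp χ 2 volume) (hχ' : MemLp (fun η => Complex.I * om η * χ η) 2 volume)
    {z a c : ℝ → RealL2} (ha : Continuous a) (hc : Continuous c)
    (hz : ∀ (n : ℕ) (t : ℝ),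
      HasDerivAt (fun τ => proj n (z τ)) (opOm om n (a t) + proj n (c t)) t) (t : ℝ) :
    HasDerivAt (fun τ => ∫ η, FT (z τ) η * χ η)
      ((∫ η, FT (a t) η * (Complex.I * om η * χ η)) + ∫ η, FT (c t) η * χ η) t := by
  obtain ⟨A, hA⟩ := exists_functional hχ
  obtain ⟨B, hB⟩ := exists_functional hχ'
  simp_rw [← hA, ← hB]
  -- The unbounded operator is absorbed by the test function; what remains is a fixed bounded
  -- functional, uniform in n.
  have e1 : ∀ n u, A (opOm om n u) = B (proj n u) := by
    intro n u
    rw [hA, hB]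
    apply integral_congr_ae
    filter_upwards [FT_mulOp (h.isLocSymbol_om.band n) u, FT_proj n u] with η h1 h2
    rw [opOm, h1, h2, band]
    split_ifs
    · ring
    · simp
  set D : ℕ → ℝ → ℂ := fun n τ => B (proj n (a τ)) + A (proj n (c τ)) with hD
  have hDc : ∀ n, Continuous (D n) := fun n =>
    (B.continuous.comp ((proj n).continuous.comp ha)).add
      (A.continuous.comp ((proj n).continuous.comp hc))
  have hder : ∀ n τ, HasDerivAt (fun τ => A (proj n (z τ))) (D n τ) τ := by
    intro n τ
    have := A.hasFDerivAt.comp_hasDerivAt τ (hz n τ)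
    rwa [map_add, e1] at this
  have hint : ∀ n τ, ∫ x in (0 : ℝ)..τ, D n x = A (proj n (z τ)) - A (proj n (z 0)) := fun n τ =>
    intervalIntegral.integral_eq_sub_of_hasDerivAt (fun x _ => hder n x)
      ((hDc n).intervalIntegrable _ _)
  have hlim : ∀ τ, Filter.Tendsto (fun n => ∫ x in (0 : ℝ)..τ, D n x) Filter.atTop
      (nhds (∫ x in (0 : ℝ)..τ, (B (a x) + A (c x)))) := by
    intro τ
    apply intervalIntegral.tendsto_integral_filter_of_dominated_convergence
      (fun x => ‖B‖ * ‖a x‖ + ‖A‖ * ‖c x‖)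
    · exact Filter.Eventually.of_forall fun n => (hDc n).aestronglyMeasurable
    · refine Filter.Eventually.of_forall fun n => Filter.Eventually.of_forall fun x _ => ?_
      refine (norm_add_le _ _).trans (add_le_add ?_ ?_)
      · exact (B.le_opNorm _).trans (mul_le_mul_of_nonneg_left (norm_proj_le _ _) (norm_nonneg _))
      · exact (A.le_opNorm _).trans (mul_le_mul_of_nonneg_left (norm_proj_le _ _) (norm_nonneg _))
    · exact ((continuous_const.mul ha.norm).add (continuous_const.mul hc.norm)).intervalIntegrable
        _ _
    · exact Filter.Eventually.of_forall fun x _ =>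
        ((B.continuous.tendsto _).comp (tendsto_proj (a x))).add
          ((A.continuous.tendsto _).comp (tendsto_proj (c x)))
  have hcont : Continuous (fun x => B (a x) + A (c x)) :=
    (B.continuous.comp ha).add (A.continuous.comp hc)
  have heq : ∀ τ, A (z τ) = A (z 0) + ∫ x in (0 : ℝ)..τ, (B (a x) + A (c x)) := by
    intro τ
    have h1 := hlim τ
    simp_rw [hint] at h1
    have h2 := ((A.continuous.tendsto _).comp (tendsto_proj (z τ))).sub
      ((A.continuous.tendsto _).comp (tendsto_proj (z 0)))
    -- The limit n → ∞ is taken in the integrated equation; differentiability returns from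
    -- continuity of the limiting integrand.
    rw [tendsto_nhds_unique h1 h2]
    ring
  have hd := ((hcont.integral_hasStrictDerivAt 0 t).hasDerivAt).const_add (A (z 0))
  exact hd.congr_of_eventuallyEq (Filter.Eventually.of_forall heq)

end Weak

section Schwartz

/-- A real power of the bracket is dominated by a natural power, which is a polynomial and acts on
Schwartz functions. -/
theorem memLp_mul_schwartz {q : ℝ → ℂ} (hq : Measurable q) {C e : ℝ}
    (hC : ∀ η, ‖q η‖ ≤ C * (1 + (2 * Real.pi * η) ^ 2) ^ e) (ψ : 𝓢(ℝ, ℂ)) :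
    MemLp (fun η => q η * ψ η) 2 volume := by
  obtain ⟨N, hN⟩ := exists_nat_ge e
  set w : ℝ → ℝ := fun η => (1 + (2 * Real.pi * η) ^ 2) ^ N with hw
  have hwt : Function.HasTemperateGrowth w := by fun_prop
  refine ((SchwartzMap.smulLeftCLM ℂ w ψ).memLp 2 volume).of_le_mul (c := |C|)
    (hq.aestronglyMeasurable.mul ψ.continuous.aestronglyMeasurable)
    (Filter.Eventually.of_forall fun η => ?_)
  rw [SchwartzMap.smulLeftCLM_apply_apply hwt, norm_smul, norm_mul, ← mul_assoc]
  refine mul_le_mul_of_nonneg_right ((hC η).trans ?_) (norm_nonneg _)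
  have h1 : 0 < 1 + (2 * Real.pi * η) ^ 2 := bracket_pos _
  rw [hw, Real.norm_of_nonneg (by positivity)]
  have h2 : (1 + (2 * Real.pi * η) ^ 2) ^ e ≤ (1 + (2 * Real.pi * η) ^ 2) ^ N := by
    rw [← Real.rpow_natCast _ N]
    exact Real.rpow_le_rpow_of_exponent_le (one_le_bracket _) hN
  calc C * (1 + (2 * Real.pi * η) ^ 2) ^ e ≤ |C| * (1 + (2 * Real.pi * η) ^ 2) ^ e := by
        gcongr
        exact le_abs_self C
    _ ≤ _ := by gcongr

theorem fourierInv_derivCLM (φ : 𝓢(ℝ, ℂ)) (η : ℝ) :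
    (𝓕⁻ (SchwartzMap.derivCLM ℂ ℂ φ) : 𝓢(ℝ, ℂ)) η
      = -(Complex.I * (2 * Real.pi * η : ℝ)) * (𝓕⁻ φ : 𝓢(ℝ, ℂ)) η := by
  have hd : (SchwartzMap.derivCLM ℂ ℂ φ : ℝ → ℂ) = deriv φ := by
    ext x
    exact SchwartzMap.derivCLM_apply ℂ φ x
  have hi : Integrable (deriv φ) := by
    rw [← hd]
    exact (SchwartzMap.derivCLM ℂ ℂ φ).integrable
  rw [SchwartzMap.fourierInv_coe, SchwartzMap.fourierInv_coe, Real.fourierInv_eq_fourier_neg,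
    Real.fourierInv_eq_fourier_neg, hd, Real.fourier_deriv φ.integrable φ.differentiable hi]
  simp only [smul_eq_mul]
  push_cast
  ring

end Schwartz

section Equations

variable {ρ r p : ℝ} {l b : ℝ → ℝ}

theorem IsEllipticSymbol.norm_mul_le {k : ℝ} {m : ℝ → ℝ} (hm : IsEllipticSymbol m k) (e : ℝ) :
    ∃ C, ∀ η : ℝ, ‖(((2 * Real.pi * η) * m (2 * Real.pi * η) ^ e : ℝ) : ℂ)‖
      ≤ C * (1 + (2 * Real.pi * η) ^ 2) ^ (1 / 2 + k * e / 2) := by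
  obtain ⟨c, C, hc, hC, h⟩ := hm.rpow_bounds e
  refine ⟨C, fun η => ?_⟩
  set ξ := 2 * Real.pi * η
  have hmp := hm.pos ξ
  rw [Complex.norm_real, Real.norm_eq_abs, abs_mul, abs_of_pos (Real.rpow_pos_of_pos hmp _),
    Real.rpow_add (bracket_pos _), mul_left_comm]
  exact mul_le_mul (abs_le_bracket_rpow ξ) (h ξ).2 (by positivity) (by positivity)

theorem IsEllipticSymbol.norm_rpow_le {k : ℝ} {m : ℝ → ℝ} (hm : IsEllipticSymbol m k) (e : ℝ) :
    ∃ C, ∀ η : ℝ, ‖((m (2 * Real.pi * η) ^ e : ℝ) : ℂ)‖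
      ≤ C * (1 + (2 * Real.pi * η) ^ 2) ^ (k * e / 2) := by
  obtain ⟨c, C, hc, hC, h⟩ := hm.rpow_bounds e
  refine ⟨C, fun η => ?_⟩
  have hmp := hm.pos (2 * Real.pi * η)
  rw [Complex.norm_real, Real.norm_of_nonneg (by positivity)]
  exact (h _).2

theorem symB_mul (hl : IsEllipticSymbol l ρ) (η : ℝ) :
    symB b η = l (2 * Real.pi * η) ^ (1 / 2 : ℝ) * symK l b η := by
  have h1 := hl.rpow_neg_half_mul (2 * Real.pi * η)
  rw [symB, symK]
  linear_combination (-b (2 * Real.pi * η) ^ (1 / 2 : ℝ)) * h1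

theorem symOm_mul_rpow (hl : IsEllipticSymbol l ρ) (η : ℝ) :
    symOm l η * l (2 * Real.pi * η) ^ (1 / 2 : ℝ) = 2 * Real.pi * η * l (2 * Real.pi * η) := by
  have e2 : l (2 * Real.pi * η) ^ (1 / 2 : ℝ) * l (2 * Real.pi * η) ^ (1 / 2 : ℝ)
      = l (2 * Real.pi * η) := by
    rw [← Real.rpow_add (hl.pos _)]
    norm_num
  rw [symOm]
  linear_combination (2 * Real.pi * η) * e2

/-- Symbol form of L^(1/2) M = ∂ₓ B: the force in the equation for y becomes the force in the
equation for w. -/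
theorem symK_sq_mul (hl : IsEllipticSymbol l ρ) (hb : IsEllipticSymbol b (-r)) (η : ℝ) :
    symK l b η ^ 2 * symOm l η * l (2 * Real.pi * η) ^ (1 / 2 : ℝ)
      = 2 * Real.pi * η * b (2 * Real.pi * η) := by
  have h1 := hl.rpow_neg_half_mul (2 * Real.pi * η)
  have e2 : b (2 * Real.pi * η) ^ (1 / 2 : ℝ) * b (2 * Real.pi * η) ^ (1 / 2 : ℝ)
      = b (2 * Real.pi * η) := by
    rw [← Real.rpow_add (hb.pos _)]
    norm_num
  rw [symOm, symK]
  set x := l (2 * Real.pi * η) ^ (1 / 2 : ℝ)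
  set y := l (2 * Real.pi * η) ^ (-(1 / 2) : ℝ)
  set z := b (2 * Real.pi * η) ^ (1 / 2 : ℝ)
  linear_combination (2 * Real.pi * η * z ^ 2 * (y * x + 1)) * h1 + (2 * Real.pi * η) * e2

/-- This is w = L^(1/2) y with y = K W, the link between the original system and the symmetric one.
-/
theorem FT_opB (hr : 0 ≤ r) (hρ : 0 ≤ ρ) (hl : IsEllipticSymbol l ρ) (hb : IsEllipticSymbol b (-r))
    (W : RealL2) : ∀ᵐ η, FT (opB b W) η
      = (l (2 * Real.pi * η) ^ (1 / 2 : ℝ) : ℝ) * FT (opK (symK l b) W) η := by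
  have h1 : IsSymbol (fun η => (symB b η : ℂ)) :=
    (isSmoothing_symB (ρ := 0) hb).isSymbol (by rw [s₀]; linarith)
  have h2 : IsSymbol (fun η => (symK l b η : ℂ)) :=
    (isSmoothing_symK hl hb).isSymbol (by rw [s₀]; linarith)
  filter_upwards [FT_mulOp h1 W, FT_mulOp h2 W] with η e1 e2
  rw [opB, opK, e1, e2, symB_mul hl]
  push_cast
  ring

/-- The weak form of `u_t = w_x` in Fourier variables. -/
theorem neg_pairing_derivCLM (w : RealL2) (φ : 𝓢(ℝ, ℂ)) :
    -pairing w (SchwartzMap.derivCLM ℂ ℂ φ)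
      = ∫ η, FT w η * (Complex.I * (2 * Real.pi * η : ℝ) * (𝓕⁻ φ : 𝓢(ℝ, ℂ)) η) := by
  rw [pairing_eq_integral_FT, ← integral_neg]
  congr 1
  ext η
  rw [fourierInv_derivCLM]
  ring

theorem neg_multiplierPairing_derivCLM (m : ℝ → ℝ) (u : RealL2) (φ : 𝓢(ℝ, ℂ)) :
    -multiplierPairing m u (SchwartzMap.derivCLM ℂ ℂ φ)
      = ∫ η, FT u η * (Complex.I * (2 * Real.pi * η * m (2 * Real.pi * η) : ℝ)
        * (𝓕⁻ φ : 𝓢(ℝ, ℂ)) η) := by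
  rw [multiplierPairing, ← integral_neg]
  congr 1
  ext η
  rw [fourierInv_derivCLM, FT_apply]
  push_cast
  ring

theorem hasDerivAt_pairing (hρ : 0 ≤ ρ) (hr : 0 ≤ r) (hl : IsEllipticSymbol l ρ)
    (hb : IsEllipticSymbol b (-r)) (h : IsAdmissible (s₀ ρ r) (symK l b) (symOm l))
    {U W N : ℝ → RealL2} (hU : Continuous U) (hW : Continuous W) (hN : Continuous N)
    (hband : ∀ (n : ℕ) (t : ℝ),
        HasDerivAt (fun τ => proj n (opK (symK l b) (U τ)))
          (opOm (symOm l) n (opK (symK l b) (W t))) t ∧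
        HasDerivAt (fun τ => proj n (opK (symK l b) (W τ)))
          (opOm (symOm l) n (opK (symK l b) (U t)) + proj n (opM (symK l b) (symOm l) (N t))) t)
    (φ : 𝓢(ℝ, ℂ)) (t : ℝ) :
    HasDerivAt (fun τ => pairing (opK (symK l b) (U τ)) φ)
      (-pairing (opB b (W t)) (SchwartzMap.derivCLM ℂ ℂ φ)) t ∧
    HasDerivAt (fun τ => pairing (opB b (W τ)) φ)
      (-multiplierPairing l (opK (symK l b) (U t)) (SchwartzMap.derivCLM ℂ ℂ φ)
        - multiplierPairing b (N t) (SchwartzMap.derivCLM ℂ ℂ φ)) t := by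
  set ψ : 𝓢(ℝ, ℂ) := 𝓕⁻ φ with hψ
  have hKU : Continuous (fun t => opK (symK l b) (U t)) := (opK _).continuous.comp hU
  have hKW : Continuous (fun t => opK (symK l b) (W t)) := (opK _).continuous.comp hW
  have hlm : Measurable (fun η : ℝ => ((l (2 * Real.pi * η) ^ (1 / 2 : ℝ) : ℝ) : ℂ)) :=
    Complex.measurable_ofReal.comp (hl.measurable_rpow _)
  have hom : Measurable (fun η : ℝ => Complex.I * (symOm l η : ℂ)) :=
    h.isLocSymbol_om.measurable
  constructor
  · have hm1 : MemLp (fun η => Complex.I * symOm l η * ψ η) 2 volume := by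
      obtain ⟨C, hC⟩ := hl.norm_mul_le (1 / 2)
      exact memLp_mul_schwartz hom (fun η => by simpa [symOm] using hC η) ψ
    have key := h.hasDerivAt_weak (ψ.memLp 2 volume) hm1 hKW (continuous_const (y := (0 : RealL2)))
      (fun n τ => by simpa using (hband n τ).1) t
    simp only [pairing_eq_integral_FT]
    rw [← pairing_eq_integral_FT]
    convert! key using 1
    rw [neg_pairing_derivCLM]
    have e0 : ∫ η, FT (0 : RealL2) η * ψ η = 0 := by
      rw [map_zero]
      apply integral_eq_zero_of_ae
      filter_upwards [Lp.coeFn_zero ℂ 2 (volume : Measure ℝ)] with η hη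
      rw [hη]
      simp
    rw [e0, add_zero]
    apply integral_congr_ae
    filter_upwards [FT_opB hr hρ hl hb (W t)] with η hη
    rw [hη, ← hψ, symOm]
    push_cast
    ring
  · set χ : ℝ → ℂ := fun η => ((l (2 * Real.pi * η) ^ (1 / 2 : ℝ) : ℝ) : ℂ) * ψ η with hχ
    have hm0 : MemLp χ 2 volume := by
      obtain ⟨C, hC⟩ := hl.norm_rpow_le (1 / 2)
      exact memLp_mul_schwartz hlm hC ψ
    have hm1 : MemLp (fun η => Complex.I * symOm l η * χ η) 2 volume := by
      obtain ⟨C, hC⟩ := hl.norm_mul_le 1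
      have := memLp_mul_schwartz (hom.mul hlm) (C := C) (e := 1 / 2 + ρ * 1 / 2) (fun η => by
        refine le_trans (le_of_eq ?_) (hC η)
        rw [Real.rpow_one, ← symOm_mul_rpow hl, Pi.mul_apply, Complex.ofReal_mul, norm_mul,
          norm_mul, norm_mul, Complex.norm_I, one_mul]) ψ
      simpa only [hχ, Pi.mul_apply, mul_assoc] using this
    have hM : Continuous (fun t => opM (symK l b) (symOm l) (N t)) :=
      (opM _ _).continuous.comp hN
    have key := h.hasDerivAt_weak hm0 hm1 hKU hM (fun n τ => (hband n τ).2) t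
    have e1 : ∀ τ, pairing (opB b (W τ)) φ
        = ∫ η, FT (opK (symK l b) (W τ)) η * χ η := by
      intro τ
      rw [pairing_eq_integral_FT]
      apply integral_congr_ae
      filter_upwards [FT_opB hr hρ hl hb (W τ)] with η hη
      rw [hη, hχ]
      ring
    simp only [e1]
    convert! key using 1
    rw [sub_eq_add_neg, neg_multiplierPairing_derivCLM, neg_multiplierPairing_derivCLM]
    congr 1
    · congr 1
      ext η
      rw [hχ, ← symOm_mul_rpow hl]
      push_cast
      ring
    · apply integral_congr_ae
      filter_upwards [FT_mulOp h.isSymbol_kap_sq_om (N t)] with η hη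
      rw [opM, hη, hχ, ← symK_sq_mul hl hb]
      push_cast
      ring

end Equations

/-! ### Uniqueness on frequency bands -/

section Uniqueness

variable {s p : ℝ} {kap om : ℝ → ℝ}

theorem proj_proj (n : ℕ) (u : RealL2) : proj n (proj n u) = proj n u :=
  mulOp_mulOp (isSymbol_band_one n) (isSymbol_band_one n)
    (fun η => by unfold band; split_ifs <;> simp) u

/-- The weak equation tested with smooth functions of compact support gives the equation on every
frequency band. -/
theorem IsAdmissible.hasDerivAt_proj_of_weak (h : IsAdmissible s kap om) {b : ℝ}
    {z a c : ℝ → RealL2} (hz : Continuous z) (ha : Continuous a) (hc : Continuous c)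
    (hw : ∀ ψ : ℝ → ℝ, ContDiff ℝ ∞ ψ → HasCompactSupport ψ → ∀ t ∈ Set.Ioo 0 b,
      HasDerivAt (fun τ => ∫ η, FT (z τ) η * ψ η)
        ((∫ η, FT (a t) η * (Complex.I * om η * ψ η)) + ∫ η, FT (c t) η * ψ η) t)
    (n : ℕ) {t : ℝ} (ht : t ∈ Set.Ioo 0 b) :
    HasDerivAt (fun τ => proj n (z τ)) (opOm om n (a t) + proj n (c t)) t := by
  set D : ℝ → RealL2 := fun τ => opOm om n (a τ) + proj n (c τ) with hD
  have hDc : Continuous D :=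
    ((opOm om n).continuous.comp ha).add ((proj n).continuous.comp hc)
  have key : ∀ τ ∈ Set.Icc 0 b, proj n (z τ) = proj n (z 0) + ∫ x in (0 : ℝ)..τ, D x := by
    intro τ hτ
    -- The defect of the integrated equation is band-limited, so it suffices to test its transform
    -- with bumps supported inside the open band. There the projections act trivially on the tests.
    set X := proj n (z τ) - (proj n (z 0) + ∫ x in (0 : ℝ)..τ, D x) with hX
    have hXp : proj n X = X := by
      have e1 : proj n (∫ x in (0 : ℝ)..τ, D x) = ∫ x in (0 : ℝ)..τ, D x := by
        rw [← ContinuousLinearMap.intervalIntegral_comp_comm _ (hDc.intervalIntegrable _ _)]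
        congr 1
        ext1 x
        rw [hD, map_add, h.proj_opOm le_rfl, proj_proj]
      rw [hX, map_sub, map_add, e1, proj_proj, proj_proj]
    have hX0 : ∀ᵐ η, η ∈ {η : ℝ | |η| < n} → FT X η = 0 := by
      apply (isOpen_lt continuous_abs continuous_const).ae_eq_zero_of_integral_contDiff_smul_eq_zero
        ((locallyIntegrable_L2 (FT X)).locallyIntegrableOn _)
      intro ψ hψ hψs hψn
      have hψm : MemLp (fun η => (ψ η : ℂ)) 2 volume :=
        (Complex.continuous_ofReal.comp hψ.continuous).memLp_of_hasCompactSupport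
          (hψs.comp_left (g := Complex.ofReal) rfl)
      obtain ⟨A, hA⟩ := exists_functional hψm
      have hoff : ∀ η : ℝ, ¬ |η| < n → ψ η = 0 := fun η hη =>
        image_eq_zero_of_notMem_tsupport fun hmem => hη (hψn hmem)
      have hAp : ∀ u, A (proj n u) = A u := by
        intro u
        rw [hA, hA, integral_FT_proj_mul]
        congr 1
        ext η
        unfold band
        split_ifs with hη
        · rfl
        · rw [hoff η hη]
          simp
      have hAo : ∀ u, A (opOm om n u) = ∫ η, FT u η * (Complex.I * om η * ψ η) := by
        intro u
        rw [hA]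
        apply integral_congr_ae
        filter_upwards [FT_mulOp (h.isLocSymbol_om.band n) u] with η h1
        rw [opOm, h1]
        unfold band
        split_ifs with hη
        · ring
        · rw [hoff η hη]
          simp
      have hAD : ∀ x, A (D x) = (∫ η, FT (a x) η * (Complex.I * om η * ψ η))
          + ∫ η, FT (c x) η * ψ η := by
        intro x
        rw [hD, map_add, hAo, hAp, hA]
      have hint : ∫ x in (0 : ℝ)..τ, A (D x) = A (z τ) - A (z 0) := by
        -- Only continuity is needed at the endpoints, so the equation need not hold at time 0.
        apply intervalIntegral.integral_eq_sub_of_hasDerivAt_of_le hτ.1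
          (A.continuous.comp hz).continuousOn
        · intro x hx
          have := hw ψ hψ hψs x ⟨hx.1, hx.2.trans_le hτ.2⟩
          rw [← hAD] at this
          simp_rw [← hA] at this
          exact this
        · exact (A.continuous.comp hDc).intervalIntegrable _ _
      have e2 : ∫ η, ψ η • FT X η = A X := by
        rw [hA]
        congr 1
        ext η
        rw [Complex.real_smul, mul_comm]
      rw [e2, hX, map_sub, map_add, hAp, hAp,
        ← ContinuousLinearMap.intervalIntegral_comp_comm _ (hDc.intervalIntegrable _ _), hint]
      ring
    have : X = 0 := by
      apply FT_ext
      rw [map_zero]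
      filter_upwards [hX0, FT_proj n X, Lp.coeFn_zero ℂ 2 (volume : Measure ℝ)] with η h1 h2 h3
      rw [h3, Pi.zero_apply]
      by_cases hη : |η| < n
      · exact h1 hη
      · rw [hXp] at h2
        rw [h2, if_neg hη]
    exact sub_eq_zero.mp this
  have hd := ((hDc.integral_hasStrictDerivAt 0 t).hasDerivAt).const_add (proj n (z 0))
  refine hd.congr_of_eventuallyEq ?_
  filter_upwards [Ioo_mem_nhds ht.1 ht.2] with τ hτ
  exact key τ (Set.Ioo_subset_Icc_self hτ)

/-- A nonnegative continuous function bounded by a multiple of its primitive vanishes. -/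
theorem eq_zero_of_le_integral {e : ℝ → ℝ} {L b : ℝ} (he : Continuous e) (h0 : ∀ t, 0 ≤ e t)
    (hL : 0 ≤ L) (hle : ∀ t ∈ Set.Icc 0 b, e t ≤ L * ∫ x in (0 : ℝ)..t, e x) :
    ∀ t ∈ Set.Icc 0 b, e t = 0 := by
  intro t ht
  have hd : ∀ t, HasDerivAt (fun t => ∫ x in (0 : ℝ)..t, e x) (e t) t := fun t =>
    (he.integral_hasStrictDerivAt 0 t).hasDerivAt
  have hF : ∀ t ∈ Set.Icc 0 b, 0 ≤ ∫ x in (0 : ℝ)..t, e x := fun t ht =>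
    intervalIntegral.integral_nonneg ht.1 fun x _ => h0 x
  have := norm_le_gronwallBound_of_norm_deriv_right_le (f := fun t => ∫ x in (0 : ℝ)..t, e x)
    (f' := e) (δ := 0) (K := L) (ε := 0) (a := 0) (b := b)
    (fun x _ => (hd x).continuousAt.continuousWithinAt) (fun x _ => (hd x).hasDerivWithinAt)
    (by simp) (fun x hx => by
      have hx' := Set.Ico_subset_Icc_self hx
      rw [Real.norm_of_nonneg (h0 x), Real.norm_of_nonneg (hF x hx'), add_zero]
      exact hle x hx') t ht
  rw [gronwallBound_ε0_δ0, Real.norm_of_nonneg (hF t ht)] at this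
  have h1 := hle t ht
  have h2 := mul_nonpos_of_nonneg_of_nonpos hL this
  exact le_antisymm (h1.trans h2) (h0 t)

/-- Uniqueness for the equation on all frequency bands. -/
theorem IsAdmissible.unique_of_band (h : IsAdmissible s kap om) {b L : ℝ} (hL : 0 ≤ L)
    {u₁ y₁ c₁ u₂ y₂ c₂ : ℝ → RealL2} (hu₁ : Continuous u₁) (hy₁ : Continuous y₁)
    (hc₁ : Continuous c₁) (hu₂ : Continuous u₂) (hy₂ : Continuous y₂) (hc₂ : Continuous c₂)
    (hlip : ∀ t, ‖c₁ t - c₂ t‖ ≤ L * ‖u₁ t - u₂ t‖) (hu0 : u₁ 0 = u₂ 0) (hy0 : y₁ 0 = y₂ 0)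
    (hband₁ : ∀ n : ℕ, ∀ t ∈ Set.Ioo 0 b,
      HasDerivAt (fun τ => proj n (u₁ τ)) (opOm om n (y₁ t)) t ∧
      HasDerivAt (fun τ => proj n (y₁ τ)) (opOm om n (u₁ t) + proj n (c₁ t)) t)
    (hband₂ : ∀ n : ℕ, ∀ t ∈ Set.Ioo 0 b,
      HasDerivAt (fun τ => proj n (u₂ τ)) (opOm om n (y₂ t)) t ∧
      HasDerivAt (fun τ => proj n (y₂ τ)) (opOm om n (u₂ t) + proj n (c₂ t)) t) :
    ∀ t ∈ Set.Icc 0 b, u₁ t = u₂ t ∧ y₁ t = y₂ t := by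
  set v : ℝ → RealL2 := fun t => u₁ t - u₂ t with hv
  set y : ℝ → RealL2 := fun t => y₁ t - y₂ t with hy
  set c : ℝ → RealL2 := fun t => c₁ t - c₂ t with hc
  have hvc : Continuous v := hu₁.sub hu₂
  have hyc : Continuous y := hy₁.sub hy₂
  have hcc : Continuous c := hc₁.sub hc₂
  set e : ℝ → ℝ := fun t => ‖v t‖ ^ 2 + ‖y t‖ ^ 2 with he
  have hec : Continuous e := (hvc.norm.pow 2).add (hyc.norm.pow 2)
  have hder : ∀ n : ℕ, ∀ t ∈ Set.Ioo 0 b,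
      HasDerivAt (fun τ => ‖proj n (v τ)‖ ^ 2 + ‖proj n (y τ)‖ ^ 2)
        (2 * inner ℝ (proj n (y t)) (c t)) t := by
    intro n t ht
    have h1 : HasDerivAt (fun τ => proj n (v τ)) (opOm om n (y t)) t := by
      have := (hband₁ n t ht).1.sub (hband₂ n t ht).1
      simp only [hv, hy, map_sub]
      exact this
    have h2 : HasDerivAt (fun τ => proj n (y τ)) (opOm om n (v t) + proj n (c t)) t := by
      have := (hband₁ n t ht).2.sub (hband₂ n t ht).2
      rw [add_sub_add_comm] at this
      simp only [hv, hy, hc, map_sub]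
      exact this
    convert! h1.norm_sq.add h2.norm_sq using 1
    -- The two linear contributions cancel by skewness of `opOm`; only the difference of the forces
    -- is left.
    rw [inner_add_right, inner_proj n (v t), inner_proj n (y t) (opOm om n (v t)),
      h.proj_opOm le_rfl, h.proj_opOm le_rfl, ← inner_proj n (proj n (y t)), proj_proj,
      real_inner_comm (opOm om n (v t)) (y t), h.inner_opOm]
    ring
  have hlen : ∀ n : ℕ, ∀ t ∈ Set.Icc 0 b, ‖proj n (v t)‖ ^ 2 + ‖proj n (y t)‖ ^ 2
      ≤ L * ∫ x in (0 : ℝ)..t, e x := by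
    intro n t ht
    have hint : ∫ x in (0 : ℝ)..t, 2 * inner ℝ (proj n (y x)) (c x)
        = (‖proj n (v t)‖ ^ 2 + ‖proj n (y t)‖ ^ 2)
          - (‖proj n (v 0)‖ ^ 2 + ‖proj n (y 0)‖ ^ 2) := by
      apply intervalIntegral.integral_eq_sub_of_hasDerivAt_of_le
        (f := fun τ => ‖proj n (v τ)‖ ^ 2 + ‖proj n (y τ)‖ ^ 2) ht.1
      · exact ((((proj n).continuous.comp hvc).norm.pow 2).add
          (((proj n).continuous.comp hyc).norm.pow 2)).continuousOn
      · exact fun x hx => hder n x ⟨hx.1, hx.2.trans_le ht.2⟩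
      · exact (continuous_const.mul (((proj n).continuous.comp hyc).inner hcc)).intervalIntegrable
          _ _
    have hv0 : v 0 = 0 := sub_eq_zero.mpr hu0
    have hy0' : y 0 = 0 := sub_eq_zero.mpr hy0
    rw [hv0, hy0', map_zero, norm_zero] at hint
    have h1 : ‖proj n (v t)‖ ^ 2 + ‖proj n (y t)‖ ^ 2
        = ∫ x in (0 : ℝ)..t, 2 * inner ℝ (proj n (y x)) (c x) := by
      rw [hint]
      ring
    rw [h1, ← intervalIntegral.integral_const_mul]
    apply intervalIntegral.integral_mono_on ht.1
    · exact (continuous_const.mul (((proj n).continuous.comp hyc).inner hcc)).intervalIntegrable _ _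
    · exact (continuous_const.mul hec).intervalIntegrable _ _
    · intro x _
      have i1 := real_inner_le_norm (proj n (y x)) (c x)
      have i2 : ‖proj n (y x)‖ * ‖c x‖ ≤ ‖y x‖ * (L * ‖v x‖) :=
        mul_le_mul (norm_proj_le _ _) (hlip x) (norm_nonneg _) (norm_nonneg _)
      have i3 := mul_nonneg hL (sq_nonneg (‖v x‖ - ‖y x‖))
      simp only [he]
      nlinarith
  have hle : ∀ t ∈ Set.Icc 0 b, e t ≤ L * ∫ x in (0 : ℝ)..t, e x := by
    intro t ht
    -- The right hand side does not depend on the band, so the estimate passes to the full norms and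
    -- Grönwall applies to e.
    refine le_of_tendsto (((tendsto_proj (v t)).norm.pow 2).add ((tendsto_proj (y t)).norm.pow 2))
      (Filter.Eventually.of_forall fun n => hlen n t ht)
  intro t ht
  have := eq_zero_of_le_integral hec (fun t => by positivity) hL hle t ht
  have h1 : ‖v t‖ ^ 2 = 0 := by nlinarith [sq_nonneg ‖v t‖, sq_nonneg ‖y t‖]
  have h2 : ‖y t‖ ^ 2 = 0 := by nlinarith [sq_nonneg ‖v t‖, sq_nonneg ‖y t‖]
  exact ⟨sub_eq_zero.mp (norm_eq_zero.mp (pow_eq_zero_iff two_ne_zero |>.mp h1)),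
    sub_eq_zero.mp (norm_eq_zero.mp (pow_eq_zero_iff two_ne_zero |>.mp h2))⟩

end Uniqueness

/-! ### Solutions of the Cauchy problem -/

section Solutions

variable {s ρ r p : ℝ} {l b : ℝ → ℝ} {T : EReal} {u₀ w₀ : RealL2}

theorem IsSmoothing.continuousInSobolev {a : ℝ → ℝ} (ha : IsSmoothing s a) (hs : 0 ≤ s)
    {U : ℝ → RealL2} (hU : Continuous U) (T : EReal) :
    ContinuousInSobolev s T (fun t => mulOp (fun η => (a η : ℂ)) (U t)) := by
  obtain ⟨c, C, hc, hC, h⟩ := ha.sobolevNorm_equiv hs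
  refine ⟨fun t _ _ => ha.memSobolev_mulOp hs _, fun t _ _ => ?_⟩
  have h1 : Filter.Tendsto (fun τ => C * ‖U τ - U t‖) (nhds t) (nhds 0) := by
    have := (((hU.sub (continuous_const (y := U t))).norm).const_mul C).tendsto t
    simpa using this
  refine squeeze_zero (fun τ => Real.sqrt_nonneg _) (fun τ => ?_)
    (h1.mono_left nhdsWithin_le_nhds)
  rw [← map_sub]
  exact (h _).1

/-- On a compact time interval a continuous curve in a Sobolev space is the image of a bounded
continuous curve in `L²`. -/
theorem IsSmoothing.exists_continuous_lift {a : ℝ → ℝ} (ha : IsSmoothing s a) (hs : 0 ≤ s)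
    {u : ℝ → RealL2} (hu : ContinuousInSobolev s T u) {β : ℝ} (hβ : 0 ≤ β) (hβT : (β : EReal) < T) :
    ∃ U : ℝ → RealL2, Continuous U ∧ (∃ M, ∀ t, ‖U t‖ ≤ M) ∧
      ∀ t ∈ Set.Icc 0 β, u t = mulOp (fun η => (a η : ℂ)) (U t) := by
  obtain ⟨c, C, hc, hC, h⟩ := ha.sobolevNorm_equiv hs
  have hT : ∀ t ∈ Set.Icc 0 β, (t : EReal) < T := fun t ht =>
    (EReal.coe_le_coe_iff.mpr ht.2).trans_lt hβT
  have hex : ∀ t : ℝ, ∃ V, t ∈ Set.Icc 0 β → u t = mulOp (fun η => (a η : ℂ)) V := by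
    intro t
    by_cases ht : t ∈ Set.Icc 0 β
    · obtain ⟨V, hV⟩ := ha.exists_eq_mulOp hs (hu.1 t ht.1 (hT t ht))
      exact ⟨V, fun _ => hV⟩
    · exact ⟨0, fun h => absurd h ht⟩
  choose V hV using hex
  have hVc : ContinuousOn V (Set.Icc 0 β) := by
    intro t ht
    have h1 := (hu.2 t ht.1 (hT t ht)).mono_left
      (nhdsWithin_mono t (fun τ hτ => ⟨hτ.1, hT τ hτ⟩ : Set.Icc 0 β ⊆ {τ : ℝ | 0 ≤ τ ∧ (τ : EReal) < T}))
    have h2 := h1.const_mul c⁻¹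
    rw [mul_zero] at h2
    refine tendsto_iff_norm_sub_tendsto_zero.mpr (squeeze_zero' (Filter.Eventually.of_forall
      fun _ => norm_nonneg _) ?_ h2)
    filter_upwards [self_mem_nhdsWithin] with τ hτ
    rw [hV τ hτ, hV t ht, ← map_sub, ← div_eq_inv_mul, le_div_iff₀ hc, mul_comm]
    exact (h _).2
  obtain ⟨M, hM⟩ := isCompact_Icc.exists_bound_of_continuousOn hVc
  -- Constant extension beyond the interval gives a curve that is continuous and bounded on the
  -- whole line, as the band lemmas require.
  refine ⟨Set.IccExtend hβ (Set.domRestrict (Set.Icc 0 β) V), hVc.domRestrict.Icc_extend',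
    ⟨M, fun t => hM _ (Set.projIcc 0 β hβ t).2⟩, fun t ht => ?_⟩
  rw [Set.IccExtend_of_mem hβ _ ht]
  exact hV t ht

/-- The frequency-side weak equations of a solution. -/
theorem IsSolution.hasDerivAt_weak (hρ : 0 ≤ ρ) (hr : 0 ≤ r) (hl : IsEllipticSymbol l ρ)
    (hb : IsEllipticSymbol b (-r)) (h : IsAdmissible (s₀ ρ r) (symK l b) (symOm l))
    {u w : ℝ → RealL2} (hsol : IsSolution l b ρ r p u₀ w₀ T u w) {β : ℝ} (hβT : (β : EReal) < T)
    {W : ℝ → RealL2} (hW : ∀ t ∈ Set.Icc 0 β, w t = opB b (W t))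
    {ψ : ℝ → ℝ} (hψ : ContDiff ℝ ∞ ψ) (hψs : HasCompactSupport ψ) {t : ℝ} (ht : t ∈ Set.Ioo 0 β) :
    HasDerivAt (fun τ => ∫ η, FT (u τ) η * ψ η)
      (∫ η, FT (opK (symK l b) (W t)) η * (Complex.I * symOm l η * ψ η)) t ∧
    HasDerivAt (fun τ => ∫ η, FT (opK (symK l b) (W τ)) η * ψ η)
      ((∫ η, FT (u t) η * (Complex.I * symOm l η * ψ η))
        + ∫ η, FT (opM (symK l b) (symOm l) (gL2 p (u t))) η * ψ η) t := by
  have htT : (t : EReal) < T := (EReal.coe_lt_coe_iff.mpr ht.2).trans hβT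
  have hmk : ∀ χ : ℝ → ℝ, ContDiff ℝ ∞ χ → HasCompactSupport χ →
      ∃ φ : 𝓢(ℝ, ℂ), ∀ η, (𝓕⁻ φ : 𝓢(ℝ, ℂ)) η = χ η := by
    intro χ hχ hχs
    have h1 : ContDiff ℝ ∞ (fun x => (χ x : ℂ)) := Complex.ofRealCLM.contDiff.comp hχ
    have h2 : HasCompactSupport (fun x => (χ x : ℂ)) := hχs.comp_left (g := Complex.ofReal) rfl
    refine ⟨𝓕 (h2.toSchwartzMap h1), fun η => ?_⟩
    rw [FourierTransform.fourierInv_fourier_eq]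
    rfl
  constructor
  · obtain ⟨φ, hφ⟩ := hmk ψ hψ hψs
    have key := hsol.eq_u φ t ht.1 htT
    simp only [neg_pairing_derivCLM, hφ] at key
    have e1 : ∀ τ, pairing (u τ) φ = ∫ η, FT (u τ) η * ψ η := fun τ => by
      simp only [pairing_eq_integral_FT, hφ]
    simp only [e1] at key
    convert! key using 1
    rw [hW t (Set.Ioo_subset_Icc_self ht)]
    apply integral_congr_ae
    filter_upwards [FT_opB hr hρ hl hb (W t)] with η hη
    rw [hη, symOm]
    push_cast
    ring
  -- The equation for y = L^(-1/2) w is the equation for w tested with l^(-1/2) ψ, still smooth with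
  -- compact support because l is smooth and positive.
  · have hlc : ContDiff ℝ ∞ (fun η : ℝ => l (2 * Real.pi * η) ^ (-(1 / 2) : ℝ)) :=
      (hl.smooth.comp (contDiff_const.mul contDiff_id)).rpow_const_of_ne fun x => (hl.pos _).ne'
    obtain ⟨φ, hφ⟩ := hmk _ (hlc.mul hψ) hψs.mul_left
    have hll : ∀ η : ℝ, ((l (2 * Real.pi * η) ^ (-(1 / 2) : ℝ) : ℝ) : ℂ)
        * ((l (2 * Real.pi * η) ^ (1 / 2 : ℝ) : ℝ) : ℂ) = 1 := fun η => by
      rw [← Complex.ofReal_mul, hl.rpow_neg_half_mul, Complex.ofReal_one]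
    have key := hsol.eq_w φ t ht.1 htT
    rw [sub_eq_add_neg] at key
    simp only [neg_multiplierPairing_derivCLM, hφ] at key
    have e1 : ∀ τ ∈ Set.Icc 0 β, ∫ η, FT (opK (symK l b) (W τ)) η * ψ η = pairing (w τ) φ := by
      intro τ hτ
      simp only [pairing_eq_integral_FT, hφ]
      rw [hW τ hτ]
      apply integral_congr_ae
      filter_upwards [FT_opB hr hρ hl hb (W τ)] with η hη
      rw [hη]
      push_cast
      linear_combination (-(FT (opK (symK l b) (W τ)) η * ψ η)) * hll η
    have key2 := key.congr_of_eventuallyEq (f₁ := fun τ =>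
      ∫ η, FT (opK (symK l b) (W τ)) η * ψ η) (by
        filter_upwards [Ioo_mem_nhds ht.1 ht.2] with τ hτ
        exact e1 τ (Set.Ioo_subset_Icc_self hτ))
    convert! key2 using 1
    congr 1
    · congr 1
      ext η
      rw [← symOm_mul_rpow hl]
      push_cast
      linear_combination (-(FT (u t) η * Complex.I * symOm l η * ψ η)) * hll η
    · apply integral_congr_ae
      filter_upwards [FT_mulOp h.isSymbol_kap_sq_om (gL2 p (u t))] with η hη
      rw [opM, hη, ← symK_sq_mul hl hb]
      push_cast
      linear_combination (-(FT (gL2 p (u t)) η * Complex.I * symK l b η ^ 2 * symOm l η * ψ η))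
        * hll η

/-- Uniqueness for the Cauchy problem. -/
theorem IsSolution.unique (hρ : 0 ≤ ρ) (hr : 0 ≤ r) (hl : IsEllipticSymbol l ρ)
    (hb : IsEllipticSymbol b (-r)) (h : IsAdmissible (s₀ ρ r) (symK l b) (symOm l))
    (hg : ContDiff ℝ 1 (g p)) {T₁ T₂ : EReal} {u₁ w₁ u₂ w₂ : ℝ → RealL2}
    (h₁ : IsSolution l b ρ r p u₀ w₀ T₁ u₁ w₁) (h₂ : IsSolution l b ρ r p u₀ w₀ T₂ u₂ w₂)
    {β : ℝ} (hβ : 0 ≤ β) (hβ₁ : (β : EReal) < T₁) (hβ₂ : (β : EReal) < T₂) :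
    u₁ β = u₂ β ∧ w₁ β = w₂ β := by
  have hsK := isSmoothing_symK (ρ := ρ) (r := r) hl hb
  have hsB := isSmoothing_symB (ρ := ρ) (r := r) hb
  have hs0 : 0 ≤ s₀ ρ r := h.s_nonneg
  have hs1 : 0 ≤ s₀ ρ r - ρ / 2 := by rw [s₀]; linarith
  obtain ⟨U₁, hU₁c, ⟨M₁, hM₁⟩, hU₁⟩ := hsK.exists_continuous_lift hs0 h₁.continuous_u hβ hβ₁
  obtain ⟨W₁, hW₁c, -, hW₁⟩ := hsB.exists_continuous_lift hs1 h₁.continuous_w hβ hβ₁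
  obtain ⟨U₂, hU₂c, ⟨M₂, hM₂⟩, hU₂⟩ := hsK.exists_continuous_lift hs0 h₂.continuous_u hβ hβ₂
  obtain ⟨W₂, hW₂c, -, hW₂⟩ := hsB.exists_continuous_lift hs1 h₂.continuous_w hβ hβ₂
  change ∀ t ∈ Set.Icc 0 β, u₁ t = opK (symK l b) (U₁ t) at hU₁
  change ∀ t ∈ Set.Icc 0 β, u₂ t = opK (symK l b) (U₂ t) at hU₂
  change ∀ t ∈ Set.Icc 0 β, w₁ t = opB b (W₁ t) at hW₁
  change ∀ t ∈ Set.Icc 0 β, w₂ t = opB b (W₂ t) at hW₂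
  obtain ⟨C, hC0, hC⟩ := exists_sup_bound_mulOp h.isSymbol_kap (h.smoothing.memLp h.half_lt)
  change ∀ U, ∀ᵐ x, |opK (symK l b) U x| ≤ C * ‖U‖ at hC
  -- A common sup bound for both solutions on [0, β], so that one truncation represents g along
  -- both.
  set R := C * max M₁ M₂ with hR
  have hR0 : 0 ≤ R := mul_nonneg hC0 ((norm_nonneg _).trans ((hM₁ 0).trans (le_max_left _ _)))
  obtain ⟨K, hK⟩ := exists_lipschitzWith_gTrunc hg hR0
  have h0 : gTrunc p R 0 = 0 := gTrunc_zero hR0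
  have hg₁ : ∀ t, gL2 p (opK (symK l b) (U₁ t)) = hK.compLp h0 (opK (symK l b) (U₁ t)) := fun t =>
    gL2_eq_compLp hK h0 ((hC (U₁ t)).mono fun x hx =>
      hx.trans (mul_le_mul_of_nonneg_left ((hM₁ t).trans (le_max_left _ _)) hC0))
  have hg₂ : ∀ t, gL2 p (opK (symK l b) (U₂ t)) = hK.compLp h0 (opK (symK l b) (U₂ t)) := fun t =>
    gL2_eq_compLp hK h0 ((hC (U₂ t)).mono fun x hx =>
      hx.trans (mul_le_mul_of_nonneg_left ((hM₂ t).trans (le_max_right _ _)) hC0))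
  have hband : ∀ (T : EReal) (u w U W : ℝ → RealL2), IsSolution l b ρ r p u₀ w₀ T u w →
      (β : EReal) < T → Continuous U → Continuous W →
      (∀ t ∈ Set.Icc 0 β, u t = opK (symK l b) (U t)) → (∀ t ∈ Set.Icc 0 β, w t = opB b (W t)) →
      (∀ t, gL2 p (opK (symK l b) (U t)) = hK.compLp h0 (opK (symK l b) (U t))) →
      ∀ n : ℕ, ∀ t ∈ Set.Ioo 0 β,
        HasDerivAt (fun τ => proj n (opK (symK l b) (U τ)))
          (opOm (symOm l) n (opK (symK l b) (W t))) t ∧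
        HasDerivAt (fun τ => proj n (opK (symK l b) (W τ)))
          (opOm (symOm l) n (opK (symK l b) (U t))
            + proj n (opM (symK l b) (symOm l) (hK.compLp h0 (opK (symK l b) (U t))))) t := by
    intro T u w U W hsol hβT hUc hWc hU hW hgU n t ht
    have hKU : Continuous (fun t => opK (symK l b) (U t)) := (opK _).continuous.comp hUc
    have hKW : Continuous (fun t => opK (symK l b) (W t)) := (opK _).continuous.comp hWc
    have hN : Continuous (fun t =>
        opM (symK l b) (symOm l) (hK.compLp h0 (opK (symK l b) (U t)))) :=
      (opM _ _).continuous.comp ((hK.continuous_compLp h0).comp hKU)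
    constructor
    · have := h.hasDerivAt_proj_of_weak hKU hKW (continuous_const (y := (0 : RealL2)))
        (fun ψ hψ hψs τ hτ => by
          have h1 := (hsol.hasDerivAt_weak hρ hr hl hb h hβT hW hψ hψs hτ).1
          have h2 : ∫ η, FT (0 : RealL2) η * ψ η = 0 := by
            rw [map_zero]
            apply integral_eq_zero_of_ae
            filter_upwards [Lp.coeFn_zero ℂ 2 (volume : Measure ℝ)] with η hη
            rw [hη]
            simp
          rw [h2, add_zero]
          refine h1.congr_of_eventuallyEq ?_
          filter_upwards [Ioo_mem_nhds hτ.1 hτ.2] with x hx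
          rw [hU x (Set.Ioo_subset_Icc_self hx)]) n ht
      simpa using this
    · refine h.hasDerivAt_proj_of_weak hKW hKU hN (fun ψ hψ hψs τ hτ => ?_) n ht
      have h1 := (hsol.hasDerivAt_weak hρ hr hl hb h hβT hW hψ hψs hτ).2
      rwa [hU τ (Set.Ioo_subset_Icc_self hτ), hgU] at h1
  have hmem : β ∈ Set.Icc 0 β := ⟨hβ, le_rfl⟩
  have hmem0 : (0 : ℝ) ∈ Set.Icc 0 β := ⟨le_rfl, hβ⟩
  have hBinj : Function.Injective (opB b) :=
    mulOp_injective (hsB.isSymbol hs1) fun η => by exact_mod_cast (hsB.pos η).ne'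
  have hu0 : opK (symK l b) (U₁ 0) = opK (symK l b) (U₂ 0) := by
    rw [← hU₁ 0 hmem0, ← hU₂ 0 hmem0, h₁.init_u, h₂.init_u]
  have hw0 : W₁ 0 = W₂ 0 := by
    apply hBinj
    rw [← hW₁ 0 hmem0, ← hW₂ 0 hmem0, h₁.init_w, h₂.init_w]
  have hcont : ∀ {V : ℝ → RealL2}, Continuous V → Continuous (fun t => opK (symK l b) (V t)) :=
    fun hV => (opK _).continuous.comp hV
  have hcontN : ∀ {V : ℝ → RealL2}, Continuous V → Continuous (fun t =>
      opM (symK l b) (symOm l) (hK.compLp h0 (opK (symK l b) (V t)))) :=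
    fun hV => (opM _ _).continuous.comp ((hK.continuous_compLp h0).comp (hcont hV))
  -- Comparison in L² is enough: the truncated force is Lipschitz there, and injectivity of K and
  -- equality of the preimages then return w.
  have key := h.unique_of_band (L := ‖opM (symK l b) (symOm l)‖ * K) (by positivity)
    (hcont hU₁c) (hcont hW₁c) (hcontN hU₁c) (hcont hU₂c) (hcont hW₂c) (hcontN hU₂c)
    (fun t => by
      rw [← map_sub, mul_assoc]
      refine ((opM _ _).le_opNorm _).trans (mul_le_mul_of_nonneg_left ?_ (norm_nonneg _))
      exact hK.norm_compLp_sub_le h0 _ _)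
    hu0 (by rw [hw0])
    (hband T₁ u₁ w₁ U₁ W₁ h₁ hβ₁ hU₁c hW₁c hU₁ hW₁ hg₁)
    (hband T₂ u₂ w₂ U₂ W₂ h₂ hβ₂ hU₂c hW₂c hU₂ hW₂ hg₂) β hmem
  refine ⟨by rw [hU₁ β hmem, hU₂ β hmem, key.1], ?_⟩
  rw [hW₁ β hmem, hW₂ β hmem, h.opK_injective key.2]

/-- Global solutions exist for initial data in `Σ₊`. -/
theorem exists_isSolution_top (hρ : 0 ≤ ρ) (hr : 0 ≤ r) (hp : 1 < p) (hl : IsEllipticSymbol l ρ)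
    (hb : IsEllipticSymbol b (-r)) (h : IsAdmissible (s₀ ρ r) (symK l b) (symOm l))
    (hg : ContDiff ℝ 1 (g p)) (h₀ : (u₀, w₀) ∈ SigmaPlus l b ρ r p) :
    ∃ u w, IsSolution l b ρ r p u₀ w₀ ⊤ u w := by
  have hs0 : 0 ≤ s₀ ρ r := h.s_nonneg
  have hs1 : 0 ≤ s₀ ρ r - ρ / 2 := by rw [s₀]; linarith
  obtain ⟨hm, hE, hQ⟩ := h₀
  obtain ⟨U₀, W₀, rfl, rfl⟩ := exists_of_memEnergySpace hs0 hr hl hb hm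
  dsimp only at hE hQ
  rw [energy_opK_opB hs0 hr hl hb] at hE
  rw [two_mul_I_opK hs0 hl hb, sub_nonneg] at hQ
  obtain ⟨U, W, hU, hW, hU0, hW0, hN, hband⟩ := h.exists_global_solution hp hg
    (fun U W => depth_le hs0 hr hp hl hb U W) hE hQ
  have hder := hasDerivAt_pairing hρ hr hl hb h hU hW hN hband
  exact ⟨fun t => opK (symK l b) (U t), fun t => opB b (W t),
    { pos := EReal.zero_lt_top
      continuous_u := (isSmoothing_symK hl hb).continuousInSobolev hs0 hU ⊤
      continuous_w := (isSmoothing_symB hb).continuousInSobolev hs1 hW ⊤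
      eq_u := fun φ t _ _ => (hder φ t).1
      eq_w := fun φ t _ _ => (hder φ t).2
      init_u := by rw [hU0]
      init_w := by rw [hW0] }⟩

end Solutions

end

end NonlocalWave

theorem theorem3p3 (l b : ℝ → ℝ) (ρ r p : ℝ)
    (hρ : 0 ≤ ρ) (hr : 0 ≤ r) (hp : 1 < p)
    (hl : NonlocalWave.IsEllipticSymbol l ρ) (hb : NonlocalWave.IsEllipticSymbol b (-r))
    (hρr : 1 ≤ r + ρ / 2) (hne : ¬ (ρ = 0 ∧ r = 1))
    (hg : ContDiff ℝ ((⌊NonlocalWave.s₀ ρ r⌋₊ + 1 : ℕ) : WithTop ℕ∞) (NonlocalWave.g p))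
    (u₀ w₀ : NonlocalWave.RealL2)
    (h₀ : (u₀, w₀) ∈ NonlocalWave.SigmaPlus l b ρ r p) :
    NonlocalWave.maximalTime l b ρ r p u₀ w₀ = ⊤ ∧
    ∃ u w : ℝ → NonlocalWave.RealL2,
      NonlocalWave.IsSolution l b ρ r p u₀ w₀ ⊤ u w ∧
      ∀ (T : EReal) (u' w' : ℝ → NonlocalWave.RealL2),
        NonlocalWave.IsSolution l b ρ r p u₀ w₀ T u' w' →
        ∀ t : ℝ, 0 ≤ t → (t : EReal) < T → u' t = u t ∧ w' t = w t := by
  have h := NonlocalWave.isAdmissible hρ hr hl hb hρr hne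
  have hg1 : ContDiff ℝ 1 (NonlocalWave.g p) := hg.of_le (by
    exact_mod_cast Nat.le_add_left 1 _)
  obtain ⟨u, w, hsol⟩ := NonlocalWave.exists_isSolution_top hρ hr hp hl hb h hg1 h₀
  refine ⟨eq_top_iff.mpr (le_sSup ⟨u, w, hsol⟩), u, w, hsol, fun T u' w' hsol' t ht htT => ?_⟩
  exact hsol'.unique hρ hr hl hb h hg1 hsol ht htT (EReal.coe_lt_top t)
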